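/- Let $\Phi$ be the standard normal distribution function and $\Lambda(x)=\exp(-e^{-x})$. For $\lambda\in(0,\infty)$ let $$H_\lambda(x,y)=\exp\Bigl(-\Phi\bigl(\lambda+\tfrac{x-y}{2\lambda}\bigr)e^{-y}-\Phi\bigl(\lambda+\tfrac{y-x}{2\lambda}\bigr)e^{-x}\Bigr),\qquad x,y\in\mathbb R,$$ and let $H_0(x,y)=\min(\Lambda(x),\Lambda(y))$, $H_\infty(x,y)=\Lambda(x)\Lambda(y)$. Put $u_n(s)=a_ns+b_n$ with $a_n=(2\ln n)^{-1/2}$ and $b_n=\sqrt{2\ln n}-\frac{\ln(4\pi\ln n)}{2\sqrt{2\ln n}}$. Let $\{(X^{(1)}_{n,k},X^{(2)}_{n,k}):1\le k\le n,\ n\ge1\}$ be a triangular array of jointly Gaussian random variables (jointly over all rows) with mean zero and variance one such that $$\mathrm{corr}(X^{(1)}_{n,k},X^{(2)}_{n,k})=\rho_0(n),\qquad \mathrm{corr}(X^{(i)}_{n,k},X^{(j)}_{n,l})=\rho_{ij}(|k-l|,n)\quad(1\le k\ne l\le n,\ i,j\in\{1,2\}),$$ and, for elements of different rows, $$\mathrm{corr}(X^{(i)}_{m,k},X^{(j)}_{n,l})=\gamma_{ij}(|k-l|+1,m,n)\quad(1\le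 k\le m,\ 1\le l\le n,\ m<n,\ i,j\in\{1,2\}).$$ Assume: 1. $\sigma:=\sup_{1\le k<n,\ i,j}|\rho_{ij}(k,n)|<1$, and for some $\alpha\in(0,\frac{1-\sigma}{1+\sigma})$, with $I_n=\lfloor n^\alpha\rfloor$, $\lim_{n\to\infty}\max_{I_n\le k<n;\ i,j}|\rho_{ij}(k,n)|\ln n=0$; 2. $\lim_{n\to\infty}(1-\rho_0(n))\ln n=\lambda^2$ with $\lambda\in[0,\infty]$; 3. $\theta:=\sup_{1\le t\le n,\ 1\le m<n,\ i,j}|\gamma_{ij}(t,m,n)|<1$, and, for some $\beta\in(0,\frac{1-\theta}{1+\theta})$ and $\epsilon>0$, with $J_n=\lfloor n^\beta\rfloor$, as $n\to\infty$, $$\max_{I_n\le s<n;\ i,j}|\rho_{ij}(s,n)|\ln s\,(\ln\ln s)^{1+\epsilon}=O(1),\qquad \max_{1\le m<n}\ \max_{J_n\le t\le n;\ i,j}|\gamma_{ij}(t,m,n)|\ln t\,(\ln\ln t)^{1+\epsilon}=O(1).$$ Let $M^{(i)}_n=\max_{1\le k\le n}X^{(i)}_{n,k}$ and $m^{(i)}_n=\min_{1\le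 k\le n}X^{(i)}_{n,k}$. Then for all $x,y\in\mathbb R$, almost surely $$\lim_{n\to\infty}\frac1{\ln n}\sum_{k=1}^n\frac1k\mathbf 1\bigl(M^{(1)}_k\le u_k(x),\,M^{(2)}_k\le u_k(y)\bigr)=H_\lambda(x,y).$$ Furthermore, provided that, in the case $\lambda=\infty$, also $(1+\rho_0(n))\ln n\to\infty$, for all $x_1,x_2,y_1,y_2\in\mathbb R$, almost surely $$\lim_{n\to\infty}\frac1{\ln n}\sum_{k=1}^n\frac1k\mathbf 1\bigl(-u_k(y_1)<m^{(1)}_k\le M^{(1)}_k\le u_k(x_1),\,-u_k(y_2)<m^{(2)}_k\le M^{(2)}_k\le u_k(x_2)\bigr)=H_\lambda(x_1,x_2)H_\lambda(y_1,y_2).$$ -/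

import Mathlib

open MeasureTheory ProbabilityTheory Filter Topology
open scoped ENNReal

noncomputable section

namespace HuslerReiss

/-- The standard normal distribution function `Φ`. -/
def stdNormalCDF (x : ℝ) : ℝ := cdf (gaussianReal 0 1) x

/-- The Gumbel distribution function `Λ`. -/
def gumbel (x : ℝ) : ℝ := Real.exp (-Real.exp (-x))

/-- The Hüsler–Reiss distribution function `H_lam`, for a parameter `lam ∈ [0, ∞]`. -/
def hrCDF (lam : ℝ≥0∞) (x y : ℝ) : ℝ :=
  if lam = 0 then min (gumbel x) (gumbel y)
  else if lam = ⊤ then gumbel x * gumbel y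
  else Real.exp
    (-(stdNormalCDF (lam.toReal + (x - y) / (2 * lam.toReal)) * Real.exp (-y))
      - stdNormalCDF (lam.toReal + (y - x) / (2 * lam.toReal)) * Real.exp (-x))

/-- The scale constant `a_n`. -/
def scaleConst (n : ℕ) : ℝ := 1 / √(2 * Real.log n)

/-- The location constant `b_n`. -/
def locConst (n : ℕ) : ℝ :=
  √(2 * Real.log n) - 1 / (2 * √(2 * Real.log n)) * Real.log (4 * Real.pi * Real.log n)

/-- The level `u_n(s) = a_n s + b_n`. -/
def level (n : ℕ) (s : ℝ) : ℝ := scaleConst n * s + locConst n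

/-- The distance `|k - l|` of two positions. -/
def gap (k l : ℕ) : ℕ := ((k : ℤ) - (l : ℤ)).natAbs

/-- The positions `(n, k)`, `1 ≤ k ≤ n`, of a triangular array. -/
def Position : Type := {p : ℕ × ℕ // 1 ≤ p.2 ∧ p.2 ≤ p.1}

section Array

variable {Ω : Type*} [MeasurableSpace Ω]

/-- The correlation coefficient of two real random variables. -/
def corr (P : Measure Ω) (Y Z : Ω → ℝ) : ℝ :=
  cov[Y, Z; P] / (√(Var[Y; P]) * √(Var[Z; P]))

/-- `X n k i` is the component `i` of the vector at position `k` of row `n`; only the entries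
with `1 ≤ k ≤ n` matter. The entries are jointly Gaussian, centred and of variance one; inside
row `n` the two components of a vector have correlation `ρ₀ n`, and entries at different
positions `k`, `l` have correlation `ρ i j |k - l| n`. -/
structure IsStationaryGaussianArray (P : Measure Ω) (X : ℕ → ℕ → Fin 2 → Ω → ℝ)
    (ρ₀ : ℕ → ℝ) (ρ : Fin 2 → Fin 2 → ℕ → ℕ → ℝ) : Prop where
  gaussian : IsGaussianProcess
    (fun (t : Position × Fin 2) (ω : Ω) => X t.1.1.1 t.1.1.2 t.2 ω) P
  mean_zero : ∀ n k, 1 ≤ k → k ≤ n → ∀ i, ∫ ω, X n k i ω ∂P = 0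
  unit_variance : ∀ n k, 1 ≤ k → k ≤ n → ∀ i, Var[X n k i; P] = 1
  corr_same : ∀ n k, 1 ≤ k → k ≤ n → corr P (X n k 0) (X n k 1) = ρ₀ n
  corr_row : ∀ n k l, 1 ≤ k → k ≤ n → 1 ≤ l → l ≤ n → k ≠ l →
    ∀ i j, corr P (X n k i) (X n l j) = ρ i j (gap k l) n

/-- Entries of different rows `m < n` have correlation `γ i j (|k - l| + 1) m n`. -/
def HasCrossRowCorr (P : Measure Ω) (X : ℕ → ℕ → Fin 2 → Ω → ℝ)
    (γ : Fin 2 → Fin 2 → ℕ → ℕ → ℕ → ℝ) : Prop :=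
  ∀ m n k l, m < n → 1 ≤ k → k ≤ m → 1 ≤ l → l ≤ n →
    ∀ i j, corr P (X m k i) (X n l j) = γ i j (gap k l + 1) m n

/-- The row maximum `M_n^{(i)}` (used for `n ≥ 1`). -/
def rowMax (X : ℕ → ℕ → Fin 2 → Ω → ℝ) (n : ℕ) (i : Fin 2) (ω : Ω) : ℝ :=
  sSup ((fun k => X n k i ω) '' Set.Icc 1 n)

/-- The row minimum `m_n^{(i)}` (used for `n ≥ 1`). -/
def rowMin (X : ℕ → ℕ → Fin 2 → Ω → ℝ) (n : ℕ) (i : Fin 2) (ω : Ω) : ℝ :=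
  sInf ((fun k => X n k i ω) '' Set.Icc 1 n)

/-- The event `{M_k^{(1)} ≤ u_k(x), M_k^{(2)} ≤ u_k(y)}`. -/
def maxEvent (X : ℕ → ℕ → Fin 2 → Ω → ℝ) (k : ℕ) (x y : ℝ) : Set Ω :=
  {ω | rowMax X k 0 ω ≤ level k x ∧ rowMax X k 1 ω ≤ level k y}

/-- The event
`{-u_k(y₁) < m_k^{(1)} ≤ M_k^{(1)} ≤ u_k(x₁), -u_k(y₂) < m_k^{(2)} ≤ M_k^{(2)} ≤ u_k(x₂)}`. -/
def maxMinEvent (X : ℕ → ℕ → Fin 2 → Ω → ℝ) (k : ℕ) (x₁ x₂ y₁ y₂ : ℝ) : Set Ω :=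
  {ω | (-level k y₁ < rowMin X k 0 ω ∧ rowMin X k 0 ω ≤ rowMax X k 0 ω ∧
        rowMax X k 0 ω ≤ level k x₁) ∧
       (-level k y₂ < rowMin X k 1 ω ∧ rowMin X k 1 ω ≤ rowMax X k 1 ω ∧
        rowMax X k 1 ω ≤ level k x₂)}

/-- The logarithmic average `(1 / ln n) ∑_{k=1}^n (1 / k) 1_{A_k}(ω)`. -/
def logAverage (A : ℕ → Set Ω) (n : ℕ) (ω : Ω) : ℝ :=
  1 / Real.log n * ∑ k ∈ Finset.Icc 1 n, 1 / (k : ℝ) * (A k).indicator (fun _ => (1 : ℝ)) ω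

end Array

/-- `[n ^ α]`, the integer part. -/
def powFloor (α : ℝ) (n : ℕ) : ℕ := ⌊(n : ℝ) ^ α⌋₊

/-- `σ = sup |ρ_ij(k, n)|` over `1 ≤ k < n`, `n ≥ 2` and `i, j`. -/
def IsRowSup (ρ : Fin 2 → Fin 2 → ℕ → ℕ → ℝ) (σ : ℝ) : Prop :=
  IsLUB {r | ∃ i j k n, 1 ≤ k ∧ k < n ∧ r = |ρ i j k n|} σ

/-- `θ = sup |γ_ij(t, m, n)|` over `1 ≤ t ≤ n`, `1 ≤ m < n` and `i, j`. -/
def IsCrossSup (γ : Fin 2 → Fin 2 → ℕ → ℕ → ℕ → ℝ) (θ : ℝ) : Prop :=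
  IsLUB {r | ∃ i j t m n, 1 ≤ t ∧ t ≤ n ∧ 1 ≤ m ∧ m < n ∧ r = |γ i j t m n|} θ

/-- The Berman condition `max_{[n^α] ≤ k < n; i, j} |ρ_ij(k, n)| ln n → 0`. -/
def BermanCondition (ρ : Fin 2 → Fin 2 → ℕ → ℕ → ℝ) (α : ℝ) : Prop :=
  ∀ δ > 0, ∀ᶠ n : ℕ in atTop, ∀ i j k, powFloor α n ≤ k → k < n →
    |ρ i j k n| * Real.log n ≤ δ

/-- `max_{[n^α] ≤ s < n} |ρ_ij(s, n)| ln s (ln ln s)^{1+ε} = O(1)` as `n → ∞`. -/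
def RowRate (ρ : Fin 2 → Fin 2 → ℕ → ℕ → ℝ) (α ε : ℝ) : Prop :=
  ∃ C : ℝ, ∀ᶠ n : ℕ in atTop, ∀ i j s, powFloor α n ≤ s → s < n →
    |ρ i j s n| * Real.log s * Real.log (Real.log s) ^ (1 + ε) ≤ C

/-- `max_{[n^β] ≤ t ≤ n} |γ_ij(t, m, n)| ln t (ln ln t)^{1+ε} = O(1)` as `n → ∞`,
uniformly in `1 ≤ m < n`. -/
def CrossRate (γ : Fin 2 → Fin 2 → ℕ → ℕ → ℕ → ℝ) (β ε : ℝ) : Prop :=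
  ∃ C : ℝ, ∀ᶠ n : ℕ in atTop, ∀ m, 1 ≤ m → m < n → ∀ i j t, powFloor β n ≤ t → t ≤ n →
    |γ i j t m n| * Real.log t * Real.log (Real.log t) ^ (1 + ε) ≤ C

end HuslerReiss

end

/-!
Rotating a Gaussian vector towards a vector in which its blocks are replaced by independent copies,
and integrating by parts, bounds the resulting change of a window probability by a sum of terms
`|r| * exp (-(u ^ 2 + v ^ 2) / (2 * (1 + |r|)))` over the pairs of coordinates of different blocks.
Inside a row, Berman's condition makes this sum vanish, so the row behaves like `n` independent
pairs; conditioning a pair on one of its coordinates shows that the `n`-th power of the pair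
probability tends to the Hüsler–Reiss distribution function. Two rows taken as two blocks give
covariances of order `(log (log n)) ^ (-(1 + ε))`. These make the second moments of the centred
logarithmic averages summable along a doubly exponential subsequence, and the monotonicity of the
logarithmic sums fills the gaps.
-/

noncomputable section

namespace HuslerReiss

/-! ### Normal distribution function and Gaussian pairs -/

section StdNormal

lemma inv_sqrt_two_pi_le_one : (√(2 * Real.pi))⁻¹ ≤ 1 := by
  refine inv_le_one_of_one_le₀ (Real.one_le_sqrt.2 ?_)
  linarith [Real.pi_gt_three]

lemma gaussianPDFReal_zero_one (x : ℝ) :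
    gaussianPDFReal 0 1 x = (√(2 * Real.pi))⁻¹ * Real.exp (-x ^ 2 / 2) := by
  simp [gaussianPDFReal]

lemma hasDerivAt_gaussianPDFReal_zero_one (x : ℝ) :
    HasDerivAt (gaussianPDFReal 0 1) (-x * gaussianPDFReal 0 1 x) x := by
  have hexp : HasDerivAt (fun x : ℝ => -x ^ 2 / 2) (-(2 * x) / 2) x := by
    simpa using (hasDerivAt_pow 2 x).neg.div_const 2
  rw [gaussianPDFReal_zero_one, funext gaussianPDFReal_zero_one]
  exact (hexp.exp.const_mul (√(2 * Real.pi))⁻¹).congr_deriv (by ring)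

lemma continuous_gaussianPDFReal_zero_one : Continuous (gaussianPDFReal 0 1) :=
  continuous_iff_continuousAt.2 fun x => (hasDerivAt_gaussianPDFReal_zero_one x).continuousAt

lemma gaussianPDFReal_zero_one_le_one (x : ℝ) : gaussianPDFReal 0 1 x ≤ 1 := by
  rw [gaussianPDFReal_zero_one]
  refine mul_le_one₀ inv_sqrt_two_pi_le_one (Real.exp_pos _).le (Real.exp_le_one_iff.2 ?_)
  linarith [sq_nonneg x]

lemma abs_mul_gaussianPDFReal_zero_one_le_one (x : ℝ) : |x * gaussianPDFReal 0 1 x| ≤ 1 := by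
  have habs : |x| ≤ Real.exp (x ^ 2 / 2) := by
    nlinarith [Real.add_one_le_exp (x ^ 2 / 2), sq_nonneg (|x| - 1), sq_abs x]
  rw [abs_mul, abs_of_nonneg (gaussianPDFReal_nonneg _ _ _), gaussianPDFReal_zero_one]
  calc |x| * ((√(2 * Real.pi))⁻¹ * Real.exp (-x ^ 2 / 2))
      ≤ Real.exp (x ^ 2 / 2) * (1 * Real.exp (-x ^ 2 / 2)) := by
        gcongr
        exact inv_sqrt_two_pi_le_one
    _ = 1 := by rw [one_mul, ← Real.exp_add, neg_div, add_neg_cancel, Real.exp_zero]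

lemma stdNormalCDF_eq_integral (x : ℝ) :
    stdNormalCDF x = ∫ t in Set.Iic x, gaussianPDFReal 0 1 t := by
  rw [stdNormalCDF, cdf_eq_real, Measure.real, gaussianReal_apply_eq_integral 0 one_ne_zero,
    ENNReal.toReal_ofReal (integral_nonneg fun t => gaussianPDFReal_nonneg _ _ _)]

lemma hasDerivAt_stdNormalCDF (x : ℝ) :
    HasDerivAt stdNormalCDF (gaussianPDFReal 0 1 x) x := by
  have hint := integrable_gaussianPDFReal 0 1
  have heq : stdNormalCDF =
      fun x => stdNormalCDF 0 + ∫ t in (0 : ℝ)..x, gaussianPDFReal 0 1 t := by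
    funext x
    rw [stdNormalCDF_eq_integral, stdNormalCDF_eq_integral,
      ← intervalIntegral.integral_Iic_sub_Iic hint.integrableOn hint.integrableOn]
    ring
  rw [heq]
  exact (intervalIntegral.integral_hasDerivAt_right hint.intervalIntegrable
    (stronglyMeasurable_gaussianPDFReal 0 1).stronglyMeasurableAtFilter
    continuous_gaussianPDFReal_zero_one.continuousAt).const_add _

lemma continuous_stdNormalCDF : Continuous stdNormalCDF :=
  continuous_iff_continuousAt.2 fun x => (hasDerivAt_stdNormalCDF x).continuousAt

lemma stdNormalCDF_nonneg (x : ℝ) : 0 ≤ stdNormalCDF x := cdf_nonneg _ _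

lemma stdNormalCDF_le_one (x : ℝ) : stdNormalCDF x ≤ 1 := cdf_le_one _ _

lemma integrable_id_mul_gaussianPDFReal_zero_one :
    Integrable fun x : ℝ => x * gaussianPDFReal 0 1 x := by
  have h := (memLp_id_gaussianReal (μ := 0) (v := 1) 1).integrable le_rfl
  rw [gaussianReal_of_var_ne_zero _ one_ne_zero, integrable_withDensity_iff
    (measurable_gaussianPDF 0 1) (Eventually.of_forall fun x => gaussianPDF_lt_top)] at h
  simpa only [id_eq, toReal_gaussianPDF] using h

lemma integral_id_mul_gaussianReal_zero_one {G G' : ℝ → ℝ} (hG : ∀ x, HasDerivAt G (G' x) x)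
    (hG' : Continuous G') {C C' : ℝ} (hC : ∀ x, |G x| ≤ C) (hC' : ∀ x, |G' x| ≤ C') :
    ∫ w, w * G w ∂gaussianReal 0 1 = ∫ w, G' w ∂gaussianReal 0 1 := by
  have hGc : Continuous G := continuous_iff_continuousAt.2 fun x => (hG x).continuousAt
  have hpdf := integrable_gaussianPDFReal 0 1
  have hid : Integrable fun x : ℝ => -x * gaussianPDFReal 0 1 x := by
    simpa only [neg_mul] using integrable_id_mul_gaussianPDFReal_zero_one.fun_neg
  have hparts := integral_mul_deriv_eq_deriv_mul_of_integrable (fun x _ => hG x)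
    (fun x _ => hasDerivAt_gaussianPDFReal_zero_one x)
    (hid.bdd_mul hGc.aestronglyMeasurable (Eventually.of_forall hC))
    (hpdf.bdd_mul hG'.aestronglyMeasurable (Eventually.of_forall hC'))
    (hpdf.bdd_mul hGc.aestronglyMeasurable (Eventually.of_forall hC))
  rw [integral_gaussianReal_eq_integral_smul one_ne_zero,
    integral_gaussianReal_eq_integral_smul one_ne_zero]
  calc ∫ x, gaussianPDFReal 0 1 x • (x * G x)
      = -∫ x, G x * (-x * gaussianPDFReal 0 1 x) := by
        rw [← integral_neg]
        exact integral_congr_ae (.of_forall fun x => by simp only [smul_eq_mul]; ring)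
    _ = ∫ x, gaussianPDFReal 0 1 x • G' x := by
        rw [hparts, neg_neg]
        exact integral_congr_ae (.of_forall fun x => by simp only [smul_eq_mul]; ring)

end StdNormal

/-- The centred Gaussian law on the plane with unit variances and correlation `r ∈ [-1, 1]`.
The correlation carries its weight on the first coordinate, so that the law disintegrates over
the second one. -/
def bivGaussian (r : ℝ) : Measure (ℝ × ℝ) :=
  ((gaussianReal 0 1).prod (gaussianReal 0 1)).map
    fun p => (r * p.1 + √(1 - r ^ 2) * p.2, p.1)

instance (r : ℝ) : IsProbabilityMeasure (bivGaussian r) :=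
  Measure.isProbabilityMeasure_map (by fun_prop)

/-- `(U, V)` is a centred Gaussian pair with unit variances and covariance `r`. -/
structure IsStdPair {Ω : Type*} [MeasurableSpace Ω] (P : Measure Ω) (U V : Ω → ℝ) (r : ℝ) :
    Prop where
  gaussian : HasGaussianLaw (fun ω => (U ω, V ω)) P
  mean_fst : ∫ ω, U ω ∂P = 0
  mean_snd : ∫ ω, V ω ∂P = 0
  var_fst : Var[U; P] = 1
  var_snd : Var[V; P] = 1
  cov_eq : cov[U, V; P] = r

namespace IsStdPair

variable {Ω Ω' : Type*} [MeasurableSpace Ω] [MeasurableSpace Ω'] {P : Measure Ω} {P' : Measure Ω'}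
  {U V : Ω → ℝ} {U' V' : Ω' → ℝ} {r : ℝ}

lemma variance_lin (h : IsStdPair P U V r) (a b : ℝ) :
    Var[fun ω => a * U ω + b * V ω; P] = a ^ 2 + 2 * (a * b * r) + b ^ 2 := by
  have := h.gaussian.isProbabilityMeasure
  rw [variance_fun_add (h.gaussian.fst.memLp_two.const_mul a)
    (h.gaussian.snd.memLp_two.const_mul b), variance_const_mul, variance_const_mul,
    covariance_const_mul_left, covariance_const_mul_right, h.var_fst, h.var_snd, h.cov_eq]
  ring

lemma integral_lin (h : IsStdPair P U V r) (a b : ℝ) :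
    ∫ ω, (a * U ω + b * V ω) ∂P = 0 := by
  rw [integral_add (h.gaussian.fst.integrable.const_mul a) (h.gaussian.snd.integrable.const_mul b),
    integral_const_mul, integral_const_mul, h.mean_fst, h.mean_snd, mul_zero, mul_zero, add_zero]

lemma sq_le_one (h : IsStdPair P U V r) : r ^ 2 ≤ 1 := by
  have hnonneg := variance_nonneg (fun ω => 1 * U ω + (-r) * V ω) P
  rw [h.variance_lin] at hnonneg
  nlinarith

lemma abs_le_one (h : IsStdPair P U V r) : |r| ≤ 1 := (sq_le_one_iff_abs_le_one r).1 h.sq_le_one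

lemma neg_right (h : IsStdPair P U V r) : IsStdPair P U (fun ω => -V ω) (-r) where
  gaussian := h.gaussian.map_fun
    ((ContinuousLinearMap.fst ℝ ℝ ℝ).prod (-ContinuousLinearMap.snd ℝ ℝ ℝ))
  mean_fst := h.mean_fst
  mean_snd := by rw [integral_neg, h.mean_snd, neg_zero]
  var_fst := h.var_fst
  var_snd := by rw [variance_fun_neg, h.var_snd]
  cov_eq := by rw [covariance_fun_neg_right, h.cov_eq]

lemma swap (h : IsStdPair P U V r) : IsStdPair P V U r where
  gaussian := h.gaussian.map_fun
    ((ContinuousLinearMap.snd ℝ ℝ ℝ).prod (ContinuousLinearMap.fst ℝ ℝ ℝ))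
  mean_fst := h.mean_snd
  mean_snd := h.mean_fst
  var_fst := h.var_snd
  var_snd := h.var_fst
  cov_eq := by rw [covariance_comm, h.cov_eq]

lemma neg_neg (h : IsStdPair P U V r) : IsStdPair P (fun ω => -U ω) (fun ω => -V ω) r := by
  simpa only [_root_.neg_neg] using h.neg_right.swap.neg_right.swap

lemma map_eq_map (h : IsStdPair P U V r) (h' : IsStdPair P' U' V' r) :
    P.map (fun ω => (U ω, V ω)) = P'.map (fun ω => (U' ω, V' ω)) := by
  have := h.gaussian.isProbabilityMeasure
  have := h'.gaussian.isProbabilityMeasure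
  have := h.gaussian.isGaussian_map
  have := h'.gaussian.isGaussian_map
  refine Measure.ext_of_charFunDual (funext fun L => ?_)
  obtain ⟨a, b, hL⟩ : ∃ a b : ℝ, ∀ x y : ℝ, L (x, y) = a * x + b * y := by
    refine ⟨L (1, 0), L (0, 1), fun x y => ?_⟩
    have hxy : (x, y) = x • ((1 : ℝ), (0 : ℝ)) + y • ((0 : ℝ), (1 : ℝ)) := by simp
    rw [hxy, map_add, map_smul, map_smul, smul_eq_mul, smul_eq_mul, mul_comm x, mul_comm y]
  rw [h.gaussian.charFunDual_map_eq_fun, h'.gaussian.charFunDual_map_eq_fun]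
  simp only [hL, h.variance_lin, h'.variance_lin, h.integral_lin, h'.integral_lin]

lemma lin_left (h : IsStdPair P U V 0) (hr : r ^ 2 ≤ 1) :
    IsStdPair P (fun ω => r * U ω + √(1 - r ^ 2) * V ω) U r where
  gaussian := h.gaussian.map_fun ((r • ContinuousLinearMap.fst ℝ ℝ ℝ
    + √(1 - r ^ 2) • ContinuousLinearMap.snd ℝ ℝ ℝ).prod (ContinuousLinearMap.fst ℝ ℝ ℝ))
  mean_fst := h.integral_lin _ _
  mean_snd := h.mean_fst
  var_fst := by
    rw [h.variance_lin, Real.sq_sqrt (sub_nonneg.2 hr)]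
    ring
  var_snd := h.var_fst
  cov_eq := by
    have := h.gaussian.isProbabilityMeasure
    have hU := h.gaussian.fst.memLp_two
    have hV := h.gaussian.snd.memLp_two
    change cov[(fun ω => r * U ω) + (fun ω => √(1 - r ^ 2) * V ω), U; P] = r
    rw [covariance_add_left (hU.const_mul r) (hV.const_mul _) hU, covariance_const_mul_left,
      covariance_const_mul_left, covariance_self h.gaussian.fst.aemeasurable, h.var_fst,
      covariance_comm, h.cov_eq, mul_one, mul_zero, add_zero]

lemma fst_snd :
    IsStdPair ((gaussianReal 0 1).prod (gaussianReal 0 1)) Prod.fst Prod.snd 0 where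
  gaussian := IsGaussian.hasGaussianLaw_id
  mean_fst := by rw [integral_fun_fst fun x : ℝ => x]; simp
  mean_snd := by rw [integral_fun_snd fun x : ℝ => x]; simp
  var_fst := by
    have h := (measurePreserving_fst (μ := gaussianReal 0 1)
      (ν := gaussianReal 0 1)).variance_fun_comp (f := id) aemeasurable_id
    simpa using h
  var_snd := by
    have h := (measurePreserving_snd (μ := gaussianReal 0 1)
      (ν := gaussianReal 0 1)).variance_fun_comp (f := id) aemeasurable_id
    simpa using h
  cov_eq := covariance_fst_snd_prod (memLp_id_gaussianReal 2) (memLp_id_gaussianReal 2)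

lemma map_eq_bivGaussian (h : IsStdPair P U V r) :
    P.map (fun ω => (U ω, V ω)) = bivGaussian r :=
  h.map_eq_map (fst_snd.lin_left h.sq_le_one)

end IsStdPair

section BivGaussianDensity

lemma gaussianReal_map_affine (a b : ℝ) :
    (gaussianReal 0 1).map (fun w => a + b * w) = gaussianReal a (b ^ 2).toNNReal := by
  rw [← Function.comp_def (a + ·) (b * ·), ← Measure.map_map (by fun_prop) (by fun_prop),
    gaussianReal_map_const_mul, gaussianReal_map_const_add]
  congr 1
  · ring
  · ext; simp [sq_nonneg]

lemma lintegral_gaussianReal {f : ℝ → ℝ≥0∞} (hf : Measurable f) (m : ℝ) {v : NNReal}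
    (hv : v ≠ 0) : ∫⁻ x, f x ∂gaussianReal m v = ∫⁻ x, gaussianPDF m v x * f x := by
  rw [gaussianReal_of_var_ne_zero _ hv,
    lintegral_withDensity_eq_lintegral_mul _ (measurable_gaussianPDF _ _) hf]
  rfl

lemma lintegral_bivGaussian {r : ℝ} (hr : r ^ 2 < 1) {F : ℝ × ℝ → ℝ≥0∞} (hF : Measurable F) :
    ∫⁻ p, F p ∂bivGaussian r = ∫⁻ t, ∫⁻ x,
      gaussianPDF 0 1 t * gaussianPDF (r * t) (1 - r ^ 2).toNNReal x * F (x, t) := by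
  set v := (1 - r ^ 2).toNNReal
  have hv : v ≠ 0 := by simpa [v] using hr
  have hpdf : Measurable fun q : ℝ × ℝ => gaussianPDF (r * q.1) v q.2 := by
    have h := measurable_uncurry_gaussianPDF
    exact h.comp (f := fun q : ℝ × ℝ => (r * q.1, v, q.2)) (by fun_prop)
  have hFm : ∀ t, Measurable fun x => gaussianPDF (r * t) v x * F (x, t) :=
    fun t => (measurable_gaussianPDF _ _).mul (hF.comp measurable_prodMk_right)
  have hinner : ∀ t : ℝ, ∫⁻ w, F (r * t + √(1 - r ^ 2) * w, t) ∂gaussianReal 0 1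
      = ∫⁻ x, gaussianPDF (r * t) v x * F (x, t) := fun t => by
    rw [← lintegral_map (f := fun x => F (x, t)) (g := fun w => r * t + √(1 - r ^ 2) * w)
      (by fun_prop) (by fun_prop), gaussianReal_map_affine, Real.sq_sqrt (by linarith),
      lintegral_gaussianReal (by fun_prop) _ hv]
  have hinnerm : Measurable fun t => ∫⁻ x, gaussianPDF (r * t) v x * F (x, t) :=
    Measurable.lintegral_prod_right' (f := fun q : ℝ × ℝ =>
      gaussianPDF (r * q.1) v q.2 * F (q.2, q.1)) (hpdf.mul (hF.comp measurable_swap))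
  have hprod : Measurable fun p : ℝ × ℝ => F (r * p.1 + √(1 - r ^ 2) * p.2, p.1) :=
    hF.comp (by fun_prop)
  rw [bivGaussian, lintegral_map hF (by fun_prop), lintegral_prod _ hprod.aemeasurable]
  simp only [hinner]
  rw [lintegral_gaussianReal hinnerm _ one_ne_zero]
  refine lintegral_congr fun t => ?_
  simp only [mul_assoc, lintegral_const_mul _ (hFm t)]

variable {r R : ℝ}

lemma one_sub_sq_pos_of_abs_lt_one (hr : |r| < 1) : 0 < 1 - r ^ 2 :=
  sub_pos.2 ((sq_lt_one_iff_abs_lt_one r).2 hr)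

lemma one_sub_abs_mul_le_sq_form (r x t : ℝ) :
    (1 - |r|) * (x ^ 2 + t ^ 2) ≤ x ^ 2 - 2 * r * x * t + t ^ 2 := by
  have hcross : 2 * r * x * t ≤ |r| * (x ^ 2 + t ^ 2) := by
    calc 2 * r * x * t ≤ |2 * r * x * t| := le_abs_self _
      _ = |r| * (2 * |x| * |t|) := by
        simp only [abs_mul, abs_two]
        ring
      _ ≤ |r| * (x ^ 2 + t ^ 2) := by
        gcongr
        nlinarith [sq_nonneg (|x| - |t|), sq_abs x, sq_abs t]
  linarith

lemma div_le_bivariate_exponent (hr : |r| ≤ R) (hR : R < 1) (x t : ℝ) :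
    (x ^ 2 + t ^ 2) / (2 * (1 + R)) ≤ t ^ 2 / 2 + (x - r * t) ^ 2 / (2 * (1 - r ^ 2)) := by
  have hr1 : 0 < 1 - |r| := sub_pos.2 (hr.trans_lt hR)
  have hfactor : 1 - r ^ 2 = (1 - |r|) * (1 + |r|) := by
    rw [← sq_abs r]
    ring
  have hpos := one_sub_sq_pos_of_abs_lt_one (hr.trans_lt hR)
  calc (x ^ 2 + t ^ 2) / (2 * (1 + R)) ≤ (x ^ 2 + t ^ 2) / (2 * (1 + |r|)) := by gcongr
    _ = (1 - |r|) * (x ^ 2 + t ^ 2) / (2 * (1 - r ^ 2)) := by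
      rw [hfactor]
      field_simp
    _ ≤ (x ^ 2 - 2 * r * x * t + t ^ 2) / (2 * (1 - r ^ 2)) := by
      gcongr
      exact one_sub_abs_mul_le_sq_form r x t
    _ = t ^ 2 / 2 + (x - r * t) ^ 2 / (2 * (1 - r ^ 2)) := by
      field_simp
      ring

/-- The Gaussian kernel `exp (-x² / (2 (1 + R)))`, whose tensor square dominates the densities of
the laws `bivGaussian r` with `|r| ≤ R`. -/
def corrKernel (R x : ℝ) : ℝ≥0∞ := ENNReal.ofReal (Real.exp (-(x ^ 2 / (2 * (1 + R)))))

@[fun_prop]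
lemma measurable_corrKernel (R : ℝ) : Measurable (corrKernel R) := by
  unfold corrKernel
  fun_prop

lemma gaussianPDF_mul_gaussianPDF_le (hr : |r| ≤ R) (hR : R < 1) (x t : ℝ) :
    gaussianPDF 0 1 t * gaussianPDF (r * t) (1 - r ^ 2).toNNReal x ≤
      ENNReal.ofReal (√(1 - R ^ 2))⁻¹ * (corrKernel R x * corrKernel R t) := by
  have hR0 : 0 ≤ R := (abs_nonneg r).trans hr
  have hr2 := one_sub_sq_pos_of_abs_lt_one (hr.trans_lt hR)
  have hR2 := one_sub_sq_pos_of_abs_lt_one (abs_lt.2 ⟨by linarith, hR⟩)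
  have hrR : r ^ 2 ≤ R ^ 2 := sq_le_sq.2 (hr.trans (le_abs_self R))
  simp only [gaussianPDF, corrKernel]
  rw [← ENNReal.ofReal_mul (gaussianPDFReal_nonneg _ _ _), ← ENNReal.ofReal_mul (by positivity),
    ← ENNReal.ofReal_mul (by positivity), gaussianPDFReal_zero_one, gaussianPDFReal,
    Real.coe_toNNReal _ hr2.le]
  refine ENNReal.ofReal_le_ofReal ?_
  calc (√(2 * Real.pi))⁻¹ * Real.exp (-t ^ 2 / 2) * ((√(2 * Real.pi * (1 - r ^ 2)))⁻¹ *
        Real.exp (-(x - r * t) ^ 2 / (2 * (1 - r ^ 2))))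
      = (√(2 * Real.pi))⁻¹ * (√(2 * Real.pi * (1 - r ^ 2)))⁻¹ *
        Real.exp (-(t ^ 2 / 2 + (x - r * t) ^ 2 / (2 * (1 - r ^ 2)))) := by
        rw [neg_add, Real.exp_add]
        ring_nf
    _ ≤ 1 * (√(1 - R ^ 2))⁻¹ * Real.exp (-((x ^ 2 + t ^ 2) / (2 * (1 + R)))) := by
        gcongr ?_ * (√?_)⁻¹ * Real.exp (-?_)
        · exact inv_sqrt_two_pi_le_one
        · nlinarith [Real.pi_gt_three]
        · exact div_le_bivariate_exponent hr hR x t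
    _ = (√(1 - R ^ 2))⁻¹ * (Real.exp (-(x ^ 2 / (2 * (1 + R)))) *
        Real.exp (-(t ^ 2 / (2 * (1 + R))))) := by
        rw [← Real.exp_add, one_mul]
        ring_nf

lemma lintegral_bivGaussian_le (hr : |r| ≤ R) (hR : R < 1) {k₁ k₂ : ℝ → ℝ≥0∞}
    (h₁ : Measurable k₁) (h₂ : Measurable k₂) :
    ∫⁻ p, k₁ p.1 * k₂ p.2 ∂bivGaussian r ≤ ENNReal.ofReal (√(1 - R ^ 2))⁻¹ *
      ((∫⁻ x, k₁ x * corrKernel R x) * (∫⁻ x, k₂ x * corrKernel R x)) := by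
  have hr2 := one_sub_sq_pos_of_abs_lt_one (hr.trans_lt hR)
  have hpoint : ∀ t x, gaussianPDF 0 1 t * gaussianPDF (r * t) (1 - r ^ 2).toNNReal x *
      (k₁ x * k₂ t) ≤ ENNReal.ofReal (√(1 - R ^ 2))⁻¹ * (k₁ x * corrKernel R x) *
        (k₂ t * corrKernel R t) := fun t x =>
    calc _ ≤ ENNReal.ofReal (√(1 - R ^ 2))⁻¹ * (corrKernel R x * corrKernel R t) *
          (k₁ x * k₂ t) := by
            gcongr ?_ * _
            exact gaussianPDF_mul_gaussianPDF_le hr hR x t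
      _ = _ := by ring
  calc ∫⁻ p, k₁ p.1 * k₂ p.2 ∂bivGaussian r
      ≤ ∫⁻ t, ∫⁻ x, ENNReal.ofReal (√(1 - R ^ 2))⁻¹ * (k₁ x * corrKernel R x) *
          (k₂ t * corrKernel R t) := by
        rw [lintegral_bivGaussian (by linarith) (by fun_prop)]
        exact lintegral_mono fun t => lintegral_mono (hpoint t)
    _ = _ := by
        simp_rw [lintegral_mul_const _ (show Measurable fun x => ENNReal.ofReal (√(1 - R ^ 2))⁻¹ *
          (k₁ x * corrKernel R x) by fun_prop)]
        rw [lintegral_const_mul _ (by fun_prop), lintegral_const_mul _ (by fun_prop), mul_assoc]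

end BivGaussianDensity

/-! ### Gaussian interpolation -/

section IntegrationByParts

variable {T Ω : Type*} [MeasurableSpace Ω] {P : Measure Ω} {W : Ω → ℝ} {Z : T → Ω → ℝ}

lemma indepFun_sub_cov_mul [Finite T] (h : HasGaussianLaw (fun ω => (W ω, fun t => Z t ω)) P)
    (hW : Var[W; P] = 1) : IndepFun W (fun ω t => Z t ω - cov[W, Z t; P] * W ω) P := by
  have := h.isProbabilityMeasure
  have := Fintype.ofFinite T
  have hWmem := h.fst.memLp_two
  have hjoint : HasGaussianLaw
      (fun ω => (fun _ : Unit => W ω, fun t => Z t ω - cov[W, Z t; P] * W ω)) P :=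
    h.map_fun ((ContinuousLinearMap.pi fun _ : Unit => ContinuousLinearMap.fst ℝ ℝ (T → ℝ)).prod
      (ContinuousLinearMap.pi fun t => (ContinuousLinearMap.proj (R := ℝ) t).comp
        (ContinuousLinearMap.snd ℝ ℝ (T → ℝ)) - cov[W, Z t; P] • ContinuousLinearMap.fst ℝ ℝ _))
  have hind := HasGaussianLaw.indepFun_of_covariance_eval (X := fun _ : Unit => W)
    (Y := fun t ω => Z t ω - cov[W, Z t; P] * W ω) hjoint fun _ t => by
      rw [covariance_fun_sub_right hWmem (h.snd.eval t).memLp_two (hWmem.const_mul _),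
        covariance_const_mul_right, covariance_self h.fst.aemeasurable, hW, mul_one, sub_self]
  exact hind.comp (φ := fun x : Unit → ℝ => x ()) (ψ := id) (by fun_prop) measurable_id

lemma aemeasurable_sub_cov_mul [Finite T]
    (h : HasGaussianLaw (fun ω => (W ω, fun t => Z t ω)) P) :
    AEMeasurable (fun ω t => Z t ω - cov[W, Z t; P] * W ω) P := by
  have := Fintype.ofFinite T
  have hZm : ∀ t, AEMeasurable (Z t) P := fun t => (h.snd.eval t).aemeasurable
  exact aemeasurable_pi_lambda _ fun t => (hZm t).sub (h.fst.aemeasurable.const_mul _)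

lemma integral_comp_eq_integral_prod_residual [Finite T]
    (h : HasGaussianLaw (fun ω => (W ω, fun t => Z t ω)) P) (hW0 : ∫ ω, W ω ∂P = 0)
    (hW1 : Var[W; P] = 1) {Ψ : ℝ × (T → ℝ) → ℝ} (hΨ : Continuous Ψ) :
    ∫ ω, Ψ (W ω, fun t => Z t ω) ∂P = ∫ p, Ψ (p.1, p.2 + p.1 • fun t => cov[W, Z t; P])
      ∂(gaussianReal 0 1).prod (P.map fun ω t => Z t ω - cov[W, Z t; P] * W ω) := by
  have := h.isProbabilityMeasure
  have := Fintype.ofFinite T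
  have hWm := h.fst.aemeasurable
  have hRm := aemeasurable_sub_cov_mul h
  have hWlaw : P.map W = gaussianReal 0 1 := by
    rw [h.fst.map_eq_gaussianReal, hW0, hW1, Real.toNNReal_one]
  have hlaw : P.map (fun ω => (W ω, fun t => Z t ω - cov[W, Z t; P] * W ω)) =
      (gaussianReal 0 1).prod (P.map fun ω t => Z t ω - cov[W, Z t; P] * W ω) := by
    rw [(indepFun_iff_map_prod_eq_prod_map_map hWm hRm).1 (indepFun_sub_cov_mul h hW1), hWlaw]
  have hΨ' : Continuous fun p : ℝ × (T → ℝ) => Ψ (p.1, p.2 + p.1 • fun t => cov[W, Z t; P]) :=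
    hΨ.comp (by fun_prop)
  rw [← hlaw, integral_map (hWm.prodMk hRm) hΨ'.aestronglyMeasurable]
  refine integral_congr_ae (.of_forall fun ω => congrArg (fun z => Ψ (W ω, z)) (funext fun t => ?_))
  simp [mul_comm]

/-- The Gaussian variable `W` is independent of the residuals `Z t - cov[W, Z t] W`; fixing these
reduces the formula to integration by parts in one variable. -/
lemma integral_mul_comp_eq_integral_fderiv [Fintype T]
    (h : HasGaussianLaw (fun ω => (W ω, fun t => Z t ω)) P) (hW0 : ∫ ω, W ω ∂P = 0)
    (hW1 : Var[W; P] = 1) {F : (T → ℝ) → ℝ} {F' : (T → ℝ) → (T → ℝ) →L[ℝ] ℝ}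
    (hF : ∀ z, HasFDerivAt F (F' z) z) (hF' : Continuous F') {C C' : ℝ}
    (hC : ∀ z, |F z| ≤ C) (hC' : ∀ z, ‖F' z‖ ≤ C') :
    ∫ ω, W ω * F (fun t => Z t ω) ∂P =
      ∫ ω, F' (fun t => Z t ω) (fun t => cov[W, Z t; P]) ∂P := by
  have hP := h.isProbabilityMeasure
  have hFc : Continuous F := continuous_iff_continuousAt.2 fun z => (hF z).continuousAt
  rw [integral_comp_eq_integral_prod_residual h hW0 hW1 (Ψ := fun p => p.1 * F p.2) (by fun_prop),
    integral_comp_eq_integral_prod_residual h hW0 hW1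
      (Ψ := fun p => F' p.2 fun t => cov[W, Z t; P])
      ((hF'.comp continuous_snd).clm_apply continuous_const)]
  set c : T → ℝ := fun t => cov[W, Z t; P]
  set ν := P.map fun ω t => Z t ω - c t * W ω
  have : IsProbabilityMeasure ν := Measure.isProbabilityMeasure_map (aemeasurable_sub_cov_mul h)
  have hGi : Integrable (fun p : ℝ × (T → ℝ) => p.1 * F (p.2 + p.1 • c))
      ((gaussianReal 0 1).prod ν) :=
    (((memLp_id_gaussianReal 1).integrable le_rfl).comp_fst ν).mul_bdd
      (hFc.comp (by fun_prop)).aestronglyMeasurable (Eventually.of_forall fun p => hC _)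
  have hF'c : Continuous fun p : ℝ × (T → ℝ) => F' (p.2 + p.1 • c) c :=
    (hF'.comp (by fun_prop)).clm_apply continuous_const
  have hF'b : ∀ z, |F' z c| ≤ C' * ‖c‖ := fun z =>
    ((F' z).le_opNorm c).trans (mul_le_mul_of_nonneg_right (hC' z) (norm_nonneg c))
  have hF'i : Integrable (fun p : ℝ × (T → ℝ) => F' (p.2 + p.1 • c) c)
      ((gaussianReal 0 1).prod ν) :=
    .of_bound hF'c.aestronglyMeasurable _ (Eventually.of_forall fun p => hF'b _)
  rw [integral_prod_symm _ hGi, integral_prod_symm _ hF'i]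
  refine integral_congr_ae (.of_forall fun y => ?_)
  refine integral_id_mul_gaussianReal_zero_one (G := fun x => F (y + x • c)) (fun x => ?_)
    (hF'c.comp (by fun_prop)) (fun x => hC _) (fun x => hF'b _)
  have hline : HasDerivAt (fun x : ℝ => y + x • c) c x := by
    simpa using ((hasDerivAt_id x).smul_const c).const_add y
  exact (hF _).comp_hasDerivAt x hline

lemma abs_prod_le_pow_card {ι : Type*} (s : Finset ι) {a : ι → ℝ} {C : ℝ}
    (ha : ∀ i ∈ s, |a i| ≤ C) : |∏ i ∈ s, a i| ≤ C ^ s.card := by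
  rw [Finset.abs_prod, ← Finset.prod_const]
  exact Finset.prod_le_prod (fun _ _ => abs_nonneg _) ha

lemma integral_mul_prod_gaussian [Fintype T] [DecidableEq T]
    (h : HasGaussianLaw (fun ω => (W ω, fun t => Z t ω)) P) (hW0 : ∫ ω, W ω ∂P = 0)
    (hW1 : Var[W; P] = 1) {g g' : T → ℝ → ℝ} (hg : ∀ t x, HasDerivAt (g t) (g' t x) x)
    (hg' : ∀ t, Continuous (g' t)) {C : ℝ} (hC : ∀ t x, |g t x| ≤ C) (hC' : ∀ t x, |g' t x| ≤ C) :
    ∫ ω, W ω * ∏ t, g t (Z t ω) ∂P =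
      ∑ s, cov[W, Z s; P] * ∫ ω, (∏ t ∈ Finset.univ.erase s, g t (Z t ω)) * g' s (Z s ω) ∂P := by
  have hP := h.isProbabilityMeasure
  have hgc : ∀ t, Continuous (g t) := fun t =>
    continuous_iff_continuousAt.2 fun x => (hg t x).continuousAt
  let K : T → (T → ℝ) → ℝ := fun s z => (∏ t ∈ Finset.univ.erase s, g t (z t)) * g' s (z s)
  have hKc : ∀ s, Continuous (K s) := fun s => (continuous_finsetProd _ fun t _ =>
    (hgc t).comp (continuous_apply t)).mul ((hg' s).comp (continuous_apply s))
  have hKb : ∀ s z, |K s z| ≤ C ^ (Fintype.card T - 1) * C := fun s z => by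
    have hprod := abs_prod_le_pow_card (Finset.univ.erase s) fun t _ => hC t (z t)
    rw [Finset.card_erase_of_mem (Finset.mem_univ s), Finset.card_univ] at hprod
    rw [abs_mul]
    exact mul_le_mul hprod (hC' s _) (abs_nonneg _) ((abs_nonneg _).trans hprod)
  have hKi : ∀ s, Integrable (fun ω => K s fun t => Z t ω) P := fun s =>
    .of_bound ((hKc s).comp_aestronglyMeasurable h.snd.aemeasurable.aestronglyMeasurable) _
      (Eventually.of_forall fun ω => hKb s _)
  let proj : T → (T → ℝ) →L[ℝ] ℝ := fun s => ContinuousLinearMap.proj s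
  have hF : ∀ z : T → ℝ, HasFDerivAt (fun z : T → ℝ => ∏ t, g t (z t)) (∑ s, K s z • proj s) z := by
    intro z
    refine (HasFDerivAt.finsetProd (u := Finset.univ) fun t _ =>
      (hg t (z t)).comp_hasFDerivAt z (proj t).hasFDerivAt).congr_fderiv ?_
    simp only [K, mul_smul]
    rfl
  have hF'b : ∀ z, ‖∑ s, K s z • proj s‖ ≤ ∑ s, C ^ (Fintype.card T - 1) * C * ‖proj s‖ := fun z =>
    (norm_sum_le _ _).trans (Finset.sum_le_sum fun s _ => (norm_smul _ _).le.trans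
      (mul_le_mul_of_nonneg_right (hKb s z) (norm_nonneg _)))
  rw [integral_mul_comp_eq_integral_fderiv h hW0 hW1 hF
    (continuous_finsetSum _ fun s _ => (hKc s).smul continuous_const)
    (fun z => abs_prod_le_pow_card _ fun t _ => hC t (z t)) hF'b]
  simp only [sum_apply, smul_apply, smul_eq_mul]
  rw [integral_finsetSum _ fun s _ => (hKi s).mul_const _]
  refine Finset.sum_congr rfl fun s _ => ?_
  rw [integral_mul_const, mul_comm]
  rfl

end IntegrationByParts

section Interpolation

/-- The path `θ ↦ cos θ • ω none + sin θ • (ω (some (g t)) t)ₜ` rotating a random vector towards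
the vector whose coordinate blocks, the fibres of `g`, are replaced by independent copies. -/
def interp {T ι : Type*} (g : T → ι) (θ : ℝ) (t : T) (ω : Option ι → T → ℝ) : ℝ :=
  Real.cos θ * ω none t + Real.sin θ * ω (some (g t)) t

section Path

variable {T ι : Type*} (g : T → ι)

@[fun_prop]
lemma measurable_interp (θ : ℝ) (t : T) : Measurable (interp g θ t) := by
  unfold interp
  fun_prop

@[simp]
lemma interp_zero (t : T) (ω : Option ι → T → ℝ) : interp g 0 t ω = ω none t := by
  simp [interp]

@[simp]
lemma interp_pi_div_two (t : T) (ω : Option ι → T → ℝ) :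
    interp g (Real.pi / 2) t ω = ω (some (g t)) t := by
  simp [interp]

lemma abs_interp_le (θ : ℝ) (t : T) (ω : Option ι → T → ℝ) :
    |interp g θ t ω| ≤ |ω none t| + |ω (some (g t)) t| := by
  refine (abs_add_le _ _).trans ?_
  rw [abs_mul, abs_mul]
  exact add_le_add (mul_le_of_le_one_left (abs_nonneg _) (Real.abs_cos_le_one _))
    (mul_le_of_le_one_left (abs_nonneg _) (Real.abs_sin_le_one _))

lemma hasDerivAt_interp (θ : ℝ) (t : T) (ω : Option ι → T → ℝ) :
    HasDerivAt (fun θ => interp g θ t ω) (interp g (θ + Real.pi / 2) t ω) θ := by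
  simp only [interp, Real.cos_add_pi_div_two, Real.sin_add_pi_div_two]
  exact ((Real.hasDerivAt_cos θ).mul_const _).add ((Real.hasDerivAt_sin θ).mul_const _)

end Path

section ProdUpdate

variable {T : Type*} [DecidableEq T] {f : T → ℝ → ℝ} {s : T} {S : Finset T}

lemma prod_update_eq_mul_prod_erase (hs : s ∈ S) (h : ℝ → ℝ) (z : T → ℝ) :
    ∏ t ∈ S, Function.update f s h t (z t) = h (z s) * ∏ t ∈ S.erase s, f t (z t) := by
  rw [← Finset.mul_prod_erase S _ hs, Function.update_self]
  congr 1
  exact Finset.prod_congr rfl fun t ht => by rw [Function.update_of_ne (Finset.ne_of_mem_erase ht)]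

lemma abs_prod_update_le (hs : s ∈ S) (hf : ∀ t x, |f t x| ≤ 1) (h : ℝ → ℝ) (z : T → ℝ) :
    |∏ t ∈ S, Function.update f s h t (z t)| ≤ |h (z s)| := by
  rw [prod_update_eq_mul_prod_erase hs, abs_mul, Finset.abs_prod]
  exact mul_le_of_le_one_right (abs_nonneg _)
    (Finset.prod_le_one (fun _ _ => abs_nonneg _) fun t _ => hf t _)

lemma hasDerivAt_prod_comp {f' : T → ℝ → ℝ} (hf : ∀ t x, HasDerivAt (f t) (f' t x) x)
    {z : T → ℝ → ℝ} {z' : T → ℝ} {θ : ℝ} (hz : ∀ t, HasDerivAt (z t) (z' t) θ) :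
    HasDerivAt (fun θ => ∏ t ∈ S, f t (z t θ))
      (∑ s ∈ S, z' s * ∏ t ∈ S, Function.update f s (f' s) t (z t θ)) θ := by
  refine (HasDerivAt.fun_finsetProd fun t _ => (hf t _).comp θ (hz t)).congr_deriv
    (Finset.sum_congr rfl fun s hs => ?_)
  rw [prod_update_eq_mul_prod_erase hs, smul_eq_mul]
  simp only [Function.comp_apply]
  ring

end ProdUpdate

section Copies

variable {T ι : Type*} [Fintype ι]

/-- The law of independent copies of a random vector: a reference copy `ω none` and a copy
`ω (some i)` for each `i : ι`. -/
abbrev copies (μ : Measure (T → ℝ)) (ι : Type*) [Fintype ι] : Measure (Option ι → T → ℝ) :=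
  Measure.pi fun _ : Option ι => μ

variable {μ : Measure (T → ℝ)}

lemma integral_copies [IsProbabilityMeasure μ] (o : Option ι) (t : T) :
    ∫ ω, ω o t ∂copies μ ι = ∫ x, x t ∂μ :=
  integral_comp_eval (μ := fun _ : Option ι => μ) (i := o) (f := fun x : T → ℝ => x t)
    (measurable_pi_apply t).aestronglyMeasurable

variable [Finite T] [IsGaussian μ]

instance isGaussian_copies : IsGaussian (copies μ ι) := by
  have := Fintype.ofFinite T
  have h : HasGaussianLaw (fun ω : Option ι → T → ℝ => fun o => ω o) (copies μ ι) := by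
    refine iIndepFun.hasGaussianLaw (X := fun o (ω : Option ι → T → ℝ) => ω o) (fun o => ⟨?_⟩) ?_
    · change IsGaussian ((Measure.pi fun _ : Option ι => μ).map (Function.eval o))
      rw [(measurePreserving_eval (fun _ : Option ι => μ) o).map_eq]
      infer_instance
    · exact iIndepFun_pi (X := fun _ (x : T → ℝ) => x) fun _ => aemeasurable_id
  simpa using h.isGaussian_map

lemma memLp_copies (o : Option ι) (t : T) :
    MemLp (fun ω : Option ι → T → ℝ => ω o t) 2 (copies μ ι) := by
  have := Fintype.ofFinite T
  have h : HasGaussianLaw (id : (Option ι → T → ℝ) → _) (copies μ ι) :=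
    IsGaussian.hasGaussianLaw_id
  exact (h.map_fun ((ContinuousLinearMap.proj (R := ℝ) t).comp
    (ContinuousLinearMap.proj (R := ℝ) (φ := fun _ : Option ι => T → ℝ) o))).memLp_two

lemma covariance_copies [DecidableEq ι] (o o' : Option ι) (s t : T) :
    cov[fun ω => ω o s, fun ω => ω o' t; copies μ ι] =
      if o = o' then cov[fun x => x s, fun x => x t; μ] else 0 := by
  split_ifs with h
  · subst h
    have hcov := covariance_map_fun (μ := copies μ ι) (Z := Function.eval o)
      (X := fun x : T → ℝ => x s) (Y := fun x : T → ℝ => x t)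
      (measurable_pi_apply s).aestronglyMeasurable
      (measurable_pi_apply t).aestronglyMeasurable (measurable_pi_apply o).aemeasurable
    rw [(measurePreserving_eval (fun _ : Option ι => μ) o).map_eq] at hcov
    exact hcov.symm
  · have hind := (iIndepFun_pi (μ := fun _ : Option ι => μ) (X := fun _ (x : T → ℝ) => x)
      fun _ => aemeasurable_id).indepFun h
    exact (hind.comp (φ := fun x : T → ℝ => x s) (ψ := fun x : T → ℝ => x t) (by fun_prop)
      (by fun_prop)).covariance_eq_zero (memLp_copies o s) (memLp_copies o' t)

variable (g : T → ι)

lemma integral_interp (h0 : ∀ t, ∫ x, x t ∂μ = 0) (θ : ℝ) (t : T) :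
    ∫ ω, interp g θ t ω ∂copies μ ι = 0 := by
  have hi : ∀ o : Option ι, Integrable (fun ω : Option ι → T → ℝ => ω o t) (copies μ ι) :=
    fun o => (memLp_copies o t).integrable (by simp)
  simp only [interp]
  rw [integral_add ((hi _).const_mul _) ((hi _).const_mul _), integral_const_mul,
    integral_const_mul, integral_copies, integral_copies, h0]
  simp

lemma covariance_interp [DecidableEq ι] (θ θ' : ℝ) (s t : T) :
    cov[interp g θ s, interp g θ' t; copies μ ι] =
      (if g s = g t then Real.cos (θ - θ') else Real.cos θ * Real.cos θ') *
        cov[fun x => x s, fun x => x t; μ] := by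
  have hsum : ∀ θ t, interp g θ t =
      (fun ω => Real.cos θ * ω none t) + fun ω => Real.sin θ * ω (some (g t)) t :=
    fun _ _ => rfl
  have hm := fun (o : Option ι) (t : T) (a : ℝ) => (memLp_copies (μ := μ) o t).const_mul a
  rw [hsum θ s, hsum θ' t,
    covariance_add_left (hm _ _ _) (hm _ _ _) ((hm _ _ _).add (hm _ _ _)),
    covariance_add_right (hm _ _ _) (hm _ _ _) (hm _ _ _),
    covariance_add_right (hm _ _ _) (hm _ _ _) (hm _ _ _)]
  simp only [covariance_const_mul_left, covariance_const_mul_right, covariance_copies,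
    Option.some_inj, reduceCtorEq, if_false, if_true, Real.cos_sub]
  split_ifs <;> ring

lemma hasGaussianLaw_interp (θ θ' : ℝ) (s : T) :
    HasGaussianLaw (fun ω => (interp g θ s ω, fun t => interp g θ' t ω)) (copies μ ι) := by
  have := Fintype.ofFinite T
  have h : HasGaussianLaw (id : (Option ι → T → ℝ) → _) (copies μ ι) :=
    IsGaussian.hasGaussianLaw_id
  let E : Option ι → T → ((Option ι → T → ℝ) →L[ℝ] ℝ) := fun o t =>
    (ContinuousLinearMap.proj (R := ℝ) t).comp
      (ContinuousLinearMap.proj (R := ℝ) (φ := fun _ : Option ι => T → ℝ) o)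
  let Z : ℝ → T → ((Option ι → T → ℝ) →L[ℝ] ℝ) := fun θ t =>
    Real.cos θ • E none t + Real.sin θ • E (some (g t)) t
  exact h.map_fun ((Z θ s).prod (ContinuousLinearMap.pi (Z θ')))

lemma variance_interp (h1 : ∀ t, Var[fun x => x t; μ] = 1) (θ : ℝ) (t : T) :
    Var[interp g θ t; copies μ ι] = 1 := by
  classical
  rw [← covariance_self (by fun_prop), covariance_interp,
    covariance_self (measurable_pi_apply t).aemeasurable, h1, if_pos rfl, sub_self, Real.cos_zero,
    one_mul]

lemma isStdPair_interp [DecidableEq ι] (h0 : ∀ t, ∫ x, x t ∂μ = 0)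
    (h1 : ∀ t, Var[fun x => x t; μ] = 1) (θ : ℝ) (s t : T) :
    IsStdPair (copies μ ι) (interp g θ s) (interp g θ t)
      ((if g s = g t then Real.cos (θ - θ) else Real.cos θ * Real.cos θ) *
        cov[fun x => x s, fun x => x t; μ]) where
  gaussian := by
    have := Fintype.ofFinite T
    exact (hasGaussianLaw_interp g θ θ s).map_fun ((ContinuousLinearMap.fst ℝ ℝ (T → ℝ)).prod
      ((ContinuousLinearMap.proj (R := ℝ) t).comp (ContinuousLinearMap.snd ℝ ℝ (T → ℝ))))
  mean_fst := integral_interp g h0 θ s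
  mean_snd := integral_interp g h0 θ t
  var_fst := variance_interp g h1 θ s
  var_snd := variance_interp g h1 θ t
  cov_eq := covariance_interp g θ θ s t

end Copies

lemma IsStdPair.integral_abs_mul_abs_le {Ω : Type*} [MeasurableSpace Ω] {P : Measure Ω}
    {U V : Ω → ℝ} {r R c₁ c₂ : ℝ} {h₁ h₂ : ℝ → ℝ} (h : IsStdPair P U V r) (hr : |r| ≤ R)
    (hR : R < 1) (hm₁ : Measurable h₁) (hm₂ : Measurable h₂) (hc₁ : 0 ≤ c₁) (hc₂ : 0 ≤ c₂)
    (hh₁ : ∫⁻ x, ENNReal.ofReal |h₁ x| * corrKernel R x ≤ ENNReal.ofReal c₁)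
    (hh₂ : ∫⁻ x, ENNReal.ofReal |h₂ x| * corrKernel R x ≤ ENNReal.ofReal c₂) :
    ∫ ω, |h₁ (U ω)| * |h₂ (V ω)| ∂P ≤ (√(1 - R ^ 2))⁻¹ * (c₁ * c₂) := by
  have hb := lintegral_bivGaussian_le hr hR (k₁ := fun x => ENNReal.ofReal |h₁ x|)
    (k₂ := fun x => ENNReal.ofReal |h₂ x|) (by fun_prop) (by fun_prop)
  rw [← h.map_eq_bivGaussian, lintegral_map' (by fun_prop) h.gaussian.aemeasurable] at hb
  have hU := h.gaussian.fst.aemeasurable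
  have hV := h.gaussian.snd.aemeasurable
  rw [integral_eq_lintegral_of_nonneg_ae (.of_forall fun ω => by positivity)
    (AEMeasurable.aestronglyMeasurable (by fun_prop))]
  refine ENNReal.toReal_le_of_le_ofReal (by positivity) ?_
  rw [ENNReal.ofReal_mul (by positivity), ENNReal.ofReal_mul hc₁]
  simp_rw [ENNReal.ofReal_mul (abs_nonneg _)]
  exact hb.trans (mul_le_mul_right (mul_le_mul' hh₁ hh₂) _)

variable {T ι : Type*} [Fintype T] [Fintype ι] {μ : Measure (T → ℝ)} [IsGaussian μ] (g : T → ι)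
  {f f' f'' : T → ℝ → ℝ} {C : ℝ}

lemma hasDerivAt_integral_interp [DecidableEq T] (hf : ∀ t x, HasDerivAt (f t) (f' t x) x)
    (hf' : ∀ t, Continuous (f' t)) (hf1 : ∀ t x, |f t x| ≤ 1) (hC' : ∀ t x, |f' t x| ≤ C)
    (θ : ℝ) :
    HasDerivAt (fun θ => ∫ ω, ∏ t, f t (interp g θ t ω) ∂copies μ ι)
      (∑ s, ∫ ω, interp g (θ + Real.pi / 2) s ω *
        ∏ t, Function.update f s (f' s) t (interp g θ t ω) ∂copies μ ι) θ := by
  have hfm : ∀ t, Measurable (f t) := fun t =>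
    (continuous_iff_continuousAt.2 fun x => (hf t x).continuousAt).measurable
  have hupdm : ∀ s t, Measurable (Function.update f s (f' s) t) := fun s t => by
    rcases eq_or_ne t s with rfl | hts
    · simpa using (hf' t).measurable
    · simpa [hts] using hfm t
  have hprodm : ∀ θ, Measurable fun ω => ∏ t, f t (interp g θ t ω) := fun θ =>
    Finset.measurable_fun_prod _ fun t _ => (hfm t).comp (measurable_interp g θ t)
  let F' : T → ℝ → (Option ι → T → ℝ) → ℝ := fun s θ ω =>
    interp g (θ + Real.pi / 2) s ω * ∏ t, Function.update f s (f' s) t (interp g θ t ω)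
  let B : T → (Option ι → T → ℝ) → ℝ := fun s ω => (|ω none s| + |ω (some (g s)) s|) * C
  have hF'B : ∀ s θ ω, |F' s θ ω| ≤ B s ω := fun s θ ω => by
    rw [abs_mul]
    exact mul_le_mul (abs_interp_le g _ _ _)
      ((abs_prod_update_le (Finset.mem_univ s) hf1 _ _).trans (hC' _ _)) (abs_nonneg _)
      (by positivity)
  have habs : ∀ (o : Option ι) s, Integrable (fun ω : Option ι → T → ℝ => |ω o s|) (copies μ ι) :=
    fun o s => ((memLp_copies o s).integrable (by simp)).abs
  have hB : ∀ s, Integrable (B s) (copies μ ι) := fun s => ((habs _ _).add (habs _ _)).mul_const C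
  have hF' : ∀ s, Integrable (F' s θ) (copies μ ι) := fun s =>
    (hB s).mono' ((measurable_interp g _ s).mul (Finset.measurable_fun_prod _ fun t _ =>
      (hupdm s t).comp (measurable_interp g θ t))).aestronglyMeasurable
      (.of_forall (hF'B s θ))
  have key := (hasDerivAt_integral_of_dominated_loc_of_deriv_le (𝕜 := ℝ) (s := Set.univ)
    (F := fun θ ω => ∏ t, f t (interp g θ t ω)) (F' := fun θ ω => ∑ s, F' s θ ω)
    (bound := fun ω => ∑ s, B s ω) Filter.univ_mem
    (.of_forall fun θ => (hprodm θ).aestronglyMeasurable)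
    (.of_bound (hprodm θ).aestronglyMeasurable 1 (.of_forall fun ω => by
      rw [Real.norm_eq_abs, Finset.abs_prod]
      exact Finset.prod_le_one (fun _ _ => abs_nonneg _) fun t _ => hf1 t _))
    (integrable_finsetSum _ fun s _ => hF' s).aestronglyMeasurable
    (.of_forall fun ω θ _ =>
      (Finset.abs_sum_le_sum_abs _ _).trans (Finset.sum_le_sum fun s _ => hF'B s θ ω))
    (integrable_finsetSum _ fun s _ => hB s)
    (.of_forall fun ω θ _ => hasDerivAt_prod_comp hf fun t => hasDerivAt_interp g θ t ω)).2
  rwa [integral_finsetSum _ fun s _ => hF' s] at key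

/-- Coordinates in the same block contribute nothing, since `interp g (θ + π / 2) s` and
`interp g θ t` are then uncorrelated. -/
lemma abs_integral_interp_mul_prod_update_le [DecidableEq T] [DecidableEq ι]
    (h0 : ∀ t, ∫ x, x t ∂μ = 0) (h1 : ∀ t, Var[fun x => x t; μ] = 1)
    (hf : ∀ t x, HasDerivAt (f t) (f' t x) x) (hf' : ∀ t x, HasDerivAt (f' t) (f'' t x) x)
    (hf'' : ∀ t, Continuous (f'' t)) (hf1 : ∀ t x, |f t x| ≤ 1) (hC' : ∀ t x, |f' t x| ≤ C)
    (hC'' : ∀ t x, |f'' t x| ≤ C) (θ : ℝ) (s : T) :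
    |∫ ω, interp g (θ + Real.pi / 2) s ω *
        ∏ t, Function.update f s (f' s) t (interp g θ t ω) ∂copies μ ι| ≤
      ∑ t, if g s = g t then 0 else |cov[fun x => x s, fun x => x t; μ]| *
        ∫ ω, |f' s (interp g θ s ω)| * |f' t (interp g θ t ω)| ∂copies μ ι := by
  have hf'c : ∀ t, Continuous (f' t) := fun t =>
    continuous_iff_continuousAt.2 fun x => (hf' t x).continuousAt
  rw [integral_mul_prod_gaussian (hasGaussianLaw_interp g _ _ s) (integral_interp g h0 _ s)
    (variance_interp g h1 _ s) (g := Function.update f s (f' s))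
    (g' := Function.update f' s (f'' s)) (C := max 1 C)
    (fun t x => by rcases eq_or_ne t s with rfl | h <;> simp [*])
    (fun t => by rcases eq_or_ne t s with rfl | h <;> simp [*])
    (fun t x => by rcases eq_or_ne t s with rfl | h <;> simp [*])
    (fun t x => by rcases eq_or_ne t s with rfl | h <;> simp [*])]
  refine (Finset.abs_sum_le_sum_abs _ _).trans (Finset.sum_le_sum fun t _ => ?_)
  rw [covariance_interp]
  split_ifs with hst
  · simp
  have hts : t ≠ s := fun h => hst (by rw [h])
  rw [abs_mul, abs_mul, abs_mul]
  refine mul_le_mul (mul_le_of_le_one_left (abs_nonneg _) (mul_le_one₀ (Real.abs_cos_le_one _)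
    (abs_nonneg _) (Real.abs_cos_le_one _))) ?_ (abs_nonneg _) (abs_nonneg _)
  refine abs_integral_le_integral_abs.trans (integral_mono_of_nonneg
    (.of_forall fun ω => abs_nonneg _) ?_ (.of_forall fun ω => ?_))
  · refine .of_bound (((hf'c s).measurable.comp (measurable_interp g θ s)).abs.mul
      ((hf'c t).measurable.comp (measurable_interp g θ t)).abs).aestronglyMeasurable (C * C)
      (.of_forall fun ω => ?_)
    rw [Real.norm_eq_abs, abs_mul, abs_abs, abs_abs]
    exact mul_le_mul (hC' _ _) (hC' _ _) (abs_nonneg _) ((abs_nonneg _).trans (hC' s 0))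
  · simp only [abs_mul, Function.update_of_ne hts]
    exact mul_le_mul_of_nonneg_right (abs_prod_update_le
      (Finset.mem_erase.2 ⟨hts.symm, Finset.mem_univ s⟩) hf1 _ _) (abs_nonneg _)

lemma abs_integral_interp_sub_le [DecidableEq ι] (h0 : ∀ t, ∫ x, x t ∂μ = 0)
    (h1 : ∀ t, Var[fun x => x t; μ] = 1) {r : T → T → ℝ}
    (hr : ∀ s t, cov[fun x => x s, fun x => x t; μ] = r s t)
    (hr1 : ∀ s t, g s ≠ g t → |r s t| < 1)
    (hf : ∀ t x, HasDerivAt (f t) (f' t x) x) (hf' : ∀ t x, HasDerivAt (f' t) (f'' t x) x)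
    (hf'' : ∀ t, Continuous (f'' t)) (hf1 : ∀ t x, |f t x| ≤ 1) (hC' : ∀ t x, |f' t x| ≤ C)
    (hC'' : ∀ t x, |f'' t x| ≤ C) {c : T → T → ℝ} (hc0 : ∀ s t, 0 ≤ c s t)
    (hc : ∀ s t, ∫⁻ x, ENNReal.ofReal |f' s x| * corrKernel |r s t| x ≤ ENNReal.ofReal (c s t)) :
    |(∫ ω, ∏ t, f t (ω none t) ∂copies μ ι) - ∫ ω, ∏ t, f t (ω (some (g t)) t) ∂copies μ ι| ≤
      ∑ s, ∑ t, (if g s = g t then 0 else |r s t| * ((√(1 - r s t ^ 2))⁻¹ * (c s t * c t s)))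
        * (Real.pi / 2) := by
  classical
  have hf'c : ∀ t, Continuous (f' t) := fun t =>
    continuous_iff_continuousAt.2 fun x => (hf' t x).continuousAt
  have hpair : ∀ θ s t, g s ≠ g t →
      ∫ ω, |f' s (interp g θ s ω)| * |f' t (interp g θ t ω)| ∂copies μ ι ≤
        (√(1 - r s t ^ 2))⁻¹ * (c s t * c t s) := fun θ s t hst => by
    have hp := isStdPair_interp g h0 h1 θ s t
    rw [if_neg hst, hr] at hp
    have hsymm : r t s = r s t := by rw [← hr, ← hr, covariance_comm]
    have hle : |Real.cos θ * Real.cos θ * r s t| ≤ |r s t| := by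
      rw [abs_mul, abs_mul]
      exact mul_le_of_le_one_left (abs_nonneg _)
        (mul_le_one₀ (Real.abs_cos_le_one _) (abs_nonneg _) (Real.abs_cos_le_one _))
    simpa only [sq_abs] using hp.integral_abs_mul_abs_le hle (hr1 s t hst) (hf'c s).measurable
      (hf'c t).measurable (hc0 s t) (hc0 t s) (hc s t) (hsymm ▸ hc t s)
  have hderiv : ∀ θ, |∑ s, ∫ ω, interp g (θ + Real.pi / 2) s ω *
        ∏ t, Function.update f s (f' s) t (interp g θ t ω) ∂copies μ ι| ≤
      ∑ s, ∑ t, if g s = g t then 0 else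
        |r s t| * ((√(1 - r s t ^ 2))⁻¹ * (c s t * c t s)) := fun θ => by
    refine (Finset.abs_sum_le_sum_abs _ _).trans (Finset.sum_le_sum fun s _ =>
      (abs_integral_interp_mul_prod_update_le g h0 h1 hf hf' hf'' hf1 hC' hC'' θ s).trans
        (Finset.sum_le_sum fun t _ => ?_))
    split_ifs with hst
    · exact le_rfl
    · rw [hr]
      exact mul_le_mul_of_nonneg_left (hpair θ s t hst) (abs_nonneg _)
  have hmv := Convex.norm_image_sub_le_of_norm_hasDerivWithin_le (𝕜 := ℝ) (s := Set.univ)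
    (x := Real.pi / 2) (y := 0)
    (fun θ _ => (hasDerivAt_integral_interp (μ := μ) g hf hf'c hf1 hC' θ).hasDerivWithinAt)
    (fun θ _ => hderiv θ) convex_univ trivial trivial
  simpa [abs_of_pos Real.pi_pos, Finset.sum_mul] using hmv

end Interpolation

/-! ### Normal comparison for windows -/

section Windows

/-- Smooth approximations `f j` of the indicator function of `B`, with first and second derivatives
`f' j` and `f'' j`. Asymptotically `|f' j|` charges at most two points, both at distance at least
`w` from the origin. -/
structure IsSmoothing (f f' f'' : ℕ → ℝ → ℝ) (B : Set ℝ) (w : ℝ) : Prop where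
  abs_le_one : ∀ j x, |f j x| ≤ 1
  hasDerivAt : ∀ j x, HasDerivAt (f j) (f' j x) x
  hasDerivAt_deriv : ∀ j x, HasDerivAt (f' j) (f'' j x) x
  continuous_deriv_two : ∀ j, Continuous (f'' j)
  exists_abs_le : ∀ j, ∃ C, ∀ x, |f' j x| ≤ C ∧ |f'' j x| ≤ C
  ae_tendsto : ∀ᵐ x, Tendsto (fun j => f j x) atTop (𝓝 (B.indicator 1 x))
  eventually_lintegral_le : ∀ R ≥ 0, ∀ η > 2 * corrKernel R w,
    ∀ᶠ j in atTop, ∫⁻ x, ENNReal.ofReal |f' j x| * corrKernel R x ≤ η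

/-- A measurable set of reals is a window at level `w` if its indicator function has smooth
approximations concentrating their derivatives at distance at least `w` from the origin. -/
def IsWindow (B : Set ℝ) (w : ℝ) : Prop :=
  MeasurableSet B ∧ ∃ f f' f'' : ℕ → ℝ → ℝ, IsSmoothing f f' f'' B w

/-- A smoothed indicator function of the half line `(-∞, u]`. -/
def smoothStep (u : ℝ) (j : ℕ) (x : ℝ) : ℝ := stdNormalCDF ((j + 1) * (u - x))

/-- The derivative of `smoothStep u j`. -/
def smoothStepDeriv (u : ℝ) (j : ℕ) (x : ℝ) : ℝ :=
  -((j + 1) * gaussianPDFReal 0 1 ((j + 1) * (u - x)))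

/-- The second derivative of `smoothStep u j`. -/
def smoothStepDerivTwo (u : ℝ) (j : ℕ) (x : ℝ) : ℝ :=
  -((j + 1) ^ 2 * (((j + 1) * (u - x)) * gaussianPDFReal 0 1 ((j + 1) * (u - x))))

lemma smoothStep_nonneg (u : ℝ) (j : ℕ) (x : ℝ) : 0 ≤ smoothStep u j x := stdNormalCDF_nonneg _

lemma smoothStep_le_one (u : ℝ) (j : ℕ) (x : ℝ) : smoothStep u j x ≤ 1 := stdNormalCDF_le_one _

lemma hasDerivAt_add_one_mul_sub (u : ℝ) (j : ℕ) (x : ℝ) :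
    HasDerivAt (fun x : ℝ => ((j : ℝ) + 1) * (u - x)) (-((j : ℝ) + 1)) x := by
  simpa using ((hasDerivAt_id x).const_sub u).const_mul ((j : ℝ) + 1)

lemma hasDerivAt_smoothStep (u : ℝ) (j : ℕ) (x : ℝ) :
    HasDerivAt (smoothStep u j) (smoothStepDeriv u j x) x := by
  refine ((hasDerivAt_stdNormalCDF _).comp x (hasDerivAt_add_one_mul_sub u j x)).congr_deriv ?_
  rw [smoothStepDeriv]
  ring

lemma hasDerivAt_smoothStepDeriv (u : ℝ) (j : ℕ) (x : ℝ) :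
    HasDerivAt (smoothStepDeriv u j) (smoothStepDerivTwo u j x) x := by
  refine ((((hasDerivAt_gaussianPDFReal_zero_one _).comp x
    (hasDerivAt_add_one_mul_sub u j x)).const_mul ((j : ℝ) + 1)).neg).congr_deriv ?_
  rw [smoothStepDerivTwo]
  ring

@[fun_prop]
lemma measurable_smoothStepDeriv (u : ℝ) (j : ℕ) : Measurable (smoothStepDeriv u j) :=
  (continuous_iff_continuousAt.2 fun x =>
    (hasDerivAt_smoothStepDeriv u j x).continuousAt).measurable

lemma continuous_smoothStepDerivTwo (u : ℝ) (j : ℕ) : Continuous (smoothStepDerivTwo u j) := by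
  have := continuous_gaussianPDFReal_zero_one.comp
    (by fun_prop : Continuous fun x : ℝ => ((j : ℝ) + 1) * (u - x))
  unfold smoothStepDerivTwo
  fun_prop

lemma abs_smoothStepDeriv_le (u : ℝ) (j : ℕ) (x : ℝ) : |smoothStepDeriv u j x| ≤ j + 1 := by
  rw [smoothStepDeriv, abs_neg, abs_mul, abs_of_pos (by positivity : (0 : ℝ) < j + 1),
    abs_of_nonneg (gaussianPDFReal_nonneg _ _ _)]
  exact mul_le_of_le_one_right (by positivity) (gaussianPDFReal_zero_one_le_one _)

lemma abs_smoothStepDerivTwo_le (u : ℝ) (j : ℕ) (x : ℝ) :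
    |smoothStepDerivTwo u j x| ≤ (j + 1) ^ 2 := by
  rw [smoothStepDerivTwo, abs_neg, abs_mul, abs_of_pos (by positivity : (0 : ℝ) < (j + 1) ^ 2)]
  exact mul_le_of_le_one_right (by positivity) (abs_mul_gaussianPDFReal_zero_one_le_one _)

lemma tendsto_natCast_add_one_atTop : Tendsto (fun j : ℕ => (j : ℝ) + 1) atTop atTop :=
  tendsto_atTop_add_const_right _ _ tendsto_natCast_atTop_atTop

lemma ae_tendsto_smoothStep (u : ℝ) :
    ∀ᵐ x, Tendsto (fun j => smoothStep u j x) atTop (𝓝 ((Set.Iic u).indicator 1 x)) := by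
  filter_upwards [compl_mem_ae_iff.2 (measure_singleton u)] with x hx
  rcases lt_or_gt_of_ne hx with h | h
  · rw [Set.indicator_of_mem (Set.mem_Iic.2 h.le)]
    exact (tendsto_cdf_atTop (gaussianReal 0 1)).comp
      (tendsto_natCast_add_one_atTop.atTop_mul_const (sub_pos.2 h))
  · rw [Set.indicator_of_notMem (by simpa using h)]
    exact (tendsto_cdf_atBot (gaussianReal 0 1)).comp
      (tendsto_natCast_add_one_atTop.atTop_mul_const_of_neg (sub_neg.2 h))

lemma ofReal_abs_smoothStepDeriv (u : ℝ) (j : ℕ) (x : ℝ) :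
    ENNReal.ofReal |smoothStepDeriv u j x| =
      gaussianPDF u ((1 / ((j : ℝ) + 1)) ^ 2).toNNReal x := by
  have hj : (0 : ℝ) < j + 1 := by positivity
  rw [gaussianPDF, smoothStepDeriv, abs_neg,
    abs_of_nonneg (mul_nonneg hj.le (gaussianPDFReal_nonneg _ _ _)), gaussianPDFReal_zero_one,
    gaussianPDFReal, Real.coe_toNNReal _ (sq_nonneg _),
    Real.sqrt_mul (by positivity) ((1 / ((j : ℝ) + 1)) ^ 2), Real.sqrt_sq (by positivity)]
  congr 1
  have hexp : -(((j : ℝ) + 1) * (u - x)) ^ 2 / 2 =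
      -(x - u) ^ 2 / (2 * (1 / ((j : ℝ) + 1)) ^ 2) := by
    field_simp
    ring
  rw [hexp]
  field_simp

lemma lintegral_smoothStepDeriv_mul (u : ℝ) (j : ℕ) {k : ℝ → ℝ≥0∞} (hk : Measurable k) :
    ∫⁻ x, ENNReal.ofReal |smoothStepDeriv u j x| * k x =
      ∫⁻ y, k (u + 1 / ((j : ℝ) + 1) * y) ∂gaussianReal 0 1 := by
  have hv : ((1 / ((j : ℝ) + 1)) ^ 2).toNNReal ≠ 0 := by
    rw [Ne, Real.toNNReal_eq_zero, not_le]
    positivity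
  simp_rw [ofReal_abs_smoothStepDeriv]
  rw [← lintegral_gaussianReal hk u hv, ← gaussianReal_map_affine, lintegral_map hk (by fun_prop)]

lemma corrKernel_le_corrKernel {R u w : ℝ} (hR : 0 ≤ R) (hw : 0 ≤ w) (hwu : w ≤ |u|) :
    corrKernel R u ≤ corrKernel R w := by
  have hsq : w ^ 2 ≤ u ^ 2 := by
    rw [← sq_abs u]
    gcongr
  unfold corrKernel
  gcongr

lemma corrKernel_le_one {R : ℝ} (hR : 0 ≤ R) (x : ℝ) : corrKernel R x ≤ 1 :=
  ENNReal.ofReal_le_one.2 (Real.exp_le_one_iff.2 (neg_nonpos.2 (by positivity)))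

lemma tendsto_lintegral_smoothStepDeriv (u : ℝ) {R : ℝ} (hR : 0 ≤ R) :
    Tendsto (fun j => ∫⁻ x, ENNReal.ofReal |smoothStepDeriv u j x| * corrKernel R x) atTop
      (𝓝 (corrKernel R u)) := by
  simp_rw [lintegral_smoothStepDeriv_mul u _ (measurable_corrKernel R)]
  have hlim := tendsto_lintegral_of_dominated_convergence (μ := gaussianReal 0 1)
    (F := fun (j : ℕ) y => corrKernel R (u + 1 / ((j : ℝ) + 1) * y)) (f := fun _ => corrKernel R u)
    (fun _ => 1) (fun j => by fun_prop) (fun j => .of_forall fun y => corrKernel_le_one hR _)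
    (by simp) (.of_forall fun y => ?_)
  · simpa using hlim
  · have hpt : Tendsto (fun j : ℕ => u + 1 / ((j : ℝ) + 1) * y) atTop (𝓝 u) := by
      simpa using (tendsto_one_div_add_atTop_nhds_zero_nat.mul_const y).const_add u
    have hcont : Continuous (corrKernel R) := ENNReal.continuous_ofReal.comp (by fun_prop)
    exact (hcont.tendsto u).comp hpt

lemma isSmoothing_smoothStep {u w : ℝ} (hw : 0 ≤ w) (hwu : w ≤ |u|) :
    IsSmoothing (smoothStep u) (smoothStepDeriv u) (smoothStepDerivTwo u) (Set.Iic u) w where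
  abs_le_one j x := (abs_of_nonneg (smoothStep_nonneg u j x)).trans_le (smoothStep_le_one u j x)
  hasDerivAt := hasDerivAt_smoothStep u
  hasDerivAt_deriv := hasDerivAt_smoothStepDeriv u
  continuous_deriv_two := continuous_smoothStepDerivTwo u
  exists_abs_le j := ⟨max (j + 1) ((j + 1) ^ 2), fun x =>
    ⟨(abs_smoothStepDeriv_le u j x).trans (le_max_left _ _),
      (abs_smoothStepDerivTwo_le u j x).trans (le_max_right _ _)⟩⟩
  ae_tendsto := ae_tendsto_smoothStep u
  eventually_lintegral_le R hR η hη := by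
    refine (tendsto_lintegral_smoothStepDeriv u hR).eventually_le_const (lt_of_le_of_lt ?_ hη)
    rw [two_mul]
    exact (corrKernel_le_corrKernel hR hw hwu).trans le_self_add

lemma isSmoothing_smoothStep_sub {u v w : ℝ} (hw : 0 ≤ w) (hwu : w ≤ |u|) (hwv : w ≤ |v|)
    (hvu : v ≤ u) :
    IsSmoothing (fun j x => smoothStep u j x - smoothStep v j x)
      (fun j x => smoothStepDeriv u j x - smoothStepDeriv v j x)
      (fun j x => smoothStepDerivTwo u j x - smoothStepDerivTwo v j x) (Set.Ioc v u) w where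
  abs_le_one j x := abs_sub_le_iff.2
    ⟨by linarith [smoothStep_le_one u j x, smoothStep_nonneg v j x],
      by linarith [smoothStep_le_one v j x, smoothStep_nonneg u j x]⟩
  hasDerivAt j x := (hasDerivAt_smoothStep u j x).sub (hasDerivAt_smoothStep v j x)
  hasDerivAt_deriv j x := (hasDerivAt_smoothStepDeriv u j x).sub (hasDerivAt_smoothStepDeriv v j x)
  continuous_deriv_two j :=
    (continuous_smoothStepDerivTwo u j).sub (continuous_smoothStepDerivTwo v j)
  exists_abs_le j := ⟨max ((j + 1) + (j + 1)) ((j + 1) ^ 2 + (j + 1) ^ 2), fun x =>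
    ⟨((abs_sub _ _).trans (add_le_add (abs_smoothStepDeriv_le u j x)
        (abs_smoothStepDeriv_le v j x))).trans (le_max_left _ _),
      ((abs_sub _ _).trans (add_le_add (abs_smoothStepDerivTwo_le u j x)
        (abs_smoothStepDerivTwo_le v j x))).trans (le_max_right _ _)⟩⟩
  ae_tendsto := by
    filter_upwards [ae_tendsto_smoothStep u, ae_tendsto_smoothStep v] with x hxu hxv
    convert hxu.sub hxv using 2
    rw [← Set.Iic_sdiff_Iic, Set.indicator_sdiff (Set.Iic_subset_Iic.2 hvu), Pi.sub_apply]
  eventually_lintegral_le R hR η hη := by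
    refine (((tendsto_lintegral_smoothStepDeriv u hR).add
      (tendsto_lintegral_smoothStepDeriv v hR)).eventually_le_const
        (lt_of_le_of_lt ?_ hη)).mono fun j hj => le_trans ?_ hj
    · rw [two_mul]
      exact add_le_add (corrKernel_le_corrKernel hR hw hwu) (corrKernel_le_corrKernel hR hw hwv)
    · rw [← lintegral_add_left (by fun_prop)]
      refine lintegral_mono fun x => ?_
      rw [← add_mul, ← ENNReal.ofReal_add (abs_nonneg _) (abs_nonneg _)]
      gcongr
      exact abs_sub _ _

lemma isWindow_Iic {u w : ℝ} (hw : 0 ≤ w) (hwu : w ≤ |u|) : IsWindow (Set.Iic u) w :=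
  ⟨measurableSet_Iic, _, _, _, isSmoothing_smoothStep hw hwu⟩

lemma isWindow_Ioc {u v w : ℝ} (hw : 0 ≤ w) (hwu : w ≤ |u|) (hwv : w ≤ |v|) (hvu : v ≤ u) :
    IsWindow (Set.Ioc v u) w :=
  ⟨measurableSet_Ioc, _, _, _, isSmoothing_smoothStep_sub hw hwu hwv hvu⟩

end Windows

section Decoupling

lemma indicator_setOf_forall_mem {T Ω : Type*} [Fintype T] (V : T → Ω → ℝ) (B : T → Set ℝ)
    (ω : Ω) :
    {ω | ∀ t, V t ω ∈ B t}.indicator (1 : Ω → ℝ) ω = ∏ t, (B t).indicator 1 (V t ω) := by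
  by_cases h : ∀ t, V t ω ∈ B t
  · rw [Set.indicator_of_mem (by exact h)]
    simp [h]
  · rw [Set.indicator_of_notMem (by exact h)]
    obtain ⟨t, ht⟩ := not_forall.1 h
    exact (Finset.prod_eq_zero (Finset.mem_univ t) (Set.indicator_of_notMem ht _)).symm

lemma measurableSet_setOf_forall_mem {T Ω : Type*} [Countable T] [MeasurableSpace Ω]
    {V : T → Ω → ℝ} (hV : ∀ t, Measurable (V t)) {B : T → Set ℝ} (hB : ∀ t, MeasurableSet (B t)) :
    MeasurableSet {ω | ∀ t, V t ω ∈ B t} := by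
  rw [Set.ofPred_forall]
  exact .iInter fun t => hV t (hB t)

lemma tendsto_integral_prod_smooth {T Ω : Type*} [Fintype T] [MeasurableSpace Ω] {P : Measure Ω}
    [IsProbabilityMeasure P] {V : T → Ω → ℝ} (hV : ∀ t, Measurable (V t))
    (hlaw : ∀ t, P.map (V t) ≪ volume) {B : T → Set ℝ} (hB : ∀ t, MeasurableSet (B t))
    {f : T → ℕ → ℝ → ℝ} (hf : ∀ t j, Measurable (f t j)) (hf1 : ∀ t j x, |f t j x| ≤ 1)
    (hlim : ∀ t, ∀ᵐ x, Tendsto (fun j => f t j x) atTop (𝓝 ((B t).indicator 1 x))) :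
    Tendsto (fun j => ∫ ω, ∏ t, f t j (V t ω) ∂P) atTop (𝓝 (P.real {ω | ∀ t, V t ω ∈ B t})) := by
  rw [← integral_indicator_one (measurableSet_setOf_forall_mem hV hB)]
  simp_rw [indicator_setOf_forall_mem]
  refine tendsto_integral_of_dominated_convergence (fun _ => 1)
    (fun j => (Finset.measurable_fun_prod _ fun t _ =>
      (hf t j).comp (hV t)).aestronglyMeasurable) (integrable_const 1)
    (fun j => .of_forall fun ω => ?_) ?_
  · rw [Real.norm_eq_abs, Finset.abs_prod]
    exact Finset.prod_le_one (fun _ _ => abs_nonneg _) fun t _ => hf1 t j _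
  · filter_upwards [ae_all_iff.2 fun t =>
      ae_of_ae_map (hV t).aemeasurable ((hlaw t).ae_le (hlim t))] with ω hω
    exact tendsto_finsetProd _ fun t _ => hω t

section Copies

variable {T ι : Type*} [Finite T] [Fintype ι] {μ : Measure (T → ℝ)}

lemma map_copies_absolutelyContinuous [IsGaussian μ] (h1 : ∀ t, Var[fun x => x t; μ] = 1)
    (o : Option ι) (t : T) : (copies μ ι).map (fun ω => ω o t) ≪ volume := by
  have := Fintype.ofFinite T
  have hG : HasGaussianLaw (fun x : T → ℝ => x t) μ :=
    (IsGaussian.hasGaussianLaw_id (μ := μ)).map_fun (ContinuousLinearMap.proj (R := ℝ) t)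
  have hmap := Measure.map_map (μ := copies μ ι)
    (measurable_pi_apply t : Measurable fun x : T → ℝ => x t) (measurable_pi_apply o)
  have hlaw : μ.map (fun x : T → ℝ => x t) ≪ volume := by
    rw [hG.map_eq_gaussianReal, h1]
    exact gaussianReal_absolutelyContinuous _ (by simp)
  change (copies μ ι).map ((fun x : T → ℝ => x t) ∘ fun ω => ω o) ≪ volume
  rw [← hmap]
  exact (measurePreserving_eval (fun _ : Option ι => μ) o).map_eq.symm ▸ hlaw

variable [IsProbabilityMeasure μ] {B : T → Set ℝ}

lemma measureReal_copies_none (hB : ∀ t, MeasurableSet (B t)) :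
    (copies μ ι).real {ω | ∀ t, ω none t ∈ B t} = μ.real {x | ∀ t, x t ∈ B t} :=
  (measurePreserving_eval (fun _ : Option ι => μ) none).measureReal_preimage
    (measurableSet_setOf_forall_mem measurable_pi_apply hB).nullMeasurableSet

omit [Finite T] in
lemma measureReal_copies_some (g : T → ι) :
    (copies μ ι).real {ω | ∀ t, ω (some (g t)) t ∈ B t} =
      ∏ i, μ.real {x | ∀ t, g t = i → x t ∈ B t} := by
  have hpi : {ω : Option ι → T → ℝ | ∀ t, ω (some (g t)) t ∈ B t} =
      Set.univ.pi (fun o : Option ι => o.elim Set.univ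
        fun i => {x : T → ℝ | ∀ t, g t = i → x t ∈ B t}) := by
    ext ω
    simp only [Set.mem_ofPred_eq, Set.mem_univ_pi, Option.forall, Option.elim_none, Set.mem_univ,
      Option.elim_some, true_and]
    exact ⟨fun h i t hi => hi ▸ h t, fun h t => h (g t) t rfl⟩
  rw [hpi, Measure.real, Measure.pi_pi, ENNReal.toReal_prod, Fintype.prod_option]
  simp [Measure.real]

end Copies

/-- The upper bound, up to a constant, for the effect of decoupling two standard Gaussian variables
with correlation `r` which are restricted to windows at the levels `u` and `v`. -/
def comparisonTerm (r u v : ℝ) : ℝ := |r| * Real.exp (-((u ^ 2 + v ^ 2) / (2 * (1 + |r|))))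

lemma comparisonTerm_comm (r u v : ℝ) : comparisonTerm r u v = comparisonTerm r v u := by
  unfold comparisonTerm
  rw [add_comm (u ^ 2)]

lemma comparisonTerm_zero (u v : ℝ) : comparisonTerm 0 u v = 0 := by
  simp [comparisonTerm]

lemma two_mul_corrKernel_lt (R x : ℝ) {η : ℝ} (hη : 1 < η) :
    2 * corrKernel R x < ENNReal.ofReal (η * (2 * corrKernel R x).toReal) := by
  have hfin : 2 * corrKernel R x ≠ ∞ := by simp [corrKernel, ENNReal.mul_eq_top]
  have hpos : 0 < (2 * corrKernel R x).toReal :=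
    ENNReal.toReal_pos (by simp [corrKernel, Real.exp_pos]) hfin
  rw [ENNReal.lt_ofReal_iff_toReal_lt hfin]
  exact lt_mul_of_one_lt_left hpos hη

lemma abs_mul_corrKernel_mul_corrKernel_le {r R : ℝ} (hrR : |r| ≤ R) (hR : R < 1) (u v η : ℝ) :
    |r| * ((√(1 - r ^ 2))⁻¹ *
        ((η * (2 * corrKernel |r| u).toReal) * (η * (2 * corrKernel |r| v).toReal)))
        * (Real.pi / 2) ≤
      η ^ 2 * (2 * Real.pi * (√(1 - R ^ 2))⁻¹ * comparisonTerm r u v) := by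
  have hR2 : 0 < 1 - R ^ 2 :=
    one_sub_sq_pos_of_abs_lt_one (by rwa [abs_of_nonneg ((abs_nonneg r).trans hrR)])
  have hsqrt : (√(1 - r ^ 2))⁻¹ ≤ (√(1 - R ^ 2))⁻¹ := by
    rw [← sq_abs r]
    gcongr
  have hexp : -((u ^ 2 + v ^ 2) / (2 * (1 + |r|))) =
      -(u ^ 2 / (2 * (1 + |r|))) + -(v ^ 2 / (2 * (1 + |r|))) := by ring
  simp only [corrKernel, comparisonTerm, ENNReal.toReal_mul, ENNReal.toReal_ofNat,
    ENNReal.toReal_ofReal (Real.exp_pos _).le]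
  rw [hexp, Real.exp_add]
  calc _ = (√(1 - r ^ 2))⁻¹ * (η ^ 2 * (2 * Real.pi * (|r| * (Real.exp (-(u ^ 2 / (2 * (1 + |r|))))
        * Real.exp (-(v ^ 2 / (2 * (1 + |r|)))))))) := by ring
    _ ≤ (√(1 - R ^ 2))⁻¹ * (η ^ 2 * (2 * Real.pi * (|r| * (Real.exp (-(u ^ 2 / (2 * (1 + |r|))))
        * Real.exp (-(v ^ 2 / (2 * (1 + |r|)))))))) := by gcongr
    _ = _ := by ring

section NormalComparison

variable {T ι : Type*} [Fintype T] [Fintype ι] [DecidableEq ι]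

lemma abs_measure_windows_sub_prod_le_sq_mul {μ : Measure (T → ℝ)} [IsGaussian μ] (g : T → ι)
    (h0 : ∀ t, ∫ x, x t ∂μ = 0) (h1 : ∀ t, Var[fun x => x t; μ] = 1)
    {r : T → T → ℝ} (hr : ∀ s t, cov[fun x => x s, fun x => x t; μ] = r s t) {R : ℝ} (hR : R < 1)
    (hrR : ∀ s t, g s ≠ g t → |r s t| ≤ R) {B : T → Set ℝ} {w : T → ℝ}
    (hB : ∀ t, IsWindow (B t) (w t)) {η : ℝ} (hη : 1 < η) :
    |μ.real {x | ∀ t, x t ∈ B t} - ∏ i, μ.real {x | ∀ t, g t = i → x t ∈ B t}| ≤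
      η ^ 2 * (2 * Real.pi * (√(1 - R ^ 2))⁻¹ *
        ∑ s, ∑ t, if g s = g t then 0 else comparisonTerm (r s t) (w s) (w t)) := by
  have : 0 ≤ η := zero_le_one.trans hη.le
  choose hBm f f' f'' hf using hB
  choose C hC using fun t => (hf t).exists_abs_le
  have hCle : ∀ t j, C t j ≤ ∑ t, |C t j| := fun t j => (le_abs_self _).trans
    (Finset.single_le_sum (f := fun t => |C t j|) (fun _ _ => abs_nonneg _) (Finset.mem_univ t))
  have hfm : ∀ t j, Measurable (f t j) := fun t j =>
    (continuous_iff_continuousAt.2 fun x => ((hf t).hasDerivAt j x).continuousAt).measurable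
  have hsymm : ∀ s t, r s t = r t s := fun s t => by rw [← hr, ← hr, covariance_comm]
  have hlim : ∀ o : T → Option ι, Tendsto (fun j => ∫ ω, ∏ t, f t j (ω (o t) t) ∂copies μ ι) atTop
      (𝓝 ((copies μ ι).real {ω | ∀ t, ω (o t) t ∈ B t})) := fun o =>
    tendsto_integral_prod_smooth (fun t => by fun_prop)
      (fun t => map_copies_absolutelyContinuous h1 (o t) t) hBm hfm
      (fun t => (hf t).abs_le_one) (fun t => (hf t).ae_tendsto)
  have hdiff := ((hlim fun _ => none).sub (hlim fun t => some (g t))).abs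
  rw [measureReal_copies_none hBm, measureReal_copies_some] at hdiff
  refine le_of_tendsto hdiff ?_
  filter_upwards [eventually_all.2 fun s => eventually_all.2 fun t =>
    (hf s).eventually_lintegral_le _ (abs_nonneg (r s t)) _ (two_mul_corrKernel_lt _ (w s) hη)]
    with j hj
  refine (abs_integral_interp_sub_le g h0 h1 hr (fun s t h => (hrR s t h).trans_lt hR)
    (fun t => (hf t).hasDerivAt j) (fun t => (hf t).hasDerivAt_deriv j)
    (fun t => (hf t).continuous_deriv_two j) (fun t => (hf t).abs_le_one j)
    (fun t x => (hC t j x).1.trans (hCle t j)) (fun t x => (hC t j x).2.trans (hCle t j))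
    (fun s t => by positivity) hj).trans ?_
  simp only [Finset.mul_sum]
  refine Finset.sum_le_sum fun s _ => Finset.sum_le_sum fun t _ => ?_
  split_ifs with hst
  · simp
  · rw [hsymm t s]
    exact abs_mul_corrKernel_mul_corrKernel_le (hrR s t hst) hR _ _ η

lemma abs_measure_windows_sub_prod_le {μ : Measure (T → ℝ)} [IsGaussian μ] (g : T → ι)
    (h0 : ∀ t, ∫ x, x t ∂μ = 0) (h1 : ∀ t, Var[fun x => x t; μ] = 1)
    {r : T → T → ℝ} (hr : ∀ s t, cov[fun x => x s, fun x => x t; μ] = r s t) {R : ℝ} (hR : R < 1)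
    (hrR : ∀ s t, g s ≠ g t → |r s t| ≤ R) {B : T → Set ℝ} {w : T → ℝ}
    (hB : ∀ t, IsWindow (B t) (w t)) :
    |μ.real {x | ∀ t, x t ∈ B t} - ∏ i, μ.real {x | ∀ t, g t = i → x t ∈ B t}| ≤
      2 * Real.pi * (√(1 - R ^ 2))⁻¹ *
        ∑ s, ∑ t, if g s = g t then 0 else comparisonTerm (r s t) (w s) (w t) := by
  set K := 2 * Real.pi * (√(1 - R ^ 2))⁻¹ *
    ∑ s, ∑ t, if g s = g t then 0 else comparisonTerm (r s t) (w s) (w t)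
  have hcont : Tendsto (fun η : ℝ => η ^ 2 * K) (𝓝[>] 1) (𝓝 (1 ^ 2 * K)) :=
    ((by fun_prop : Continuous fun η : ℝ => η ^ 2 * K).tendsto 1).mono_left nhdsWithin_le_nhds
  rw [one_pow, one_mul] at hcont
  exact ge_of_tendsto hcont (eventually_mem_nhdsWithin.mono fun η hη =>
    abs_measure_windows_sub_prod_le_sq_mul g h0 h1 hr hR hrR hB hη)

variable {Ω : Type*} [MeasurableSpace Ω] {P : Measure Ω} {Z : T → Ω → ℝ}

theorem abs_measureReal_windows_sub_prod_le (hZ : HasGaussianLaw (fun ω t => Z t ω) P) (g : T → ι)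
    (h0 : ∀ t, ∫ ω, Z t ω ∂P = 0) (h1 : ∀ t, Var[Z t; P] = 1) {R : ℝ} (hR : R < 1)
    (hrR : ∀ s t, g s ≠ g t → |cov[Z s, Z t; P]| ≤ R)
    {B : T → Set ℝ} {w : T → ℝ} (hB : ∀ t, IsWindow (B t) (w t)) :
    |P.real {ω | ∀ t, Z t ω ∈ B t} - ∏ i, P.real {ω | ∀ t, g t = i → Z t ω ∈ B t}| ≤
      2 * Real.pi * (√(1 - R ^ 2))⁻¹ *
        ∑ s, ∑ t, if g s = g t then 0 else comparisonTerm cov[Z s, Z t; P] (w s) (w t) := by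
  have hm : AEMeasurable (fun ω t => Z t ω) P := hZ.aemeasurable
  have hG : IsGaussian (P.map fun ω t => Z t ω) := hZ.isGaussian_map
  have key := abs_measure_windows_sub_prod_le (μ := P.map fun ω t => Z t ω) g
    (fun t => (integral_map hm (measurable_pi_apply t).aestronglyMeasurable).trans (h0 t))
    (fun t => (variance_map (measurable_pi_apply t).aemeasurable hm).trans (h1 t))
    (r := fun s t => cov[Z s, Z t; P])
    (fun s t => covariance_map (measurable_pi_apply s).aestronglyMeasurable
      (measurable_pi_apply t).aestronglyMeasurable hm)
    hR hrR hB
  have hpi : ∀ s : Set T, MeasurableSet {x : T → ℝ | ∀ t, t ∈ s → x t ∈ B t} := fun s =>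
    MeasurableSet.pi s.to_countable fun t _ => (hB t).1
  have hblock : ∀ i, MeasurableSet {x : T → ℝ | ∀ t, g t = i → x t ∈ B t} := fun i =>
    hpi {t | g t = i}
  rw [map_measureReal_apply_of_aemeasurable hm
    (measurableSet_setOf_forall_mem measurable_pi_apply fun t => (hB t).1)] at key
  simp_rw [map_measureReal_apply_of_aemeasurable hm (hblock _)] at key
  exact key

end NormalComparison

end Decoupling

/-! ### Asymptotics of the levels -/

lemma tendsto_log_natCast : Tendsto (fun n : ℕ => Real.log n) atTop atTop :=
  Real.tendsto_log_atTop.comp tendsto_natCast_atTop_atTop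

lemma eventually_log_pos : ∀ᶠ n : ℕ in atTop, 0 < Real.log n :=
  tendsto_log_natCast.eventually_gt_atTop 0

lemma tendsto_sqrt_two_mul_log : Tendsto (fun n : ℕ => √(2 * Real.log n)) atTop atTop :=
  Real.tendsto_sqrt_atTop.comp (tendsto_log_natCast.const_mul_atTop two_pos)

lemma sqrt_two_mul_log_sq (n : ℕ) : √(2 * Real.log n) ^ 2 = 2 * Real.log n :=
  Real.sq_sqrt (mul_nonneg zero_le_two (Real.log_natCast_nonneg n))

lemma tendsto_logLog_pow_div_log (k : ℕ) :
    Tendsto (fun n : ℕ => Real.log (4 * Real.pi * Real.log n) ^ k / Real.log n) atTop (𝓝 0) := by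
  have h1 : Tendsto (fun n : ℕ => 4 * Real.pi * Real.log n) atTop atTop :=
    tendsto_log_natCast.const_mul_atTop (by positivity)
  have h2 := (Real.tendsto_pow_log_div_mul_add_atTop (1 / (4 * Real.pi)) 0 k
    (by positivity)).comp h1
  refine h2.congr fun n => ?_
  simp only [Function.comp]
  congr 1
  field_simp
  ring

lemma tendsto_scaleConst : Tendsto scaleConst atTop (𝓝 0) := by
  exact tendsto_const_nhds.div_atTop tendsto_sqrt_two_mul_log

lemma scaleConst_pos {n : ℕ} (h : 0 < Real.log n) : 0 < scaleConst n := by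
  unfold scaleConst; positivity

lemma scaleConst_mul_locConst {n : ℕ} (h : 0 < Real.log n) :
    scaleConst n * locConst n
      = 1 - Real.log (4 * Real.pi * Real.log n) ^ 1 / Real.log n * (1 / 4) := by
  have : 0 < √(2 * Real.log n) := by positivity
  unfold scaleConst locConst
  field_simp
  rw [sqrt_two_mul_log_sq]
  ring

lemma tendsto_scaleConst_mul_locConst :
    Tendsto (fun n => scaleConst n * locConst n) atTop (𝓝 1) := by
  have h := ((tendsto_logLog_pow_div_log 1).mul_const (1 / 4)).const_sub 1
  simp only [zero_mul, sub_zero] at h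
  refine h.congr' ?_
  filter_upwards [eventually_log_pos] with n hn
  rw [scaleConst_mul_locConst hn]

lemma tendsto_scaleConst_mul_level (z : ℝ) :
    Tendsto (fun n => scaleConst n * level n z) atTop (𝓝 1) := by
  have h := ((tendsto_scaleConst.mul tendsto_scaleConst).mul_const z).add
    tendsto_scaleConst_mul_locConst
  simp only [zero_mul, zero_add] at h
  refine h.congr fun n => ?_
  unfold level
  ring

lemma neg_locConst_sq_div_two {n : ℕ} (h : 0 < Real.log n) :
    -locConst n ^ 2 / 2 = -Real.log n + Real.log (4 * Real.pi * Real.log n) / 2 -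
      Real.log (4 * Real.pi * Real.log n) ^ 2 / Real.log n * (1 / 16) := by
  have hs : √(2 * Real.log n) ≠ 0 := by positivity
  have hexp : locConst n ^ 2 = √(2 * Real.log n) ^ 2 - Real.log (4 * Real.pi * Real.log n) +
      Real.log (4 * Real.pi * Real.log n) ^ 2 / (4 * √(2 * Real.log n) ^ 2) := by
    unfold locConst
    field_simp
    ring
  rw [hexp, sqrt_two_mul_log_sq]
  field_simp
  ring

lemma mul_scaleConst_mul_pdf_locConst {n : ℕ} (h : 0 < Real.log n) :
    n * scaleConst n * gaussianPDFReal 0 1 (locConst n)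
      = Real.exp (-(Real.log (4 * Real.pi * Real.log n) ^ 2 / Real.log n * (1 / 16))) := by
  have hn : (0 : ℝ) < n := Nat.cast_pos.2 (Nat.pos_of_ne_zero fun h0 => by simp [h0] at h)
  have hsqrt : Real.exp (Real.log (4 * Real.pi * Real.log n) / 2) =
      √(2 * Real.log n) * √(2 * Real.pi) := by
    rw [← Real.sqrt_mul (by positivity), Real.exp_half, Real.exp_log (by positivity)]
    ring_nf
  rw [gaussianPDFReal_zero_one, neg_locConst_sq_div_two h, sub_eq_add_neg, Real.exp_add,
    Real.exp_add, hsqrt, Real.exp_neg, Real.exp_log hn, scaleConst]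
  field_simp

lemma tendsto_mul_pdf_locConst :
    Tendsto (fun n : ℕ => n * scaleConst n * gaussianPDFReal 0 1 (locConst n)) atTop (𝓝 1) := by
  have h := (((tendsto_logLog_pow_div_log 2).mul_const (1 / 16)).neg).rexp
  simp only [zero_mul, neg_zero, Real.exp_zero] at h
  refine h.congr' ?_
  filter_upwards [eventually_log_pos] with n hn
  rw [mul_scaleConst_mul_pdf_locConst hn]

lemma pdf_level (n : ℕ) (z : ℝ) : gaussianPDFReal 0 1 (level n z) =
    gaussianPDFReal 0 1 (locConst n) *
      Real.exp (-(scaleConst n * locConst n * z + (scaleConst n * z) ^ 2 / 2)) := by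
  rw [gaussianPDFReal_zero_one, gaussianPDFReal_zero_one, mul_assoc, ← Real.exp_add]
  congr 2
  unfold level
  ring

lemma tendsto_mul_pdf_level (z : ℝ) :
    Tendsto (fun n : ℕ => n * scaleConst n * gaussianPDFReal 0 1 (level n z)) atTop
      (𝓝 (Real.exp (-z))) := by
  have h1 : Tendsto (fun n => -(scaleConst n * locConst n * z + (scaleConst n * z) ^ 2 / 2)) atTop
      (𝓝 (-(1 * z + (0 * z) ^ 2 / 2))) :=
    ((tendsto_scaleConst_mul_locConst.mul_const z).add
      (((tendsto_scaleConst.mul_const z).pow 2).div_const 2)).neg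
  have h := tendsto_mul_pdf_locConst.mul h1.rexp
  simp only [one_mul, zero_mul, ne_eq, OfNat.ofNat_ne_zero, not_false_eq_true, zero_pow, zero_div,
    add_zero] at h
  refine h.congr fun n => ?_
  rw [pdf_level]
  ring

lemma eventually_mul_pdf_level_le (y : ℝ) : ∀ᶠ n : ℕ in atTop, ∀ z > y,
    n * scaleConst n * gaussianPDFReal 0 1 (level n z) ≤
      2 * Real.exp (2 * |y|) * Real.exp (-(1 / 2) * z) := by
  filter_upwards [tendsto_mul_pdf_locConst.eventually_le_const (by norm_num : (1 : ℝ) < 2),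
    tendsto_scaleConst_mul_locConst.eventually_le_const (by norm_num : (1 : ℝ) < 2),
    tendsto_scaleConst_mul_locConst.eventually_const_le (by norm_num : (1 / 2 : ℝ) < 1)]
    with n h1 h2 h3 z hz
  rw [pdf_level, ← mul_assoc, mul_assoc 2, ← Real.exp_add]
  refine mul_le_mul h1 (Real.exp_le_exp.2 ?_) (Real.exp_pos _).le (by norm_num)
  have : 0 ≤ (scaleConst n * z) ^ 2 / 2 := by positivity
  rcases le_or_gt 0 z with h0 | h0
  · nlinarith [abs_nonneg y]
  · have : |y| = -y := abs_of_neg (hz.trans h0)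
    nlinarith

lemma tendsto_level_atTop (z : ℝ) : Tendsto (fun n => level n z) atTop atTop := by
  have h := (tendsto_scaleConst_mul_level z).pos_mul_atTop one_pos tendsto_sqrt_two_mul_log
  refine h.congr' ?_
  filter_upwards [eventually_log_pos] with n hn
  have : 0 < √(2 * Real.log n) := by positivity
  rw [scaleConst]
  field_simp

lemma eventually_level_sq_le (z : ℝ) : ∀ᶠ n : ℕ in atTop, level n z ^ 2 ≤ 3 * Real.log n := by
  have h := (tendsto_scaleConst_mul_level z).pow 2
  filter_upwards [h.eventually_le_const (by norm_num : (1 : ℝ) ^ 2 < 3 / 2), eventually_log_pos]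
    with n h1 hn
  rw [mul_pow, scaleConst, div_pow, sqrt_two_mul_log_sq, one_pow] at h1
  rw [div_mul_eq_mul_div, one_mul, div_le_iff₀ (by positivity)] at h1
  linarith

lemma exists_exp_neg_level_sq_le (z : ℝ) : ∃ K > 0, ∀ᶠ n : ℕ in atTop,
    Real.exp (-(level n z ^ 2 / 2)) ≤ K * √(Real.log n) / n := by
  refine ⟨2 * Real.exp (-z) * √(2 * Real.pi) * √2, by positivity, ?_⟩
  filter_upwards [(tendsto_mul_pdf_level z).eventually_le_const
    (by linarith [Real.exp_pos (-z)] : Real.exp (-z) < 2 * Real.exp (-z)), eventually_log_pos,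
    eventually_gt_atTop 0] with n hpdf hlog hn
  have hn' : (0 : ℝ) < n := Nat.cast_pos.2 hn
  rw [gaussianPDFReal_zero_one, scaleConst, Real.sqrt_mul zero_le_two, neg_div] at hpdf
  rw [le_div_iff₀ hn']
  calc Real.exp (-(level n z ^ 2 / 2)) * n
      = n * (1 / (√2 * √(Real.log n))) * ((√(2 * Real.pi))⁻¹ *
          Real.exp (-(level n z ^ 2 / 2))) * (√(2 * Real.pi) * √2 * √(Real.log n)) := by
        field_simp
    _ ≤ 2 * Real.exp (-z) * (√(2 * Real.pi) * √2 * √(Real.log n)) := by gcongr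
    _ = _ := by ring

/-! ### Tail integrals -/

lemma mul_setIntegral_Ioi_level {n : ℕ} (hn : 0 < Real.log n) (G : ℝ → ℝ) (y : ℝ) :
    n * ∫ t in Set.Ioi (level n y), G t ∂gaussianReal 0 1 =
      ∫ z in Set.Ioi y, n * scaleConst n * gaussianPDFReal 0 1 (level n z) * G (level n z) := by
  have hdens : ∫ t in Set.Ioi (level n y), G t ∂gaussianReal 0 1 =
      ∫ t in Set.Ioi (level n y), gaussianPDFReal 0 1 t * G t := by
    rw [← integral_indicator measurableSet_Ioi, ← integral_indicator measurableSet_Ioi,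
      integral_gaussianReal_eq_integral_smul one_ne_zero]
    simp only [smul_eq_mul, Set.indicator_mul_right]
  have hshift := (measurePreserving_add_right volume (locConst n)).setIntegral_preimage_emb
    (MeasurableEquiv.addRight (locConst n)).measurableEmbedding
    (fun t => gaussianPDFReal 0 1 t * G t) (Set.Ioi (level n y))
  rw [Set.preimage_add_const_Ioi, level, add_sub_cancel_right,
    ← integral_comp_mul_left_Ioi' _ _ (scaleConst_pos hn), smul_eq_mul] at hshift
  rw [hdens, level, ← hshift, ← integral_const_mul, ← integral_const_mul]
  simp only [level, mul_assoc]

lemma tendsto_mul_tail_integral {y : ℝ} {G : ℕ → ℝ → ℝ} {G₀ : ℝ → ℝ} {S : Set ℝ}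
    (hS : S.Countable) (hm : ∀ n, Measurable (G n)) (h0 : ∀ n t, 0 ≤ G n t) (h1 : ∀ n t, G n t ≤ 1)
    (hlim : ∀ z ∉ S, Tendsto (fun n => G n (level n z)) atTop (𝓝 (G₀ z))) :
    Tendsto (fun n : ℕ => n * ∫ t in Set.Ioi (level n y), G n t ∂gaussianReal 0 1) atTop
      (𝓝 (∫ z in Set.Ioi y, Real.exp (-z) * G₀ z)) := by
  have hlev : ∀ n, Measurable fun z => level n z := fun n => by unfold level; fun_prop
  refine Tendsto.congr' (eventually_log_pos.mono fun n hn =>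
    (mul_setIntegral_Ioi_level hn (G n) y).symm) ?_
  refine tendsto_integral_filter_of_dominated_convergence
    (fun z => 2 * Real.exp (2 * |y|) * Real.exp (-(1 / 2) * z)) ?_ ?_ ?_ ?_
  · exact .of_forall fun n => ((((measurable_gaussianPDFReal 0 1).comp (hlev n)).const_mul _).mul
      ((hm n).comp (hlev n))).aestronglyMeasurable
  · filter_upwards [eventually_mul_pdf_level_le y, eventually_log_pos] with n hn hl
    filter_upwards [ae_restrict_mem measurableSet_Ioi] with z hz
    have hpos : 0 ≤ n * scaleConst n * gaussianPDFReal 0 1 (level n z) :=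
      mul_nonneg (mul_nonneg (Nat.cast_nonneg n) (scaleConst_pos hl).le)
        (gaussianPDFReal_nonneg _ _ _)
    rw [Real.norm_eq_abs, abs_mul, abs_of_nonneg hpos, abs_of_nonneg (h0 _ _)]
    exact (mul_le_of_le_one_right hpos (h1 _ _)).trans (hn z hz)
  · exact (exp_neg_integrableOn_Ioi y (by norm_num)).const_mul _
  · filter_upwards [ae_restrict_of_ae (hS.ae_notMem volume)] with z hz
    exact (tendsto_mul_pdf_level z).mul (hlim z hz)

lemma tendsto_mul_tail (x : ℝ) :
    Tendsto (fun n : ℕ => n * (gaussianReal 0 1).real (Set.Ioi (level n x))) atTop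
      (𝓝 (Real.exp (-x))) := by
  have h := tendsto_mul_tail_integral (y := x) (G := fun _ _ => 1) (G₀ := fun _ => 1)
    Set.countable_empty (fun _ => measurable_const) (fun _ _ => zero_le_one) (fun _ _ => le_rfl)
    (fun _ _ => tendsto_const_nhds)
  simpa only [mul_one, integral_exp_neg_Ioi, setIntegral_const, smul_eq_mul] using h

/-! ### The Hüsler–Reiss limit -/

/-- The exponent `-log H_lam` of the Hüsler–Reiss distribution function. -/
def hrExponent (lam : ℝ≥0∞) (x y : ℝ) : ℝ :=
  if lam = 0 then max (Real.exp (-x)) (Real.exp (-y))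
  else if lam = ⊤ then Real.exp (-x) + Real.exp (-y)
  else stdNormalCDF (lam.toReal + (x - y) / (2 * lam.toReal)) * Real.exp (-y)
    + stdNormalCDF (lam.toReal + (y - x) / (2 * lam.toReal)) * Real.exp (-x)

lemma hrCDF_eq_exp (lam : ℝ≥0∞) (x y : ℝ) : hrCDF lam x y = Real.exp (-hrExponent lam x y) := by
  unfold hrCDF hrExponent gumbel
  split_ifs
  · rw [← Real.exp_monotone.map_min, ← min_neg_neg]
  · rw [← Real.exp_add]
    ring_nf
  · ring_nf

/-- The limit of `P(ξ ≤ u_n(x) | η = u_n(z))` for a standard normal pair `(ξ, η)` whose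
correlation `ρ_n` satisfies `(1 - ρ_n) log n → lam ^ 2`. -/
def condLimit (lam : ℝ≥0∞) (x z : ℝ) : ℝ :=
  if lam = 0 then (Set.Iio x).indicator (fun _ => 1) z
  else if lam = ⊤ then 1
  else stdNormalCDF (lam.toReal + (x - z) / (2 * lam.toReal))

lemma integral_Ioi_exp_neg_mul_indicator_Iio (x y : ℝ) :
    ∫ z in Set.Ioi y, Real.exp (-z) * (Set.Iio x).indicator (fun _ => 1) z =
      max (Real.exp (-x)) (Real.exp (-y)) - Real.exp (-x) := by
  have hint : IntegrableOn (fun z : ℝ => Real.exp (-z)) (Set.Ioi y) := by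
    simpa using exp_neg_integrableOn_Ioi y one_pos
  have hind : ∀ z : ℝ, Real.exp (-z) * (Set.Iio x).indicator (fun _ => (1 : ℝ)) z =
      (Set.Iio x).indicator (fun z => Real.exp (-z)) z := fun z => by
    simp [Set.indicator_apply]
  simp_rw [hind]
  rw [setIntegral_indicator measurableSet_Iio, Set.Ioi_inter_Iio]
  rcases le_or_gt x y with hxy | hxy
  · rw [Set.Ioo_eq_empty (not_lt.2 hxy), max_eq_left (Real.exp_le_exp.2 (by linarith))]
    simp
  · rw [max_eq_right (Real.exp_le_exp.2 (by linarith)), ← integral_Ioc_eq_integral_Ioo,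
      ← intervalIntegral.integral_of_le hxy.le,
      ← intervalIntegral.integral_Ioi_sub_Ioi hint hxy.le, integral_exp_neg_Ioi,
      integral_exp_neg_Ioi]

lemma exp_neg_mul_gaussianPDFReal {l : ℝ} (hl : l ≠ 0) (x z : ℝ) :
    Real.exp (-z) * gaussianPDFReal 0 1 (l + (x - z) / (2 * l)) =
      Real.exp (-x) * gaussianPDFReal 0 1 (l + (z - x) / (2 * l)) := by
  rw [gaussianPDFReal_zero_one, gaussianPDFReal_zero_one, mul_left_comm,
    mul_left_comm (Real.exp (-x)), ← Real.exp_add, ← Real.exp_add]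
  congr 2
  field_simp
  ring

/-- An antiderivative of `z ↦ exp (-z) * Φ (l + (x - z) / (2 * l))`. -/
def hrPrimitive (l x z : ℝ) : ℝ :=
  -(Real.exp (-z) * stdNormalCDF (l + (x - z) / (2 * l))) -
    Real.exp (-x) * stdNormalCDF (l + (z - x) / (2 * l))

lemma hasDerivAt_hrPrimitive {l : ℝ} (hl : l ≠ 0) (x z : ℝ) :
    HasDerivAt (hrPrimitive l x) (Real.exp (-z) * stdNormalCDF (l + (x - z) / (2 * l))) z := by
  have hexp : HasDerivAt (fun z : ℝ => Real.exp (-z)) (-Real.exp (-z)) z := by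
    simpa using (hasDerivAt_neg z).exp
  have hdec : HasDerivAt (fun z : ℝ => l + (x - z) / (2 * l)) (-1 / (2 * l)) z := by
    simpa using (((hasDerivAt_id z).const_sub x).div_const (2 * l)).const_add l
  have hinc : HasDerivAt (fun z : ℝ => l + (z - x) / (2 * l)) (1 / (2 * l)) z := by
    simpa using (((hasDerivAt_id z).sub_const x).div_const (2 * l)).const_add l
  refine ((hexp.mul ((hasDerivAt_stdNormalCDF _).comp z hdec)).neg.sub
    (((hasDerivAt_stdNormalCDF _).comp z hinc).const_mul (Real.exp (-x)))).congr_deriv ?_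
  simp only [Function.comp]
  linear_combination (1 / (2 * l)) * exp_neg_mul_gaussianPDFReal hl x z

lemma tendsto_hrPrimitive_atTop {l : ℝ} (hl : 0 < l) (x : ℝ) :
    Tendsto (hrPrimitive l x) atTop (𝓝 (-Real.exp (-x))) := by
  have hfst : Tendsto (fun z : ℝ => Real.exp (-z) * stdNormalCDF (l + (x - z) / (2 * l))) atTop
      (𝓝 0) :=
    squeeze_zero (fun z => mul_nonneg (Real.exp_pos _).le (stdNormalCDF_nonneg _))
      (fun z => mul_le_of_le_one_right (Real.exp_pos _).le (stdNormalCDF_le_one _))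
      Real.tendsto_exp_neg_atTop_nhds_zero
  have hsnd : Tendsto (fun z : ℝ => stdNormalCDF (l + (z - x) / (2 * l))) atTop (𝓝 1) :=
    (tendsto_cdf_atTop (gaussianReal 0 1)).comp <| tendsto_atTop_add_const_left _ _ <|
      (tendsto_atTop_add_const_right _ (-x) tendsto_id).atTop_div_const (by positivity)
  have h := hfst.neg.sub (hsnd.const_mul (Real.exp (-x)))
  rwa [neg_zero, zero_sub, mul_one] at h

lemma integral_condLimit (lam : ℝ≥0∞) (x y : ℝ) :
    ∫ z in Set.Ioi y, Real.exp (-z) * condLimit lam x z = hrExponent lam x y - Real.exp (-x) := by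
  unfold condLimit hrExponent
  by_cases h0 : lam = 0
  · simp only [if_pos h0, integral_Ioi_exp_neg_mul_indicator_Iio]
  by_cases htop : lam = ⊤
  · simp only [if_neg h0, if_pos htop, mul_one, integral_exp_neg_Ioi]
    ring
  simp only [if_neg h0, if_neg htop]
  have hl : 0 < lam.toReal := ENNReal.toReal_pos h0 htop
  rw [integral_Ioi_of_hasDerivAt_of_nonneg
    (hasDerivAt_hrPrimitive hl.ne' x y).continuousAt.continuousWithinAt
    (fun z _ => hasDerivAt_hrPrimitive hl.ne' x z)
    (fun z _ => mul_nonneg (Real.exp_pos _).le (stdNormalCDF_nonneg _))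
    (tendsto_hrPrimitive_atTop hl x), hrPrimitive]
  ring

lemma measureReal_bivGaussian_eq_integral (r u v : ℝ) :
    (bivGaussian r).real {p | p.1 ≤ u ∧ v < p.2} =
      ∫ t in Set.Ioi v, (gaussianReal 0 1).real {w | r * t + √(1 - r ^ 2) * w ≤ u}
        ∂(gaussianReal 0 1) := by
  have hms : MeasurableSet {p : ℝ × ℝ | p.1 ≤ u ∧ v < p.2} :=
    (measurableSet_le measurable_fst measurable_const).inter
      (measurableSet_lt measurable_const measurable_snd)
  have hf : Measurable fun p : ℝ × ℝ => (r * p.1 + √(1 - r ^ 2) * p.2, p.1) := by fun_prop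
  rw [bivGaussian, map_measureReal_apply hf hms, Measure.real, Measure.prod_apply (hf hms),
    ← integral_toReal (measurable_measure_prodMk_left (hf hms)).aemeasurable
      (.of_forall fun t => measure_lt_top _ _), ← integral_indicator measurableSet_Ioi]
  refine integral_congr_ae (.of_forall fun t => ?_)
  by_cases ht : v < t
  · simp only [Set.indicator_of_mem (Set.mem_Ioi.2 ht), Measure.real]
    congr 2
    ext w
    simp [ht]
  · simp only [Set.indicator_of_notMem (by simpa using ht : t ∉ Set.Ioi v)]
    have : (Prod.mk t ⁻¹' ((fun p : ℝ × ℝ => (r * p.1 + √(1 - r ^ 2) * p.2, p.1)) ⁻¹'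
        {p | p.1 ≤ u ∧ v < p.2})) = ∅ := by
      ext w
      simp [ht]
    rw [this]
    simp
lemma tendsto_measure_halfline_one {s d : ℕ → ℝ} (hs : ∀ᶠ n in atTop, 0 ≤ s n)
    (h : ∀ K, ∀ᶠ n in atTop, K * s n ≤ d n) :
    Tendsto (fun n => (gaussianReal 0 1).real {w | s n * w ≤ d n}) atTop (𝓝 1) := by
  refine tendsto_order.2 ⟨fun a ha => ?_,
    fun a ha => .of_forall fun n => measureReal_le_one.trans_lt ha⟩
  obtain ⟨K, hK⟩ := ((tendsto_cdf_atTop (gaussianReal 0 1)).eventually_const_lt ha).exists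
  rw [cdf_eq_real] at hK
  filter_upwards [hs, h K] with n hsn hdn
  refine hK.trans_le (measureReal_mono fun w hw => ?_)
  rw [mul_comm] at hdn
  exact (mul_le_mul_of_nonneg_left (Set.mem_Iic.1 hw) hsn).trans hdn

lemma tendsto_measure_halfline_zero {s d : ℕ → ℝ} (hs : ∀ᶠ n in atTop, 0 ≤ s n)
    (h : ∀ K, ∀ᶠ n in atTop, d n + K * s n < 0) :
    Tendsto (fun n => (gaussianReal 0 1).real {w | s n * w ≤ d n}) atTop (𝓝 0) := by
  refine tendsto_order.2 ⟨fun a ha => .of_forall fun n => ha.trans_le measureReal_nonneg,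
    fun a ha => ?_⟩
  obtain ⟨K, hK⟩ := ((tendsto_cdf_atBot (gaussianReal 0 1)).eventually_lt_const ha).exists
  rw [cdf_eq_real] at hK
  filter_upwards [hs, h (-K)] with n hsn hdn
  refine (measureReal_mono fun w (hw : s n * w ≤ d n) => ?_).trans_lt hK
  by_contra hcon
  linarith [mul_le_mul_of_nonneg_left (lt_of_not_ge hcon).le hsn]

lemma tendsto_measure_halfline_cdf {s d : ℕ → ℝ} {A : ℝ} (hs : ∀ᶠ n in atTop, 0 < s n)
    (h : Tendsto (fun n => d n / s n) atTop (𝓝 A)) :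
    Tendsto (fun n => (gaussianReal 0 1).real {w | s n * w ≤ d n}) atTop (𝓝 (stdNormalCDF A)) := by
  refine ((continuous_stdNormalCDF.tendsto A).comp h).congr' ?_
  filter_upwards [hs] with n hn
  simp only [Function.comp, stdNormalCDF, cdf_eq_real]
  congr 1
  ext w
  rw [Set.mem_Iic, le_div_iff₀ hn, mul_comm]
  rfl

/-! ### Joint exceedances of a correlated pair -/

section CondProb

variable {ρ : ℕ → ℝ} {lam : ℝ≥0∞}

lemma eventually_one_sub_mul_log_nonneg (hρ : ∀ᶠ n in atTop, |ρ n| ≤ 1) :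
    ∀ᶠ n : ℕ in atTop, 0 ≤ (1 - ρ n) * Real.log n :=
  hρ.mono fun n hn => mul_nonneg (sub_nonneg.2 (abs_le.1 hn).2) (Real.log_natCast_nonneg n)

lemma condProb_event_iff {n : ℕ} (hn : 0 < Real.log n) (r x z w : ℝ) :
    r * level n z + √(1 - r ^ 2) * w ≤ level n x ↔
      √(2 * ((1 - r) * Real.log n) * (1 + r)) * w ≤
        x - z + 2 * ((1 - r) * Real.log n) * (scaleConst n * level n z) := by
  have hL : 0 < √(2 * Real.log n) := by positivity
  have hslope : √(2 * ((1 - r) * Real.log n) * (1 + r)) = √(2 * Real.log n) * √(1 - r ^ 2) := by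
    rw [← Real.sqrt_mul (by positivity)]
    ring_nf
  have hshift : x - z + 2 * ((1 - r) * Real.log n) * (scaleConst n * level n z) =
      √(2 * Real.log n) * (level n x - r * level n z) := by
    have hdiff : √(2 * Real.log n) * (level n x - level n z) = x - z := by
      simp only [level, scaleConst]
      field_simp
      ring
    have hscale : 2 * Real.log n * scaleConst n = √(2 * Real.log n) := by
      rw [scaleConst, mul_one_div, div_eq_iff hL.ne', ← sq, sqrt_two_mul_log_sq]
    linear_combination -hdiff + (1 - r) * level n z * hscale
  rw [hslope, hshift, mul_assoc, mul_le_mul_iff_right₀ hL, le_sub_iff_add_le']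

lemma tendsto_one_sub_mul_log (hρ : ∀ᶠ n in atTop, |ρ n| ≤ 1)
    (hlam : Tendsto (fun n : ℕ => ENNReal.ofReal ((1 - ρ n) * Real.log n)) atTop (𝓝 (lam ^ 2)))
    (htop : lam ≠ ⊤) :
    Tendsto (fun n : ℕ => (1 - ρ n) * Real.log n) atTop (𝓝 (lam.toReal ^ 2)) := by
  have h := (ENNReal.tendsto_toReal (ENNReal.pow_ne_top htop)).comp hlam
  rw [ENNReal.toReal_pow] at h
  exact h.congr' ((eventually_one_sub_mul_log_nonneg hρ).mono fun n hn => ENNReal.toReal_ofReal hn)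

lemma tendsto_one_of_tendsto_one_sub_mul_log {q : ℝ}
    (hq : Tendsto (fun n : ℕ => (1 - ρ n) * Real.log n) atTop (𝓝 q)) :
    Tendsto ρ atTop (𝓝 1) := by
  have h := (hq.div_atTop tendsto_log_natCast).const_sub 1
  rw [sub_zero] at h
  refine h.congr' ?_
  filter_upwards [eventually_log_pos] with n hn
  rw [mul_div_cancel_right₀ _ hn.ne', sub_sub_cancel]

lemma tendsto_condProb_of_ne_top (hρ : ∀ᶠ n in atTop, |ρ n| ≤ 1)
    (hlam : Tendsto (fun n : ℕ => ENNReal.ofReal ((1 - ρ n) * Real.log n)) atTop (𝓝 (lam ^ 2)))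
    (htop : lam ≠ ⊤) {x z : ℝ} (hz : z ≠ x) :
    Tendsto (fun n : ℕ => (gaussianReal 0 1).real
      {w | √(2 * ((1 - ρ n) * Real.log n) * (1 + ρ n)) * w ≤
        x - z + 2 * ((1 - ρ n) * Real.log n) * (scaleConst n * level n z)}) atTop
      (𝓝 (condLimit lam x z)) := by
  have hq := tendsto_one_sub_mul_log hρ hlam htop
  set l := lam.toReal with hl
  have hslope : Tendsto (fun n : ℕ => √(2 * ((1 - ρ n) * Real.log n) * (1 + ρ n))) atTop
      (𝓝 (2 * l)) := by
    have h := ((hq.const_mul 2).mul ((tendsto_one_of_tendsto_one_sub_mul_log hq).const_add 1)).sqrt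
    rwa [show 2 * l ^ 2 * (1 + 1) = (2 * l) ^ 2 by ring, Real.sqrt_sq (by positivity)] at h
  have hshift := ((hq.const_mul 2).mul (tendsto_scaleConst_mul_level z)).const_add (x - z)
  rw [mul_one] at hshift
  have hnonneg : ∀ᶠ n : ℕ in atTop, 0 ≤ √(2 * ((1 - ρ n) * Real.log n) * (1 + ρ n)) :=
    .of_forall fun n => Real.sqrt_nonneg _
  unfold condLimit
  by_cases h0 : lam = 0
  · have hl0 : l = 0 := by simp [hl, h0]
    simp only [hl0, mul_zero, ne_eq, OfNat.ofNat_ne_zero, not_false_eq_true, zero_pow, add_zero]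
      at hslope hshift
    rw [if_pos h0]
    rcases lt_or_gt_of_ne hz with h | h
    · rw [Set.indicator_of_mem (Set.mem_Iio.2 h)]
      refine tendsto_measure_halfline_one hnonneg fun K => ?_
      exact ((hslope.const_mul K).eventually_lt hshift (by simpa using h)).mono fun n hn => hn.le
    · rw [Set.indicator_of_notMem (by simpa using h.le)]
      refine tendsto_measure_halfline_zero hnonneg fun K =>
        (hshift.add (hslope.const_mul K)).eventually_lt_const ?_
      simpa using h
  · have hl0 : 0 < l := ENNReal.toReal_pos h0 htop
    rw [if_neg h0, if_neg htop]
    have hratio := hshift.div hslope (by positivity)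
    rw [show (x - z + 2 * l ^ 2) / (2 * l) = l + (x - z) / (2 * l) by field_simp; ring] at hratio
    exact tendsto_measure_halfline_cdf (hslope.eventually_const_lt (by positivity)) hratio

lemma tendsto_condProb_of_tendsto_atTop (hρ : ∀ᶠ n in atTop, |ρ n| ≤ 1)
    (hq : Tendsto (fun n : ℕ => (1 - ρ n) * Real.log n) atTop atTop) (x z : ℝ) :
    Tendsto (fun n : ℕ => (gaussianReal 0 1).real
      {w | √(2 * ((1 - ρ n) * Real.log n) * (1 + ρ n)) * w ≤
        x - z + 2 * ((1 - ρ n) * Real.log n) * (scaleConst n * level n z)}) atTop (𝓝 1) := by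
  refine tendsto_measure_halfline_one (.of_forall fun n => Real.sqrt_nonneg _) fun K => ?_
  have hsqrt : Tendsto (fun n : ℕ => √((1 - ρ n) * Real.log n)) atTop atTop :=
    Real.tendsto_sqrt_atTop.comp hq
  have hbracket : Tendsto (fun n : ℕ => √((1 - ρ n) * Real.log n) *
      (scaleConst n * level n z) + -|K|) atTop atTop :=
    tendsto_atTop_add_const_right _ _
      (hsqrt.atTop_mul_pos one_pos (tendsto_scaleConst_mul_level z))
  filter_upwards [hρ, hq.eventually_ge_atTop 0,
    (hsqrt.atTop_mul_atTop₀ hbracket).eventually_ge_atTop |x - z|] with n hρn hqn hn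
  have hslope : √(2 * ((1 - ρ n) * Real.log n) * (1 + ρ n)) ≤ 2 * √((1 - ρ n) * Real.log n) := by
    refine Real.sqrt_le_iff.2 ⟨by positivity, ?_⟩
    rw [mul_pow, Real.sq_sqrt hqn]
    nlinarith [(abs_le.1 hρn).2]
  have hK : K * √(2 * ((1 - ρ n) * Real.log n) * (1 + ρ n)) ≤
      |K| * (2 * √((1 - ρ n) * Real.log n)) :=
    mul_le_mul (le_abs_self K) hslope (Real.sqrt_nonneg _) (abs_nonneg K)
  have hsq : √((1 - ρ n) * Real.log n) * √((1 - ρ n) * Real.log n) = (1 - ρ n) * Real.log n :=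
    Real.mul_self_sqrt hqn
  linear_combination hK + 2 * hn + neg_abs_le (x - z) + abs_nonneg (x - z) +
    2 * (scaleConst n * level n z) * hsq

lemma tendsto_condProb (hρ : ∀ᶠ n in atTop, |ρ n| ≤ 1)
    (hlam : Tendsto (fun n : ℕ => ENNReal.ofReal ((1 - ρ n) * Real.log n)) atTop (𝓝 (lam ^ 2)))
    {x z : ℝ} (hz : z ≠ x) :
    Tendsto (fun n : ℕ => (gaussianReal 0 1).real
      {w | ρ n * level n z + √(1 - ρ n ^ 2) * w ≤ level n x}) atTop (𝓝 (condLimit lam x z)) := by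
  have hset : ∀ᶠ n : ℕ in atTop, (gaussianReal 0 1).real
      {w | √(2 * ((1 - ρ n) * Real.log n) * (1 + ρ n)) * w ≤
        x - z + 2 * ((1 - ρ n) * Real.log n) * (scaleConst n * level n z)} =
      (gaussianReal 0 1).real {w | ρ n * level n z + √(1 - ρ n ^ 2) * w ≤ level n x} := by
    filter_upwards [eventually_log_pos] with n hn
    simp only [condProb_event_iff hn]
  refine Tendsto.congr' hset ?_
  by_cases htop : lam = ⊤
  · rw [htop, ENNReal.top_pow two_ne_zero, ENNReal.tendsto_ofReal_nhds_top] at hlam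
    rw [show condLimit lam x z = 1 by simp [condLimit, htop]]
    exact tendsto_condProb_of_tendsto_atTop hρ hlam x z
  · exact tendsto_condProb_of_ne_top hρ hlam htop hz

end CondProb

lemma isStdPair_bivGaussian {r : ℝ} (hr : |r| ≤ 1) :
    IsStdPair (bivGaussian r) Prod.fst Prod.snd r := by
  have h := IsStdPair.fst_snd.lin_left ((sq_le_one_iff_abs_le_one r).2 hr)
  have hf : AEMeasurable (fun p : ℝ × ℝ => (r * p.1 + √(1 - r ^ 2) * p.2, p.1))
      ((gaussianReal 0 1).prod (gaussianReal 0 1)) := by fun_prop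
  have hfst := measurable_id (α := ℝ × ℝ) |>.fst
  have hsnd := measurable_id (α := ℝ × ℝ) |>.snd
  refine ⟨?_, (integral_map hf hfst.aestronglyMeasurable).trans h.mean_fst,
    (integral_map hf hsnd.aestronglyMeasurable).trans h.mean_snd,
    (variance_map hfst.aemeasurable hf).trans h.var_fst,
    (variance_map hsnd.aemeasurable hf).trans h.var_snd,
    (covariance_map hfst.aestronglyMeasurable hsnd.aestronglyMeasurable hf).trans h.cov_eq⟩
  have : IsGaussian (bivGaussian r) := h.gaussian.isGaussian_map
  exact IsGaussian.hasGaussianLaw_id (μ := bivGaussian r)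

namespace IsStdPair

variable {Ω : Type*} [MeasurableSpace Ω] {P : Measure Ω} {U V : Ω → ℝ} {r : ℝ}

lemma map_fst (h : IsStdPair P U V r) : P.map U = gaussianReal 0 1 := by
  rw [h.gaussian.fst.map_eq_gaussianReal, h.mean_fst, h.var_fst, Real.toNNReal_one]

lemma measureReal_gt (h : IsStdPair P U V r) (u : ℝ) :
    P.real {ω | u < U ω} = (gaussianReal 0 1).real (Set.Ioi u) := by
  rw [← h.map_fst, map_measureReal_apply_of_aemeasurable h.gaussian.fst.aemeasurable
    measurableSet_Ioi]
  rfl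

lemma ae_ne (h : IsStdPair P U V r) (u : ℝ) : ∀ᵐ ω ∂P, U ω ≠ u := by
  have := nullSingletonClass_gaussianReal (μ := 0) (v := 1) one_ne_zero
  refine ae_of_ae_map h.gaussian.fst.aemeasurable (p := (· ≠ u)) ?_
  rw [h.map_fst]
  exact (Set.countable_singleton u).ae_notMem _

lemma measureReal_or (h : IsStdPair P U V r) (u v : ℝ) :
    P.real {ω | u < U ω ∨ v < V ω} = (bivGaussian r).real {p | u < p.1 ∨ v < p.2} := by
  rw [← h.map_eq_bivGaussian, map_measureReal_apply_of_aemeasurable h.gaussian.aemeasurable]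
  · rfl
  · exact (measurableSet_lt measurable_const measurable_fst).union
      (measurableSet_lt measurable_const measurable_snd)

lemma measureReal_and (h : IsStdPair P U V r) (u v : ℝ) :
    P.real {ω | u < U ω ∧ v < V ω} = (gaussianReal 0 1).real (Set.Ioi u) +
      (gaussianReal 0 1).real (Set.Ioi v) - (bivGaussian r).real {p | u < p.1 ∨ v < p.2} := by
  have := h.gaussian.isProbabilityMeasure
  rw [← h.measureReal_gt, ← h.swap.measureReal_gt, ← h.measureReal_or, eq_sub_iff_add_eq']
  exact measureReal_union_add_inter₀
    (h.gaussian.snd.aemeasurable.nullMeasurableSet_preimage (measurableSet_Ioi (a := v)))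

end IsStdPair

section Exceedance

variable {ρ : ℕ → ℝ} {lam : ℝ≥0∞}

lemma tendsto_mul_bivGaussian_or (hρ : ∀ᶠ n in atTop, |ρ n| ≤ 1)
    (hlam : Tendsto (fun n : ℕ => ENNReal.ofReal ((1 - ρ n) * Real.log n)) atTop (𝓝 (lam ^ 2)))
    (x y : ℝ) :
    Tendsto (fun n : ℕ => n * (bivGaussian (ρ n)).real {p | level n x < p.1 ∨ level n y < p.2})
      atTop (𝓝 (hrExponent lam x y)) := by
  have hm : ∀ n, Measurable fun t : ℝ => (gaussianReal 0 1).real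
      {w | ρ n * t + √(1 - ρ n ^ 2) * w ≤ level n x} := fun n =>
    (measurable_measure_prodMk_left (measurableSet_le
      (f := fun p : ℝ × ℝ => ρ n * p.1 + √(1 - ρ n ^ 2) * p.2) (by fun_prop)
      measurable_const)).ennreal_toReal
  have hsnd := tendsto_mul_tail_integral (y := y) (S := {x})
    (G := fun n t => (gaussianReal 0 1).real {w | ρ n * t + √(1 - ρ n ^ 2) * w ≤ level n x})
    (G₀ := condLimit lam x) (Set.countable_singleton x) hm (fun _ _ => measureReal_nonneg)
    (fun _ _ => measureReal_le_one) (fun z hz => tendsto_condProb hρ hlam hz)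
  rw [integral_condLimit] at hsnd
  have hsum := (tendsto_mul_tail x).add hsnd
  rw [add_sub_cancel] at hsum
  refine hsum.congr' ?_
  filter_upwards [hρ] with n hn
  rw [← measureReal_bivGaussian_eq_integral, ← (isStdPair_bivGaussian hn).measureReal_gt,
    ← mul_add, ← measureReal_union]
  · congr 2
    ext p
    by_cases h : level n x < p.1
    · simp [h]
    · simp [h, not_lt.1 h]
  · exact Set.disjoint_left.2 fun p hp hp' => absurd hp'.1 (not_le.2 hp)
  · exact (measurableSet_le measurable_fst measurable_const).inter
      (measurableSet_lt measurable_const measurable_snd)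

lemma tendsto_mul_bivGaussian_and_neg (hρ : ∀ᶠ n in atTop, |ρ n| ≤ 1)
    (hlam' : Tendsto (fun n : ℕ => (1 + ρ n) * Real.log n) atTop atTop) (x y : ℝ) :
    Tendsto (fun n : ℕ => n * (bivGaussian (ρ n)).real {p | level n x < p.1 ∧ level n y < -p.2})
      atTop (𝓝 0) := by
  have hor := tendsto_mul_bivGaussian_or (ρ := fun n => -ρ n) (lam := ⊤)
    (by simpa only [abs_neg] using hρ)
    (by simpa only [ENNReal.top_pow two_ne_zero, ENNReal.tendsto_ofReal_nhds_top, sub_neg_eq_add]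
      using hlam') x y
  have h := ((tendsto_mul_tail x).add (tendsto_mul_tail y)).sub hor
  rw [show hrExponent ⊤ x y = Real.exp (-x) + Real.exp (-y) by simp [hrExponent], sub_self] at h
  refine h.congr' ?_
  filter_upwards [hρ] with n hn
  rw [(isStdPair_bivGaussian hn).neg_right.measureReal_and]
  ring

lemma bivGaussian_swap_and_neg {r : ℝ} (hr : |r| ≤ 1) (u v : ℝ) :
    (bivGaussian r).real {p | u < p.2 ∧ v < -p.1} =
      (bivGaussian r).real {p | u < p.1 ∧ v < -p.2} := by
  rw [(isStdPair_bivGaussian hr).neg_right.measureReal_and,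
    (isStdPair_bivGaussian hr).swap.neg_right.measureReal_and]

lemma tendsto_mul_bivGaussian_or_inter_or_neg (hρ : ∀ᶠ n in atTop, |ρ n| ≤ 1)
    (hlam' : Tendsto (fun n : ℕ => (1 + ρ n) * Real.log n) atTop atTop) (x₁ x₂ y₁ y₂ : ℝ) :
    Tendsto (fun n : ℕ => n * (bivGaussian (ρ n)).real
      ({p | level n x₁ < p.1 ∨ level n x₂ < p.2} ∩
        {p | level n y₁ < -p.1 ∨ level n y₂ < -p.2})) atTop (𝓝 0) := by
  have hsum := (tendsto_mul_bivGaussian_and_neg hρ hlam' x₁ y₂).add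
    (tendsto_mul_bivGaussian_and_neg hρ hlam' x₂ y₁)
  rw [add_zero] at hsum
  refine squeeze_zero' (.of_forall fun n => by positivity) ?_ hsum
  filter_upwards [hρ, (tendsto_level_atTop x₁).eventually_ge_atTop 0,
    (tendsto_level_atTop x₂).eventually_ge_atTop 0,
    (tendsto_level_atTop y₁).eventually_ge_atTop 0,
    (tendsto_level_atTop y₂).eventually_ge_atTop 0] with n hn hx₁ hx₂ hy₁ hy₂
  have hsub : ({p : ℝ × ℝ | level n x₁ < p.1 ∨ level n x₂ < p.2} ∩
      {p | level n y₁ < -p.1 ∨ level n y₂ < -p.2}) ⊆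
      {p | level n x₁ < p.1 ∧ level n y₂ < -p.2} ∪
      {p | level n x₂ < p.2 ∧ level n y₁ < -p.1} := by
    rintro p ⟨h1 | h1, h2 | h2⟩
    · linarith
    · exact Or.inl ⟨h1, h2⟩
    · exact Or.inr ⟨h1, h2⟩
    · linarith
  rw [← mul_add, ← bivGaussian_swap_and_neg hn (level n x₂)]
  gcongr
  exact (measureReal_mono hsub).trans (measureReal_union_le _ _)

lemma not_mem_Ioc_neg_iff {u v a : ℝ} (ha : a ≠ -v) : a ∉ Set.Ioc (-v) u ↔ u < a ∨ v < -a := by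
  rw [Set.mem_Ioc, not_and_or, not_lt, not_le, or_comm, lt_neg, ha.le_iff_lt]

lemma bivGaussian_compl_box {r : ℝ} (hr : |r| ≤ 1) (u₁ u₂ v₁ v₂ : ℝ) :
    1 - (bivGaussian r).real (Set.Ioc (-v₁) u₁ ×ˢ Set.Ioc (-v₂) u₂) =
      (bivGaussian r).real {p | u₁ < p.1 ∨ u₂ < p.2} +
        (bivGaussian r).real {p | v₁ < p.1 ∨ v₂ < p.2} -
        (bivGaussian r).real ({p | u₁ < p.1 ∨ u₂ < p.2} ∩ {p | v₁ < -p.1 ∨ v₂ < -p.2}) := by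
  have hpair := isStdPair_bivGaussian hr
  have hcompl : (bivGaussian r).real (Set.Ioc (-v₁) u₁ ×ˢ Set.Ioc (-v₂) u₂)ᶜ =
      (bivGaussian r).real ({p | u₁ < p.1 ∨ u₂ < p.2} ∪ {p | v₁ < -p.1 ∨ v₂ < -p.2}) := by
    refine measureReal_congr ?_
    filter_upwards [hpair.ae_ne (-v₁), hpair.swap.ae_ne (-v₂)] with p h1 h2
    refine propext ?_
    change p ∉ Set.Ioc (-v₁) u₁ ×ˢ Set.Ioc (-v₂) u₂ ↔
      (u₁ < p.1 ∨ u₂ < p.2) ∨ (v₁ < -p.1 ∨ v₂ < -p.2)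
    rw [Set.mem_prod, not_and_or, not_mem_Ioc_neg_iff h1, not_mem_Ioc_neg_iff h2, or_or_or_comm]
  rw [← probReal_compl_eq_one_sub (measurableSet_Ioc.prod measurableSet_Ioc), hcompl,
    ← hpair.neg_neg.measureReal_or v₁ v₂, eq_sub_iff_add_eq]
  exact measureReal_union_add_inter ((measurableSet_lt measurable_const measurable_fst.neg).union
    (measurableSet_lt measurable_const measurable_snd.neg))

lemma tendsto_mul_bivGaussian_box (hρ : ∀ᶠ n in atTop, |ρ n| ≤ 1)
    (hlam : Tendsto (fun n : ℕ => ENNReal.ofReal ((1 - ρ n) * Real.log n)) atTop (𝓝 (lam ^ 2)))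
    (hlam' : Tendsto (fun n : ℕ => (1 + ρ n) * Real.log n) atTop atTop) (x₁ x₂ y₁ y₂ : ℝ) :
    Tendsto (fun n : ℕ => n * (1 - (bivGaussian (ρ n)).real
        (Set.Ioc (-level n y₁) (level n x₁) ×ˢ Set.Ioc (-level n y₂) (level n x₂))))
      atTop (𝓝 (hrExponent lam x₁ x₂ + hrExponent lam y₁ y₂)) := by
  have h := ((tendsto_mul_bivGaussian_or hρ hlam x₁ x₂).add
    (tendsto_mul_bivGaussian_or hρ hlam y₁ y₂)).sub
    (tendsto_mul_bivGaussian_or_inter_or_neg hρ hlam' x₁ x₂ y₁ y₂)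
  rw [sub_zero] at h
  refine h.congr' ?_
  filter_upwards [hρ] with n hn
  rw [bivGaussian_compl_box hn, mul_sub, mul_add]

lemma tendsto_pow_exp_of_tendsto_mul_one_sub {p : ℕ → ℝ} {t : ℝ}
    (h : Tendsto (fun n : ℕ => n * (1 - p n)) atTop (𝓝 t)) :
    Tendsto (fun n => p n ^ n) atTop (𝓝 (Real.exp (-t))) := by
  refine (Real.tendsto_one_add_pow_exp_of_tendsto (g := fun n => p n - 1)
    (h.neg.congr fun n => by ring)).congr fun n => ?_
  rw [add_sub_cancel]

lemma tendsto_bivGaussian_quadrant_pow (hρ : ∀ᶠ n in atTop, |ρ n| ≤ 1)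
    (hlam : Tendsto (fun n : ℕ => ENNReal.ofReal ((1 - ρ n) * Real.log n)) atTop (𝓝 (lam ^ 2)))
    (x y : ℝ) :
    Tendsto (fun n : ℕ => (bivGaussian (ρ n)).real
      (Set.Iic (level n x) ×ˢ Set.Iic (level n y)) ^ n) atTop (𝓝 (hrCDF lam x y)) := by
  rw [hrCDF_eq_exp]
  refine tendsto_pow_exp_of_tendsto_mul_one_sub
    ((tendsto_mul_bivGaussian_or hρ hlam x y).congr fun n => ?_)
  have hcompl : (Set.Iic (level n x) ×ˢ Set.Iic (level n y))ᶜ =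
      {p : ℝ × ℝ | level n x < p.1 ∨ level n y < p.2} := by
    ext p
    simp only [Set.mem_compl_iff, Set.mem_prod, Set.mem_Iic, not_and_or, not_le, Set.mem_ofPred_eq]
  rw [← hcompl, probReal_compl_eq_one_sub (measurableSet_Iic.prod measurableSet_Iic)]

lemma tendsto_bivGaussian_box_pow (hρ : ∀ᶠ n in atTop, |ρ n| ≤ 1)
    (hlam : Tendsto (fun n : ℕ => ENNReal.ofReal ((1 - ρ n) * Real.log n)) atTop (𝓝 (lam ^ 2)))
    (hlam' : Tendsto (fun n : ℕ => (1 + ρ n) * Real.log n) atTop atTop) (x₁ x₂ y₁ y₂ : ℝ) :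
    Tendsto (fun n : ℕ => (bivGaussian (ρ n)).real
        (Set.Ioc (-level n y₁) (level n x₁) ×ˢ Set.Ioc (-level n y₂) (level n x₂)) ^ n)
      atTop (𝓝 (hrCDF lam x₁ x₂ * hrCDF lam y₁ y₂)) := by
  rw [hrCDF_eq_exp, hrCDF_eq_exp, ← Real.exp_add, ← neg_add]
  exact tendsto_pow_exp_of_tendsto_mul_one_sub (tendsto_mul_bivGaussian_box hρ hlam hlam' _ _ _ _)

end Exceedance

/-! ### Comparison sums -/

lemma card_filter_gap_lt_le {n : ℕ} (k J : ℕ) :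
    (Finset.univ.filter fun l : Fin n => gap k l < J).card ≤ 2 * J := by
  have hsubset : ((Finset.univ.filter fun l : Fin n => gap k l < J).map Fin.valEmbedding) ⊆
      Finset.Ico (k + 1 - J) (k + J) := by
    intro l hl
    obtain ⟨l, hmem, rfl⟩ := Finset.mem_map.1 hl
    have hgap : gap k l < J := (Finset.mem_filter.1 hmem).2
    rw [gap] at hgap
    rw [Fin.valEmbedding_apply, Finset.mem_Ico]
    omega
  have hcard := Finset.card_le_card hsubset
  rw [Finset.card_map, Nat.card_Ico] at hcard
  lia

lemma comparisonTerm_le_exp {r R : ℝ} (hr : |r| ≤ R) (hR : R ≤ 1) (u v : ℝ) :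
    comparisonTerm r u v ≤ Real.exp (-((u ^ 2 + v ^ 2) / (2 * (1 + R)))) := by
  have hexp : Real.exp (-((u ^ 2 + v ^ 2) / (2 * (1 + |r|)))) ≤
      Real.exp (-((u ^ 2 + v ^ 2) / (2 * (1 + R)))) := by gcongr
  calc comparisonTerm r u v ≤ 1 * Real.exp (-((u ^ 2 + v ^ 2) / (2 * (1 + R)))) :=
        mul_le_mul (hr.trans hR) hexp (Real.exp_pos _).le zero_le_one
    _ = _ := one_mul _

lemma comparisonTerm_le_mul_exp {r q : ℝ} (hr : |r| ≤ q) (u v : ℝ) :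
    comparisonTerm r u v ≤
      q * (Real.exp (q * (u ^ 2 + v ^ 2) / 2) * Real.exp (-((u ^ 2 + v ^ 2) / 2))) := by
  have hr0 := abs_nonneg r
  refine mul_le_mul hr ?_ (Real.exp_pos _).le (hr0.trans hr)
  rw [← Real.exp_add, Real.exp_le_exp]
  set A := u ^ 2 + v ^ 2
  have hA : 0 ≤ A := by positivity
  have htangent : A / 2 - |r| * A / 2 ≤ A / (2 * (1 + |r|)) := by
    rw [le_div_iff₀ (by positivity)]
    nlinarith [mul_nonneg hA (sq_nonneg |r|)]
  nlinarith [mul_le_mul_of_nonneg_right hr hA]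

lemma sum_comparisonTerm_le {m n J : ℕ} {R q : ℝ} (u v : ℝ) (hR : R ≤ 1) (hq : 0 ≤ q)
    {r : Fin m × Fin 2 → Fin n × Fin 2 → ℝ} (hr : ∀ s t, |r s t| ≤ R)
    (hrq : ∀ s t, J ≤ gap s.1 t.1 → |r s t| ≤ q) :
    ∑ s, ∑ t, comparisonTerm (r s t) u v ≤
      8 * (m * J * Real.exp (-((u ^ 2 + v ^ 2) / (2 * (1 + R))))) +
        4 * (m * n *
          (q * (Real.exp (q * (u ^ 2 + v ^ 2) / 2) * Real.exp (-((u ^ 2 + v ^ 2) / 2))))) := by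
  set a := Real.exp (-((u ^ 2 + v ^ 2) / (2 * (1 + R))))
  set b := q * (Real.exp (q * (u ^ 2 + v ^ 2) / 2) * Real.exp (-((u ^ 2 + v ^ 2) / 2)))
  have ha : 0 ≤ a := (Real.exp_pos _).le
  have hb : 0 ≤ b := by positivity
  have hterm : ∀ s t, comparisonTerm (r s t) u v ≤ (if gap s.1 t.1 < J then a else 0) + b := by
    intro s t
    split_ifs with hgap
    · exact (comparisonTerm_le_exp (hr s t) hR u v).trans (le_add_of_nonneg_right hb)
    · rw [zero_add]
      exact comparisonTerm_le_mul_exp (hrq s t (not_lt.1 hgap)) u v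
  have hnear : ∀ k : ℕ, ∑ t : Fin n × Fin 2, (if gap k t.1 < J then a else 0) ≤ 4 * J * a := by
    intro k
    have hcard : ((Finset.univ.filter fun l : Fin n => gap k l < J).card : ℝ) ≤ 2 * J :=
      mod_cast card_filter_gap_lt_le k J
    rw [Fintype.sum_prod_type_right, Fin.sum_univ_two, ← Finset.sum_filter, Finset.sum_const,
      nsmul_eq_mul]
    linarith [mul_le_mul_of_nonneg_right hcard ha]
  calc ∑ s, ∑ t, comparisonTerm (r s t) u v
      ≤ ∑ _s : Fin m × Fin 2, (4 * J * a + 2 * n * b) := by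
        refine Finset.sum_le_sum fun s _ => (Finset.sum_le_sum fun t _ => hterm s t).trans ?_
        rw [Finset.sum_add_distrib]
        refine add_le_add (hnear s.1) (le_of_eq ?_)
        simp only [Finset.sum_const, Finset.card_univ, Fintype.card_prod, Fintype.card_fin,
          nsmul_eq_mul]
        push_cast
        ring
    _ = 8 * (m * J * a) + 4 * (m * n * b) := by
        simp only [Finset.sum_const, Finset.card_univ, Fintype.card_prod, Fintype.card_fin,
          nsmul_eq_mul]
        push_cast
        ring

lemma eventually_sqrt_log_le_rpow {κ : ℝ} (hκ : 0 < κ) :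
    ∀ᶠ n : ℕ in atTop, √(Real.log n) ≤ (n : ℝ) ^ κ := by
  have hlog := tendsto_natCast_atTop_atTop.eventually
    ((isLittleO_log_rpow_atTop hκ).bound one_pos)
  filter_upwards [hlog, tendsto_log_natCast.eventually_ge_atTop 1] with n hn hone
  rw [one_mul, Real.norm_of_nonneg (zero_le_one.trans hone),
    Real.norm_of_nonneg (Real.rpow_nonneg n.cast_nonneg _)] at hn
  refine le_trans ?_ hn
  rw [Real.sqrt_le_left (zero_le_one.trans hone)]
  exact le_self_pow₀ hone two_ne_zero

lemma exists_exp_neg_level_sq_le_rpow (z : ℝ) {κ : ℝ} (hκ : 0 < κ) : ∃ K > 0, ∀ᶠ n : ℕ in atTop,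
    Real.exp (-(level n z ^ 2 / 2)) ≤ K * (n : ℝ) ^ (κ - 1) := by
  obtain ⟨K, hK, hexp⟩ := exists_exp_neg_level_sq_le z
  refine ⟨K, hK, ?_⟩
  filter_upwards [hexp, eventually_sqrt_log_le_rpow hκ, eventually_ne_atTop 0] with n hexp hsqrt hn
  refine hexp.trans ?_
  rw [Real.rpow_sub_one (Nat.cast_ne_zero.2 hn), ← mul_div_assoc]
  gcongr

lemma exists_exp_neg_level_sq_div_le_rpow (z : ℝ) {c κ : ℝ} (hc : 0 < c) (hκ : 0 < κ) :
    ∃ K > 0, ∀ᶠ n : ℕ in atTop,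
      Real.exp (-(level n z ^ 2 / (2 * c))) ≤ K * (n : ℝ) ^ (κ - c⁻¹) := by
  obtain ⟨K, hK, hexp⟩ := exists_exp_neg_level_sq_le_rpow z (mul_pos hκ hc)
  refine ⟨K ^ c⁻¹, by positivity, hexp.mono fun n hn => ?_⟩
  calc Real.exp (-(level n z ^ 2 / (2 * c))) = Real.exp (-(level n z ^ 2 / 2)) ^ c⁻¹ := by
        rw [← Real.exp_mul]
        congr 1
        field_simp
    _ ≤ (K * (n : ℝ) ^ (κ * c - 1)) ^ c⁻¹ := by gcongr
    _ = K ^ c⁻¹ * (n : ℝ) ^ (κ - c⁻¹) := by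
        rw [Real.mul_rpow hK.le (by positivity), ← Real.rpow_mul n.cast_nonneg]
        congr 2
        field_simp

lemma exists_near_bound (z : ℝ) {θ β : ℝ} (hθ : 0 ≤ θ) (hβ : β < (1 - θ) / (1 + θ)) :
    ∃ η > (0 : ℝ), ∃ K > (0 : ℝ), ∃ N : ℕ, ∀ m n : ℕ, N ≤ m → m ≤ n →
      m * (n : ℝ) ^ β * Real.exp (-((level m z ^ 2 + level n z ^ 2) / (2 * (1 + θ)))) ≤
        K * (n : ℝ) ^ (-η) := by
  set p := (1 + θ)⁻¹
  have hp : p ≤ 1 := inv_le_one_of_one_le₀ (by linarith)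
  have hgap : 2 * p - 1 = (1 - θ) / (1 + θ) := by
    simp only [p]
    field_simp
    ring
  set η := (2 * p - 1 - β) / 2 with hη
  have hη0 : 0 < η := by rw [hη]; linarith
  obtain ⟨K, hK, hexp⟩ :=
    exists_exp_neg_level_sq_div_le_rpow z (by linarith : 0 < 1 + θ) (half_pos hη0)
  obtain ⟨N, hN⟩ := eventually_atTop.1 (hexp.and (eventually_gt_atTop 0))
  refine ⟨η, hη0, K * K, by positivity, N, fun m n hm hmn => ?_⟩
  obtain ⟨hexpm, hm0⟩ := hN m hm
  obtain ⟨hexpn, hn0⟩ := hN n (hm.trans hmn)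
  have hm0' : (0 : ℝ) < m := Nat.cast_pos.2 hm0
  have hn0' : (0 : ℝ) < n := Nat.cast_pos.2 hn0
  have hmono : (m : ℝ) ^ (1 + (η / 2 - p)) ≤ (n : ℝ) ^ (1 + (η / 2 - p)) := by
    have : 0 ≤ 1 + (η / 2 - p) := by linarith
    gcongr
  have hsplit : -((level m z ^ 2 + level n z ^ 2) / (2 * (1 + θ))) =
      -(level m z ^ 2 / (2 * (1 + θ))) + -(level n z ^ 2 / (2 * (1 + θ))) := by ring
  calc m * (n : ℝ) ^ β * Real.exp (-((level m z ^ 2 + level n z ^ 2) / (2 * (1 + θ))))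
      ≤ m * (n : ℝ) ^ β * ((K * (m : ℝ) ^ (η / 2 - p)) * (K * (n : ℝ) ^ (η / 2 - p))) := by
        rw [hsplit, Real.exp_add]
        gcongr
    _ = K * K * ((m : ℝ) ^ (1 + (η / 2 - p)) * ((n : ℝ) ^ β * (n : ℝ) ^ (η / 2 - p))) := by
        rw [Real.rpow_add hm0', Real.rpow_one]
        ring
    _ ≤ K * K * ((n : ℝ) ^ (1 + (η / 2 - p)) * ((n : ℝ) ^ β * (n : ℝ) ^ (η / 2 - p))) := by gcongr
    _ = K * K * (n : ℝ) ^ (-η) := by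
        rw [← Real.rpow_add hn0', ← Real.rpow_add hn0']
        congr 2
        rw [hη]
        ring

lemma exists_far_bound (z : ℝ) : ∃ K > (0 : ℝ), ∃ N : ℕ, ∀ m n : ℕ, N ≤ m → m ≤ n →
    ∀ q : ℝ, 0 ≤ q → q * Real.log n ≤ 1 →
      m * n * (q * (Real.exp (q * (level m z ^ 2 + level n z ^ 2) / 2) *
        Real.exp (-((level m z ^ 2 + level n z ^ 2) / 2)))) ≤ K * (q * Real.log n) := by
  obtain ⟨K, hK, hexp⟩ := exists_exp_neg_level_sq_le z
  obtain ⟨N, hN⟩ := eventually_atTop.1 (((hexp.and (eventually_gt_atTop 0)).and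
    eventually_log_pos).and (eventually_level_sq_le z))
  refine ⟨Real.exp 3 * (K * K), by positivity, N, fun m n hm hmn q hq hq1 => ?_⟩
  obtain ⟨⟨⟨hexpm, hm0⟩, -⟩, hsqm⟩ := hN m hm
  obtain ⟨⟨⟨hexpn, hn0⟩, hlogn⟩, hsqn⟩ := hN n (hm.trans hmn)
  rw [le_div_iff₀ (Nat.cast_pos.2 hm0)] at hexpm
  rw [le_div_iff₀ (Nat.cast_pos.2 hn0)] at hexpn
  have hlog : Real.log m ≤ Real.log n :=
    Real.log_le_log (Nat.cast_pos.2 hm0) (Nat.cast_le.2 hmn)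
  have hexp3 : Real.exp (q * (level m z ^ 2 + level n z ^ 2) / 2) ≤ Real.exp 3 := by
    have hsq : level m z ^ 2 + level n z ^ 2 ≤ 6 * Real.log n := by linarith
    exact Real.exp_le_exp.2 (by nlinarith [mul_le_mul_of_nonneg_left hsq hq])
  have hsplit : -((level m z ^ 2 + level n z ^ 2) / 2) =
      -(level m z ^ 2 / 2) + -(level n z ^ 2 / 2) := by ring
  calc m * n * (q * (Real.exp (q * (level m z ^ 2 + level n z ^ 2) / 2) *
        Real.exp (-((level m z ^ 2 + level n z ^ 2) / 2))))
      = q * Real.exp (q * (level m z ^ 2 + level n z ^ 2) / 2) *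
        ((Real.exp (-(level m z ^ 2 / 2)) * m) * (Real.exp (-(level n z ^ 2 / 2)) * n)) := by
        rw [hsplit, Real.exp_add]
        ring
    _ ≤ q * Real.exp 3 * ((K * √(Real.log m)) * (K * √(Real.log n))) := by gcongr
    _ ≤ q * Real.exp 3 * ((K * √(Real.log n)) * (K * √(Real.log n))) := by gcongr
    _ = Real.exp 3 * (K * K) * (q * Real.log n) := by
        linear_combination q * Real.exp 3 * (K * K) * Real.mul_self_sqrt hlogn.le

lemma exists_sum_comparisonTerm_le (z : ℝ) {θ β : ℝ} (hθ0 : 0 ≤ θ) (hθ1 : θ < 1)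
    (hβ : β < (1 - θ) / (1 + θ)) :
    ∃ η > (0 : ℝ), ∃ K > (0 : ℝ), ∃ N : ℕ, ∀ m n : ℕ, N ≤ m → m ≤ n →
      ∀ (r : Fin m × Fin 2 → Fin n × Fin 2 → ℝ) (q : ℝ), 0 ≤ q → q * Real.log n ≤ 1 →
      (∀ s t, |r s t| ≤ θ) → (∀ s t, powFloor β n ≤ gap s.1 t.1 → |r s t| ≤ q) →
      ∑ s, ∑ t, comparisonTerm (r s t) (level m z) (level n z) ≤
        K * ((n : ℝ) ^ (-η) + q * Real.log n) := by
  obtain ⟨η, hη, K₁, hK₁, N₁, hnear⟩ := exists_near_bound z hθ0 hβ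
  obtain ⟨K₂, hK₂, N₂, hfar⟩ := exists_far_bound z
  refine ⟨η, hη, 8 * K₁ + 4 * K₂, by positivity, max N₁ N₂, fun m n hm hmn r q hq hq1 hr hrq => ?_⟩
  have hJ : (powFloor β n : ℝ) ≤ (n : ℝ) ^ β := Nat.floor_le (by positivity)
  have hnear' : m * (powFloor β n : ℝ) *
      Real.exp (-((level m z ^ 2 + level n z ^ 2) / (2 * (1 + θ)))) ≤ K₁ * (n : ℝ) ^ (-η) :=
    le_trans (by gcongr) (hnear m n (le_of_max_le_left hm) hmn)
  have hfar' := hfar m n (le_of_max_le_right hm) hmn q hq hq1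
  have hpow : 0 ≤ (n : ℝ) ^ (-η) := by positivity
  have hqlog : 0 ≤ q * Real.log n := mul_nonneg hq (Real.log_natCast_nonneg n)
  refine (sum_comparisonTerm_le _ _ hθ1.le hq hr hrq).trans ?_
  nlinarith [mul_nonneg hK₁.le hqlog, mul_nonneg hK₂.le hpow]

/-! ### Logarithmic averages -/

/-- The logarithmically weighted sum `∑_{k = 1}^n f k / k`. -/
def logSum (f : ℕ → ℝ) (n : ℕ) : ℝ := ∑ k ∈ Finset.Icc 1 n, 1 / (k : ℝ) * f k

lemma sum_Icc_one_div (n : ℕ) : ∑ k ∈ Finset.Icc 1 n, 1 / (k : ℝ) = harmonic n := by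
  simp [harmonic_eq_sum_Icc]

lemma zero_le_harmonic_cast (n : ℕ) : (0 : ℝ) ≤ harmonic n := by
  rw [← sum_Icc_one_div]
  positivity

lemma logSum_const (c : ℝ) (n : ℕ) : logSum (fun _ => c) n = harmonic n * c := by
  rw [logSum, ← Finset.sum_mul, sum_Icc_one_div]

lemma logSum_sub (f g : ℕ → ℝ) (n : ℕ) :
    logSum (fun k => f k - g k) n = logSum f n - logSum g n := by
  simp only [logSum, mul_sub, Finset.sum_sub_distrib]

lemma logSum_nonneg {f : ℕ → ℝ} (hf : ∀ k, 0 ≤ f k) (n : ℕ) : 0 ≤ logSum f n :=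
  Finset.sum_nonneg fun k _ => mul_nonneg (by positivity) (hf k)

lemma monotone_logSum {f : ℕ → ℝ} (hf : ∀ k, 0 ≤ f k) : Monotone (logSum f) := fun _ _ hmn =>
  Finset.sum_le_sum_of_subset_of_nonneg (Finset.Icc_subset_Icc_right hmn)
    fun k _ _ => mul_nonneg (by positivity) (hf k)

lemma abs_logSum_le {f : ℕ → ℝ} (hf : ∀ k, |f k| ≤ 1) (n : ℕ) : |logSum f n| ≤ harmonic n := by
  rw [← sum_Icc_one_div]
  refine (Finset.abs_sum_le_sum_abs _ _).trans (Finset.sum_le_sum fun k _ => ?_)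
  rw [abs_mul, abs_of_nonneg (by positivity : 0 ≤ 1 / (k : ℝ))]
  exact mul_le_of_le_one_right (by positivity) (hf k)

lemma logSum_eq_sum_range (f : ℕ → ℝ) (n : ℕ) :
    logSum f n = ∑ k ∈ Finset.range (n + 1), 1 / (k : ℝ) * f k := by
  rw [logSum, Finset.sum_range_succ', Nat.cast_zero, div_zero, zero_mul, add_zero,
    Finset.range_eq_Ico, Finset.sum_Ico_add' (fun k : ℕ => 1 / (k : ℝ) * f k) 0 n 1]
  rfl

lemma tendsto_harmonic_div_log :
    Tendsto (fun n : ℕ => (harmonic n : ℝ) / Real.log n) atTop (𝓝 1) := by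
  have hdiff : Tendsto (fun n : ℕ => ((harmonic n : ℝ) - Real.log n) / Real.log n) atTop (𝓝 0) :=
    Real.tendsto_harmonic_sub_log.div_atTop tendsto_log_natCast
  refine (zero_add (1 : ℝ) ▸ hdiff.add_const 1).congr' ?_
  filter_upwards [eventually_log_pos] with n hn
  field_simp
  ring

lemma isLittleO_logSum {f : ℕ → ℝ} (hf : Tendsto f atTop (𝓝 0)) :
    logSum f =o[atTop] fun n => (harmonic n : ℝ) := by
  have hterm : (fun k : ℕ => 1 / (k : ℝ) * f k) =o[atTop] fun k : ℕ => 1 / (k : ℝ) * 1 :=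
    (Asymptotics.isBigO_refl _ _).mul_isLittleO ((Asymptotics.isLittleO_one_iff ℝ).2 hf)
  have hdiv : Tendsto (fun n => ∑ k ∈ Finset.range n, 1 / (k : ℝ) * 1) atTop atTop := by
    refine (tendsto_add_atTop_iff_nat 1).1 (tendsto_atTop_mono (fun n => ?_)
      (tendsto_log_natCast.comp (tendsto_add_atTop_nat 1)))
    rw [← logSum_eq_sum_range, logSum_const, mul_one]
    exact log_add_one_le_harmonic n
  refine ((hterm.sum_range (fun k => by positivity) hdiv).comp_tendsto
    (tendsto_add_atTop_nat 1)).congr (fun n => ?_) fun n => ?_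
  · rw [logSum_eq_sum_range, Function.comp]
  · rw [Function.comp, ← logSum_eq_sum_range, logSum_const, mul_one]

theorem tendsto_logSum_div_log {f : ℕ → ℝ} {p : ℝ} (hf : Tendsto f atTop (𝓝 p)) :
    Tendsto (fun n : ℕ => logSum f n / Real.log n) atTop (𝓝 p) := by
  have hcentered := (isLittleO_logSum (sub_self p ▸ hf.sub_const p)).tendsto_div_nhds_zero
  have hlim := (hcentered.add_const p).mul tendsto_harmonic_div_log
  rw [zero_add, mul_one] at hlim
  refine hlim.congr' ?_
  filter_upwards [eventually_gt_atTop 0] with n hn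
  have hharmonic : (harmonic n : ℝ) ≠ 0 := by exact_mod_cast (harmonic_pos hn.ne').ne'
  rw [logSum_sub, logSum_const]
  field_simp
  ring

/-- The scale `exp (j ^ δ)` of `ln n` along the sparse subsequence. -/
def sparseLog (δ : ℝ) (j : ℕ) : ℝ := Real.exp ((j : ℝ) ^ δ)

/-- The sparse subsequence `⌊exp (exp (j ^ δ))⌋` along which logarithmic averages are controlled:
for `δ < 1` consecutive logarithms are asymptotically equivalent. -/
def sparseIndex (δ : ℝ) (j : ℕ) : ℕ := ⌊Real.exp (sparseLog δ j)⌋₊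

/-- The generalized inverse `⌊(ln ln n) ^ (1 / δ)⌋` of the sparse subsequence. -/
def sparseRank (δ : ℝ) (n : ℕ) : ℕ := ⌊Real.log (Real.log n) ^ δ⁻¹⌋₊

lemma sparseLog_pos (δ : ℝ) (j : ℕ) : 0 < sparseLog δ j := Real.exp_pos _

lemma one_le_sparseLog (δ : ℝ) (j : ℕ) : 1 ≤ sparseLog δ j := Real.one_le_exp (by positivity)

lemma tendsto_sparseLog {δ : ℝ} (hδ : 0 < δ) : Tendsto (sparseLog δ) atTop atTop :=
  Real.tendsto_exp_atTop.comp ((tendsto_rpow_atTop hδ).comp tendsto_natCast_atTop_atTop)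

lemma sparseIndex_pos (δ : ℝ) (j : ℕ) : 0 < sparseIndex δ j :=
  Nat.floor_pos.2 (Real.one_le_exp (sparseLog_pos δ j).le)

lemma tendsto_sparseIndex {δ : ℝ} (hδ : 0 < δ) : Tendsto (sparseIndex δ) atTop atTop :=
  tendsto_nat_floor_atTop.comp (Real.tendsto_exp_atTop.comp (tendsto_sparseLog hδ))

lemma log_sparseIndex_le (δ : ℝ) (j : ℕ) : Real.log (sparseIndex δ j) ≤ sparseLog δ j := by
  rw [Real.log_le_iff_le_exp (Nat.cast_pos.2 (sparseIndex_pos δ j))]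
  exact Nat.floor_le (Real.exp_pos _).le

lemma sub_log_two_le_log_sparseIndex (δ : ℝ) (j : ℕ) :
    sparseLog δ j - Real.log 2 ≤ Real.log (sparseIndex δ j) := by
  have hone : (1 : ℝ) ≤ sparseIndex δ j := Nat.one_le_cast.2 (sparseIndex_pos δ j)
  have hfloor : Real.exp (sparseLog δ j) < sparseIndex δ j + 1 := Nat.lt_floor_add_one _
  rw [Real.le_log_iff_exp_le (by linarith), Real.exp_sub, Real.exp_log (by norm_num)]
  linarith

lemma tendsto_log_sparseIndex_div {δ : ℝ} (hδ : 0 < δ) :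
    Tendsto (fun j => Real.log (sparseIndex δ j) / sparseLog δ j) atTop (𝓝 1) := by
  have hlower : Tendsto (fun j => 1 - Real.log 2 / sparseLog δ j) atTop (𝓝 (1 - 0)) :=
    (tendsto_const_nhds.div_atTop (tendsto_sparseLog hδ)).const_sub 1
  rw [sub_zero] at hlower
  refine tendsto_of_tendsto_of_tendsto_of_le_of_le hlower tendsto_const_nhds
    (fun j => ?_) fun j => (div_le_one (sparseLog_pos δ j)).2 (log_sparseIndex_le δ j)
  rw [one_sub_div (sparseLog_pos δ j).ne', div_le_div_iff_of_pos_right (sparseLog_pos δ j)]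
  exact sub_log_two_le_log_sparseIndex δ j

lemma tendsto_rpow_succ_sub {δ : ℝ} (hδ0 : 0 < δ) (hδ1 : δ < 1) :
    Tendsto (fun j : ℕ => ((j + 1 : ℕ) : ℝ) ^ δ - (j : ℝ) ^ δ) atTop (𝓝 0) := by
  have hupper : Tendsto (fun j : ℕ => δ * (j : ℝ) ^ (-(1 - δ))) atTop (𝓝 0) := by
    simpa using ((tendsto_rpow_neg_atTop (sub_pos.2 hδ1)).comp
      tendsto_natCast_atTop_atTop).const_mul δ
  refine tendsto_of_tendsto_of_tendsto_of_le_of_le' tendsto_const_nhds hupper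
    (.of_forall fun j => ?_) ?_
  · rw [sub_nonneg]
    gcongr
    exact j.le_succ
  · filter_upwards [eventually_gt_atTop 0] with j hj
    have hj' : (0 : ℝ) < j := Nat.cast_pos.2 hj
    have hsucc : ((j + 1 : ℕ) : ℝ) = j * (1 + 1 / j) := by
      push_cast
      field_simp
    have hinv : 0 < 1 / (j : ℝ) := by positivity
    have hbernoulli : (1 + 1 / (j : ℝ)) ^ δ ≤ 1 + δ * (1 / j) :=
      rpow_one_add_le_one_add_mul_self (by linarith) hδ0.le hδ1.le
    have hpow : (j : ℝ) ^ (-(1 - δ)) = (j : ℝ) ^ δ * (1 / j) := by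
      rw [neg_sub, Real.rpow_sub_one hj'.ne', mul_one_div]
    rw [hsucc, Real.mul_rpow hj'.le (by positivity), hpow]
    linarith [mul_le_mul_of_nonneg_left hbernoulli (Real.rpow_nonneg hj'.le δ)]

lemma tendsto_sparseLog_succ_div {δ : ℝ} (hδ0 : 0 < δ) (hδ1 : δ < 1) :
    Tendsto (fun j => sparseLog δ (j + 1) / sparseLog δ j) atTop (𝓝 1) := by
  have hexp := (Real.continuous_exp.tendsto 0).comp (tendsto_rpow_succ_sub hδ0 hδ1)
  rw [Real.exp_zero] at hexp
  exact hexp.congr fun j => Real.exp_sub _ _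

lemma tendsto_log_log_natCast : Tendsto (fun n : ℕ => Real.log (Real.log n)) atTop atTop :=
  Real.tendsto_log_atTop.comp tendsto_log_natCast

lemma tendsto_sparseRank {δ : ℝ} (hδ : 0 < δ) : Tendsto (sparseRank δ) atTop atTop :=
  tendsto_nat_floor_atTop.comp
    ((tendsto_rpow_atTop (inv_pos.2 hδ)).comp tendsto_log_log_natCast)

lemma sparseLog_sparseRank_le {δ : ℝ} (hδ : 0 < δ) {n : ℕ} (hn : 1 ≤ Real.log n) :
    sparseLog δ (sparseRank δ n) ≤ Real.log n := by
  have hloglog := Real.log_nonneg hn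
  rw [sparseLog, ← Real.le_log_iff_exp_le (zero_lt_one.trans_le hn),
    ← Real.le_rpow_inv_iff_of_pos (Nat.cast_nonneg _) hloglog hδ]
  exact Nat.floor_le (Real.rpow_nonneg hloglog _)

lemma log_le_sparseLog_sparseRank_succ {δ : ℝ} (hδ : 0 < δ) {n : ℕ} (hn : 1 ≤ Real.log n) :
    Real.log n ≤ sparseLog δ (sparseRank δ n + 1) := by
  rw [sparseLog, ← Real.log_le_iff_le_exp (zero_lt_one.trans_le hn),
    ← Real.rpow_inv_le_iff_of_pos (Real.log_nonneg hn) (Nat.cast_nonneg _) hδ]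
  exact_mod_cast (Nat.lt_floor_add_one _).le

theorem tendsto_div_log_of_sparse {δ : ℝ} (hδ0 : 0 < δ) (hδ1 : δ < 1) {T : ℕ → ℝ}
    (hT : Monotone T) (hT0 : ∀ n, 0 ≤ T n) {p : ℝ}
    (h : Tendsto (fun j => T (sparseIndex δ j) / sparseLog δ j) atTop (𝓝 p)) :
    Tendsto (fun n : ℕ => T n / Real.log n) atTop (𝓝 p) := by
  have hratio := tendsto_sparseLog_succ_div hδ0 hδ1
  have hne : ∀ j, sparseLog δ j ≠ 0 := fun j => (sparseLog_pos δ j).ne'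
  have hlower : Tendsto (fun j => T (sparseIndex δ j) / sparseLog δ (j + 1)) atTop (𝓝 p) :=
    (div_one p ▸ h.div hratio one_ne_zero).congr fun j =>
      div_div_div_cancel_right₀ (hne j) _ _
  have hupper : Tendsto (fun j => T (sparseIndex δ (j + 1)) / sparseLog δ j) atTop (𝓝 p) :=
    (mul_one p ▸ ((tendsto_add_atTop_iff_nat 1).2 h).mul hratio).congr fun j =>
      div_mul_div_cancel₀ (hne (j + 1))
  have hlog := tendsto_log_natCast.eventually_ge_atTop 1
  refine tendsto_of_tendsto_of_tendsto_of_le_of_le' (hlower.comp (tendsto_sparseRank hδ0))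
    (hupper.comp (tendsto_sparseRank hδ0)) ?_ ?_
  · filter_upwards [hlog, eventually_gt_atTop 0] with n hlog hn
    have hrank := sparseLog_sparseRank_le hδ0 hlog
    have hindex : sparseIndex δ (sparseRank δ n) ≤ n :=
      Nat.floor_le_of_le ((Real.le_log_iff_exp_le (Nat.cast_pos.2 hn)).1 hrank)
    exact div_le_div₀ (hT0 _) (hT hindex) (zero_lt_one.trans_le hlog)
      (log_le_sparseLog_sparseRank_succ hδ0 hlog)
  · filter_upwards [hlog, eventually_gt_atTop 0] with n hlog hn
    have hrank := log_le_sparseLog_sparseRank_succ hδ0 hlog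
    have hindex : n ≤ sparseIndex δ (sparseRank δ n + 1) :=
      Nat.le_floor ((Real.log_le_iff_le_exp (Nat.cast_pos.2 hn)).1 hrank)
    exact div_le_div₀ (hT0 _) (hT hindex) (sparseLog_pos _ _) (sparseLog_sparseRank_le hδ0 hlog)

lemma tendsto_logSum_div_log_of_sparse {δ : ℝ} (hδ0 : 0 < δ) (hδ1 : δ < 1) {f g : ℕ → ℝ}
    (hf : ∀ k, 0 ≤ f k) {p : ℝ} (hfg : Tendsto (fun k => f k - g k) atTop (𝓝 p))
    (hg : Tendsto (fun j => logSum g (sparseIndex δ j) / sparseLog δ j) atTop (𝓝 0)) :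
    Tendsto (fun n : ℕ => logSum f n / Real.log n) atTop (𝓝 p) := by
  refine tendsto_div_log_of_sparse hδ0 hδ1 (monotone_logSum hf) (logSum_nonneg hf) ?_
  have hmean := ((tendsto_logSum_div_log hfg).comp (tendsto_sparseIndex hδ0)).mul
    (tendsto_log_sparseIndex_div hδ0)
  have hsum := hg.add hmean
  rw [zero_add, mul_one] at hsum
  refine hsum.congr' ?_
  filter_upwards [(tendsto_sparseIndex hδ0).eventually eventually_log_pos] with j hj
  have hL := sparseLog_pos δ j
  simp only [Function.comp, logSum_sub]
  field_simp
  ring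

section AlmostSure

variable {Ω : Type*} [MeasurableSpace Ω] {P : Measure Ω}

theorem ae_tendsto_zero_of_integral_sq_le {Z : ℕ → Ω → ℝ}
    (hZ : ∀ j, Integrable (fun ω => Z j ω ^ 2) P) {a : ℕ → ℝ} (ha : Summable a)
    (hle : ∀ᶠ j in atTop, ∫ ω, Z j ω ^ 2 ∂P ≤ a j) :
    ∀ᵐ ω ∂P, Tendsto (fun j => Z j ω) atTop (𝓝 0) := by
  have hsummable : Summable fun j => ∫ ω, Z j ω ^ 2 ∂P := by
    refine ha.of_norm_bounded_eventually_nat (hle.mono fun j hj => ?_)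
    rwa [Real.norm_of_nonneg (integral_nonneg fun ω => sq_nonneg _)]
  have hfin : ∫⁻ ω, ∑' j, ENNReal.ofReal (Z j ω ^ 2) ∂P ≠ ∞ := by
    rw [lintegral_tsum fun j => (hZ j).aemeasurable.ennreal_ofReal]
    simp_rw [← ofReal_integral_eq_lintegral_ofReal (hZ _) (.of_forall fun _ => sq_nonneg _)]
    exact hsummable.tsum_ofReal_ne_top
  filter_upwards [ae_lt_top' (AEMeasurable.tsum fun j =>
    (hZ j).aemeasurable.ennreal_ofReal) hfin] with ω hω
  have hsq : Tendsto (fun j => Z j ω ^ 2) atTop (𝓝 0) := by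
    refine ((ENNReal.tendsto_toReal ENNReal.zero_ne_top).comp
      (ENNReal.tendsto_atTop_zero_of_tsum_ne_top hω.ne)).congr fun j => ?_
    exact ENNReal.toReal_ofReal (sq_nonneg _)
  rw [tendsto_zero_iff_abs_tendsto_zero]
  exact (Real.sqrt_zero ▸ (Real.continuous_sqrt.tendsto 0).comp hsq).congr
    fun j => Real.sqrt_sq_eq_abs _

lemma integral_logSum_sq {Y : ℕ → Ω → ℝ} (hY : ∀ m n, Integrable (fun ω => Y m ω * Y n ω) P)
    (N : ℕ) :
    ∫ ω, logSum (fun k => Y k ω) N ^ 2 ∂P = ∑ m ∈ Finset.Icc 1 N, ∑ n ∈ Finset.Icc 1 N,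
      1 / (m : ℝ) * (1 / (n : ℝ)) * ∫ ω, Y m ω * Y n ω ∂P := by
  have hint : ∀ m n : ℕ, Integrable (fun ω => 1 / (m : ℝ) * (1 / (n : ℝ)) * (Y m ω * Y n ω)) P :=
    fun m n => (hY m n).const_mul _
  have hexpand : ∀ ω, logSum (fun k => Y k ω) N ^ 2 = ∑ m ∈ Finset.Icc 1 N, ∑ n ∈ Finset.Icc 1 N,
      1 / (m : ℝ) * (1 / (n : ℝ)) * (Y m ω * Y n ω) := fun ω => by
    simp_rw [logSum, sq, Finset.sum_mul_sum, mul_mul_mul_comm _ (Y _ ω)]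
  simp_rw [hexpand]
  rw [integral_finsetSum _ fun m _ => integrable_finsetSum _ fun n _ => hint m n]
  refine Finset.sum_congr rfl fun m _ => ?_
  rw [integral_finsetSum _ fun n _ => hint m n]
  simp_rw [integral_const_mul]

lemma one_div_mul_one_div_mul_le {c D : ℝ} {K m n : ℕ} (hm : 1 ≤ m) (hD : 0 ≤ D) (hc1 : c ≤ 1)
    (hc : m ≠ n → K < max m n → c ≤ D) :
    1 / (m : ℝ) * (1 / (n : ℝ)) * c ≤
      (if m ≤ K then 1 / (m : ℝ) else 0) * (if n ≤ K then 1 / (n : ℝ) else 0) +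
        (if m = n then 1 / (m : ℝ) else 0) + D * (1 / (m : ℝ) * (1 / (n : ℝ))) := by
  have hpos : 0 ≤ 1 / (m : ℝ) * (1 / (n : ℝ)) := by positivity
  have hle := mul_le_mul_of_nonneg_left hc1 hpos
  have hDpos := mul_nonneg hD hpos
  have hdiag : 0 ≤ if m = n then 1 / (m : ℝ) else 0 := by split_ifs <;> positivity
  by_cases hK : m ≤ K ∧ n ≤ K
  · rw [if_pos hK.1, if_pos hK.2]
    linarith
  have hblock : 0 ≤ (if m ≤ K then 1 / (m : ℝ) else 0) * (if n ≤ K then 1 / (n : ℝ) else 0) := by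
    split_ifs <;> positivity
  by_cases hmn : m = n
  · subst hmn
    have hone : 1 / (m : ℝ) ≤ 1 := (div_le_one (Nat.cast_pos.2 hm)).2 (Nat.one_le_cast.2 hm)
    have hsq := mul_le_of_le_one_right (by positivity : 0 ≤ 1 / (m : ℝ)) hone
    rw [if_pos rfl]
    linarith
  · linarith [mul_le_mul_of_nonneg_left (hc hmn (by grind)) hpos]

lemma sum_one_div_mul_le {c : ℕ → ℕ → ℝ} {D : ℝ} {K : ℕ} (hD : 0 ≤ D) (hc1 : ∀ m n, c m n ≤ 1)
    (hc : ∀ m n, m ≠ n → K < max m n → c m n ≤ D) (N : ℕ) :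
    ∑ m ∈ Finset.Icc 1 N, ∑ n ∈ Finset.Icc 1 N, 1 / (m : ℝ) * (1 / (n : ℝ)) * c m n ≤
      (harmonic K : ℝ) ^ 2 + harmonic N + D * (harmonic N : ℝ) ^ 2 := by
  have hblock : ∑ m ∈ Finset.Icc 1 N, (if m ≤ K then 1 / (m : ℝ) else 0) ≤ harmonic K := by
    rw [← sum_Icc_one_div, ← Finset.sum_filter]
    refine Finset.sum_le_sum_of_subset_of_nonneg (fun k hk => ?_) fun _ _ _ => by positivity
    simp only [Finset.mem_filter, Finset.mem_Icc] at hk ⊢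
    exact ⟨hk.1.1, hk.2⟩
  refine (Finset.sum_le_sum fun m hm => Finset.sum_le_sum fun n _ => one_div_mul_one_div_mul_le
    (Finset.mem_Icc.1 hm).1 hD (hc1 m n) (hc m n)).trans ?_
  simp only [Finset.sum_add_distrib, ← Finset.mul_sum, ← Finset.sum_mul]
  refine add_le_add (add_le_add ?_ (le_of_eq ?_)) (le_of_eq ?_)
  · rw [sq]
    exact mul_le_mul hblock hblock (Finset.sum_nonneg fun _ _ => by positivity)
      (zero_le_harmonic_cast K)
  · rw [← sum_Icc_one_div]
    exact Finset.sum_congr rfl fun m hm => by rw [Finset.sum_ite_eq, if_pos hm]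
  · rw [sum_Icc_one_div, sq]

section SecondMoment

variable [IsProbabilityMeasure P] {Y : ℕ → Ω → ℝ}

lemma integrable_logSum_sq (hY : ∀ k, AEStronglyMeasurable (Y k) P) (hY1 : ∀ k ω, |Y k ω| ≤ 1)
    (N : ℕ) : Integrable (fun ω => logSum (fun k => Y k ω) N ^ 2) P := by
  have hmeas : AEStronglyMeasurable (fun ω => logSum (fun k => Y k ω) N) P :=
    Finset.aestronglyMeasurable_fun_sum _ fun k _ => (hY k).const_mul _
  refine .of_bound (hmeas.pow 2) ((harmonic N : ℝ) ^ 2) (.of_forall fun ω => ?_)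
  rw [norm_pow, Real.norm_eq_abs]
  gcongr
  exact abs_logSum_le (hY1 · ω) N

theorem integral_logSum_sq_le (hY : ∀ k, AEStronglyMeasurable (Y k) P)
    (hY1 : ∀ k ω, |Y k ω| ≤ 1) {K : ℕ} {D : ℝ} (hD : 0 ≤ D)
    (hYD : ∀ m n, m < n → K < n → |∫ ω, Y m ω * Y n ω ∂P| ≤ D) (N : ℕ) :
    ∫ ω, logSum (fun k => Y k ω) N ^ 2 ∂P ≤
      (harmonic K : ℝ) ^ 2 + harmonic N + D * (harmonic N : ℝ) ^ 2 := by
  have hbound : ∀ m n ω, ‖Y m ω * Y n ω‖ ≤ 1 := fun m n ω => by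
    rw [Real.norm_eq_abs, abs_mul]
    exact mul_le_one₀ (hY1 m ω) (abs_nonneg _) (hY1 n ω)
  rw [integral_logSum_sq fun m n =>
    .of_bound ((hY m).mul (hY n)) 1 (.of_forall (hbound m n))]
  refine sum_one_div_mul_le hD (fun m n => ?_) (fun m n hne hK => ?_) N
  · refine (le_abs_self _).trans ?_
    simpa using norm_integral_le_of_norm_le_const (μ := P) (.of_forall (hbound m n))
  · rcases lt_or_gt_of_ne hne with hlt | hgt
    · exact (le_abs_self _).trans (hYD m n hlt (max_eq_right hlt.le ▸ hK))
    · simp_rw [mul_comm (Y m _)]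
      exact (le_abs_self _).trans (hYD n m hgt (max_eq_left hgt.le ▸ hK))

lemma harmonic_floor_exp_le {L : ℝ} (hL : 1 ≤ L) : (harmonic ⌊Real.exp L⌋₊ : ℝ) ≤ 2 * L := by
  have hpos : (0 : ℝ) < ⌊Real.exp L⌋₊ :=
    Nat.cast_pos.2 (Nat.floor_pos.2 (Real.one_le_exp (zero_le_one.trans hL)))
  have hlog : Real.log ⌊Real.exp L⌋₊ ≤ L :=
    (Real.log_le_iff_le_exp hpos).2 (Nat.floor_le (Real.exp_pos _).le)
  linarith [harmonic_le_one_add_log ⌊Real.exp L⌋₊]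

lemma log_log_rpow_neg_le {x y s : ℝ} (hx : 0 < x) (hs : 0 ≤ s)
    (hy : Real.exp (Real.exp (x / 2)) < y) :
    Real.log (Real.log y) ^ (-s) ≤ 2 ^ s * x ^ (-s) := by
  have hlog : Real.exp (x / 2) < Real.log y :=
    (Real.lt_log_iff_exp_lt ((Real.exp_pos _).trans hy)).2 hy
  have hloglog : x / 2 < Real.log (Real.log y) :=
    (Real.lt_log_iff_exp_lt ((Real.exp_pos _).trans hlog)).2 hlog
  calc Real.log (Real.log y) ^ (-s) ≤ (x / 2) ^ (-s) :=
        Real.rpow_le_rpow_of_nonpos (by positivity) hloglog.le (neg_nonpos.2 hs)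
    _ = 2 ^ s * x ^ (-s) := by
        rw [Real.div_rpow hx.le zero_le_two, Real.rpow_neg zero_le_two]
        field_simp

lemma inv_exp_le_rpow_neg {x s : ℝ} (hx : 0 < x) (hs : 0 < s) :
    (Real.exp x)⁻¹ ≤ s ^ s * x ^ (-s) := by
  have hpow : (x / s) ^ s ≤ Real.exp x :=
    calc (x / s) ^ s ≤ Real.exp (x / s) ^ s := by
          gcongr
          linarith [Real.add_one_le_exp (x / s)]
      _ = Real.exp x := by rw [← Real.exp_mul, div_mul_cancel₀ _ hs.ne']
  calc (Real.exp x)⁻¹ ≤ ((x / s) ^ s)⁻¹ := by gcongr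
    _ = s ^ s * x ^ (-s) := by
        rw [Real.div_rpow hx.le hs.le, Real.rpow_neg hx.le, inv_div, div_eq_mul_inv]

lemma eventually_integral_logSum_sparseIndex_sq_le (hY : ∀ k, AEStronglyMeasurable (Y k) P)
    (hY1 : ∀ k ω, |Y k ω| ≤ 1) {C s δ : ℝ} (hC : 0 ≤ C) (hs : 0 ≤ s) (hδ : 0 < δ) {N₀ : ℕ}
    (hYC : ∀ m n, m < n → N₀ ≤ n →
      |∫ ω, Y m ω * Y n ω ∂P| ≤ C * Real.log (Real.log n) ^ (-s)) :
    ∀ᶠ j : ℕ in atTop, ∫ ω, logSum (fun k => Y k ω) (sparseIndex δ j) ^ 2 ∂P ≤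
      6 * sparseLog δ j +
        4 * (C * (2 ^ s * ((j : ℝ) ^ δ) ^ (-s))) * sparseLog δ j ^ 2 := by
  have hlarge : ∀ᶠ j in atTop, (N₀ : ℝ) ≤ Real.exp √(sparseLog δ j) :=
    (Real.tendsto_exp_atTop.comp (Real.tendsto_sqrt_atTop.comp
      (tendsto_sparseLog hδ))).eventually_ge_atTop _
  filter_upwards [hlarge, eventually_gt_atTop 0] with j hj hj0
  set L := sparseLog δ j with hL
  set x : ℝ := (j : ℝ) ^ δ
  have hx : 0 < x := Real.rpow_pos_of_pos (Nat.cast_pos.2 hj0) δ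
  have hL1 : 1 ≤ L := one_le_sparseLog δ j
  have hsqrt : √L = Real.exp (x / 2) := by rw [hL, sparseLog, Real.exp_half]
  have hcov : ∀ m n, m < n → ⌊Real.exp √L⌋₊ < n →
      |∫ ω, Y m ω * Y n ω ∂P| ≤ C * (2 ^ s * x ^ (-s)) := by
    intro m n hmn hKn
    have hn : Real.exp √L < n := (Nat.floor_lt (Real.exp_pos _).le).1 hKn
    refine (hYC m n hmn (by exact_mod_cast hj.trans hn.le)).trans ?_
    gcongr
    exact log_log_rpow_neg_le hx hs (hsqrt ▸ hn)
  have hblock := harmonic_floor_exp_le (Real.one_le_sqrt.2 hL1)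
  have hfull : (harmonic (sparseIndex δ j) : ℝ) ≤ 2 * L := harmonic_floor_exp_le hL1
  calc _ ≤ _ := integral_logSum_sq_le hY hY1 (by positivity) hcov _
    _ ≤ (2 * √L) ^ 2 + 2 * L + C * (2 ^ s * x ^ (-s)) * (2 * L) ^ 2 := by
        gcongr <;> exact zero_le_harmonic_cast _
    _ = 6 * L + 4 * (C * (2 ^ s * x ^ (-s))) * L ^ 2 := by
        rw [mul_pow, Real.sq_sqrt (zero_le_one.trans hL1)]
        ring

theorem ae_tendsto_logSum_sparseIndex_div (hY : ∀ k, AEStronglyMeasurable (Y k) P)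
    (hY1 : ∀ k ω, |Y k ω| ≤ 1) {C s δ : ℝ} (hC : 0 ≤ C) (hs : 0 < s) (hδ : 0 < δ)
    (hδs : 1 < δ * s) {N₀ : ℕ}
    (hYC : ∀ m n, m < n → N₀ ≤ n →
      |∫ ω, Y m ω * Y n ω ∂P| ≤ C * Real.log (Real.log n) ^ (-s)) :
    ∀ᵐ ω ∂P, Tendsto (fun j => logSum (fun k => Y k ω) (sparseIndex δ j) / sparseLog δ j)
      atTop (𝓝 0) := by
  have hsummable : Summable fun j : ℕ => (6 * s ^ s + 4 * (C * 2 ^ s)) * (j : ℝ) ^ (-(δ * s)) :=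
    (Real.summable_nat_rpow.2 (by linarith)).mul_left _
  refine ae_tendsto_zero_of_integral_sq_le (fun j => ?_) hsummable ?_
  · simp_rw [div_pow]
    exact (integrable_logSum_sq hY hY1 _).div_const _
  filter_upwards [eventually_integral_logSum_sparseIndex_sq_le hY hY1 hC hs.le hδ hYC,
    eventually_gt_atTop 0] with j hj hj0
  set x : ℝ := (j : ℝ) ^ δ with hx
  have hx0 : 0 < x := Real.rpow_pos_of_pos (Nat.cast_pos.2 hj0) δ
  have hL := sparseLog_pos δ j
  simp_rw [div_pow]
  rw [integral_div]
  calc _ ≤ (6 * sparseLog δ j + 4 * (C * (2 ^ s * x ^ (-s))) * sparseLog δ j ^ 2) /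
          sparseLog δ j ^ 2 := by gcongr
    _ = 6 * (Real.exp x)⁻¹ + 4 * (C * (2 ^ s * x ^ (-s))) := by
        rw [hx, ← sparseLog]
        field_simp
    _ ≤ 6 * (s ^ s * x ^ (-s)) + 4 * (C * (2 ^ s * x ^ (-s))) := by
        gcongr
        exact inv_exp_le_rpow_neg hx0 hs
    _ = _ := by
        rw [hx, ← Real.rpow_mul j.cast_nonneg, mul_neg]
        ring

end SecondMoment

section Events

lemma integral_indicator_one_real {A : Set Ω} (hA : NullMeasurableSet A P) :
    ∫ ω, A.indicator (fun _ => (1 : ℝ)) ω ∂P = P.real A := by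
  rw [integral_indicator₀ hA]
  simp

variable [IsProbabilityMeasure P]

lemma integral_centered_indicator_mul {A B : Set Ω} (hA : NullMeasurableSet A P)
    (hB : NullMeasurableSet B P) :
    ∫ ω, (A.indicator (fun _ => (1 : ℝ)) ω - P.real A) *
        (B.indicator (fun _ => (1 : ℝ)) ω - P.real B) ∂P =
      P.real (A ∩ B) - P.real A * P.real B := by
  have hmem : ∀ {S : Set Ω}, NullMeasurableSet S P →
      MemLp (S.indicator fun _ => (1 : ℝ)) 2 P := fun hS =>
    .of_bound (aestronglyMeasurable_const.indicator₀ hS) 1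
      (.of_forall fun ω => (norm_indicator_le_norm_self _ _).trans_eq norm_one)
  have hcov := covariance_eq_sub (hmem hA) (hmem hB)
  rw [covariance, integral_indicator_one_real hA, integral_indicator_one_real hB] at hcov
  rw [hcov, ← integral_indicator_one_real (hA.inter hB)]
  congr 2
  ext ω
  simpa using (Set.inter_indicator_mul (s := A) (t := B) (fun _ => (1 : ℝ)) (fun _ => 1) ω).symm

lemma abs_centered_indicator_le_one (A : Set Ω) (ω : Ω) :
    |A.indicator (fun _ => (1 : ℝ)) ω - P.real A| ≤ 1 := by
  have h0 : 0 ≤ P.real A := measureReal_nonneg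
  have h1 : P.real A ≤ 1 := measureReal_le_one
  rw [abs_le]
  by_cases hω : ω ∈ A
  · rw [Set.indicator_of_mem hω]
    constructor <;> linarith
  · rw [Set.indicator_of_notMem hω]
    constructor <;> linarith

theorem ae_tendsto_logAverage {A : ℕ → Set Ω} (hA : ∀ k, NullMeasurableSet (A k) P) {p : ℝ}
    (hp : Tendsto (fun k => P.real (A k)) atTop (𝓝 p)) {C ε : ℝ} (hC : 0 ≤ C) (hε : 0 < ε)
    (hAC : ∀ᶠ m in atTop, ∀ n, m < n →
      |P.real (A m ∩ A n) - P.real (A m) * P.real (A n)| ≤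
        C * Real.log (Real.log n) ^ (-(1 + ε))) :
    ∀ᵐ ω ∂P, Tendsto (fun n => logAverage A n ω) atTop (𝓝 p) := by
  obtain ⟨N, hN⟩ := eventually_atTop.1
    (hAC.and (tendsto_log_log_natCast.eventually_ge_atTop 0))
  -- Erasing the finitely many events without a covariance bound does not affect the limit.
  set A' : ℕ → Set Ω := fun k => if N ≤ k then A k else ∅ with hA'
  set Y : ℕ → Ω → ℝ := fun k ω => (A' k).indicator (fun _ => (1 : ℝ)) ω - P.real (A' k) with hY
  have hA'm : ∀ k, NullMeasurableSet (A' k) P := fun k => by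
    simp only [hA']
    split_ifs
    exacts [hA k, .empty]
  have hYC : ∀ m n, m < n → N ≤ n →
      |∫ ω, Y m ω * Y n ω ∂P| ≤ C * Real.log (Real.log n) ^ (-(1 + ε)) := by
    intro m n hmn hn
    rw [integral_centered_indicator_mul (hA'm m) (hA'm n)]
    by_cases hm : N ≤ m
    · simpa only [hA', if_pos hm, if_pos hn] using (hN m hm).1 n hmn
    · have := (hN n hn).2
      simp only [hA', if_neg hm, Set.empty_inter, measureReal_empty, zero_mul, sub_zero, abs_zero]
      positivity
  set δ := (1 + ε / 2)⁻¹ with hδ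
  have hδ0 : 0 < δ := by positivity
  have hδ1 : δ < 1 := inv_lt_one_of_one_lt₀ (by linarith)
  have hδs : 1 < δ * (1 + ε) := by
    rw [hδ, inv_mul_eq_div, lt_div_iff₀ (by positivity)]
    linarith
  filter_upwards [ae_tendsto_logSum_sparseIndex_div (Y := Y)
    (fun k => (aestronglyMeasurable_const.indicator₀ (hA'm k)).sub aestronglyMeasurable_const)
    (fun k ω => abs_centered_indicator_le_one (A' k) ω) hC (by linarith) hδ0 hδs hYC] with ω hω
  have hdiff : Tendsto (fun k => (A k).indicator (fun _ => (1 : ℝ)) ω - Y k ω) atTop (𝓝 p) := by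
    refine hp.congr' ((eventually_ge_atTop N).mono fun k hk => ?_)
    simp only [hY, hA', if_pos hk, sub_sub_cancel]
  refine (tendsto_logSum_div_log_of_sparse hδ0 hδ1
    (fun k => Set.indicator_nonneg (fun _ _ => zero_le_one) ω) hdiff hω).congr fun n => ?_
  rw [logAverage, logSum, div_eq_inv_mul, one_div]

end Events

end AlmostSure

/-! ### Row events -/

section GaussianBlocks

variable {Ω : Type*} [MeasurableSpace Ω] {P : Measure Ω}

lemma hasGaussianLaw_of_isGaussianProcess {S T : Type*} [Finite T] {Y : S → Ω → ℝ}
    (hY : IsGaussianProcess Y P) (e : T → S) : HasGaussianLaw (fun ω t => Y (e t) ω) P :=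
  have := Fintype.ofFinite T
  ((hY.comp_right e).hasGaussianLaw Finset.univ).map_fun
    (ContinuousLinearMap.pi fun t : T =>
      ContinuousLinearMap.proj (R := ℝ) (φ := fun _ => ℝ)
        (⟨t, Finset.mem_univ t⟩ : (Finset.univ : Finset T)))

theorem abs_measureReal_inter_windows_sub_mul_le {S T : Type*} [Fintype S] [Fintype T]
    {Y : S → Ω → ℝ} {Z : T → Ω → ℝ} (hYZ : HasGaussianLaw (fun ω a => Sum.elim Y Z a ω) P)
    (hY0 : ∀ s, ∫ ω, Y s ω ∂P = 0) (hY1 : ∀ s, Var[Y s; P] = 1)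
    (hZ0 : ∀ t, ∫ ω, Z t ω ∂P = 0) (hZ1 : ∀ t, Var[Z t; P] = 1)
    {R : ℝ} (hR : R < 1) (hrR : ∀ s t, |cov[Y s, Z t; P]| ≤ R)
    {B : S → Set ℝ} {C : T → Set ℝ} {v : S → ℝ} {w : T → ℝ}
    (hB : ∀ s, IsWindow (B s) (v s)) (hC : ∀ t, IsWindow (C t) (w t)) :
    |P.real ({ω | ∀ s, Y s ω ∈ B s} ∩ {ω | ∀ t, Z t ω ∈ C t})
        - P.real {ω | ∀ s, Y s ω ∈ B s} * P.real {ω | ∀ t, Z t ω ∈ C t}|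
      ≤ 4 * Real.pi * (√(1 - R ^ 2))⁻¹
        * ∑ s, ∑ t, comparisonTerm cov[Y s, Z t; P] (v s) (w t) := by
  have key := abs_measureReal_windows_sub_prod_le hYZ Sum.isLeft (Sum.forall.2 ⟨hY0, hZ0⟩)
    (Sum.forall.2 ⟨hY1, hZ1⟩) hR (B := Sum.elim B C) (w := Sum.elim v w)
    (by
      rintro (s | s) (t | t) hst
      · exact absurd rfl hst
      · exact hrR s t
      · exact covariance_comm (Z s) (Y t) ▸ hrR t s
      · exact absurd rfl hst)
    (Sum.forall.2 ⟨hB, hC⟩)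
  have hsum : ∑ t, ∑ s, comparisonTerm cov[Z t, Y s; P] (w t) (v s)
      = ∑ s, ∑ t, comparisonTerm cov[Y s, Z t; P] (v s) (w t) := by
    rw [Finset.sum_comm]
    exact Finset.sum_congr rfl fun s _ => Finset.sum_congr rfl fun t _ => by
      rw [covariance_comm, comparisonTerm_comm]
  simp only [Sum.forall, Sum.elim_inl, Sum.elim_inr, Fintype.prod_bool, Fintype.sum_sum_type,
    Sum.isLeft_inl, Sum.isLeft_inr, Bool.true_eq_false, Bool.false_eq_true, forall_const,
    IsEmpty.forall_iff, implies_true, and_true, true_and, if_true, if_false,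
    Finset.sum_const_zero, zero_add, add_zero, hsum] at key
  rw [Set.ofPred_and] at key
  exact key.trans_eq (by ring)

end GaussianBlocks

section RowEvents

variable {Ω : Type*} {X : ℕ → ℕ → Fin 2 → Ω → ℝ}

/-- The event that the components of all vectors of row `n` lie in the windows `B 0`, `B 1`.
The positions `1, …, n` are indexed by `Fin n`. -/
def rowEvent (X : ℕ → ℕ → Fin 2 → Ω → ℝ) (n : ℕ) (B : Fin 2 → Set ℝ) : Set Ω :=
  {ω | ∀ s : Fin n × Fin 2, X n (s.1 + 1) s.2 ω ∈ B s.2}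

lemma forall_mem_Icc_one_iff {n : ℕ} {p : ℕ → Prop} :
    (∀ k ∈ Set.Icc 1 n, p k) ↔ ∀ k : Fin n, p (k + 1) := by
  constructor
  · exact fun h k => h _ ⟨Nat.le_add_left 1 k, k.isLt⟩
  · rintro h (_ | k) ⟨h1, hk⟩
    · omega
    · exact h ⟨k, hk⟩

lemma rowMax_le_iff {n : ℕ} (hn : 1 ≤ n) (i : Fin 2) (ω : Ω) (u : ℝ) :
    rowMax X n i ω ≤ u ↔ ∀ k : Fin n, X n (k + 1) i ω ≤ u := by
  rw [rowMax, csSup_le_iff ((Set.finite_Icc 1 n).image _).bddAbove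
    ((Set.nonempty_Icc.2 hn).image _), Set.forall_mem_image]
  exact forall_mem_Icc_one_iff

lemma lt_rowMin_iff {n : ℕ} (hn : 1 ≤ n) (i : Fin 2) (ω : Ω) (v : ℝ) :
    v < rowMin X n i ω ↔ ∀ k : Fin n, v < X n (k + 1) i ω := by
  rw [rowMin, ((Set.finite_Icc 1 n).image _).lt_csInf_iff ((Set.nonempty_Icc.2 hn).image _),
    Set.forall_mem_image]
  exact forall_mem_Icc_one_iff

lemma rowMin_le_rowMax {n : ℕ} (hn : 1 ≤ n) (i : Fin 2) (ω : Ω) :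
    rowMin X n i ω ≤ rowMax X n i ω :=
  csInf_le_csSup ((Set.nonempty_Icc.2 hn).image _) ((Set.finite_Icc 1 n).image _).bddBelow
    ((Set.finite_Icc 1 n).image _).bddAbove

lemma maxEvent_eq_rowEvent {n : ℕ} (hn : 1 ≤ n) (x y : ℝ) :
    maxEvent X n x y = rowEvent X n ![Set.Iic (level n x), Set.Iic (level n y)] := by
  ext ω
  simp only [maxEvent, rowEvent, Set.mem_ofPred_eq, rowMax_le_iff hn, Prod.forall,
    Fin.forall_fin_two, forall_and]
  rfl

lemma maxMinEvent_eq_rowEvent {n : ℕ} (hn : 1 ≤ n) (x₁ x₂ y₁ y₂ : ℝ) :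
    maxMinEvent X n x₁ x₂ y₁ y₂ = rowEvent X n
      ![Set.Ioc (-level n y₁) (level n x₁), Set.Ioc (-level n y₂) (level n x₂)] := by
  ext ω
  simp only [maxMinEvent, rowEvent, Set.mem_ofPred_eq, rowMax_le_iff hn, lt_rowMin_iff hn,
    rowMin_le_rowMax hn, true_and, ← forall_and, Prod.forall, Fin.forall_fin_two]
  rfl

lemma logAverage_congr {A A' : ℕ → Set Ω} (h : ∀ k, 1 ≤ k → A k = A' k) (n : ℕ) (ω : Ω) :
    logAverage A n ω = logAverage A' n ω := by
  unfold logAverage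
  congr 1
  exact Finset.sum_congr rfl fun k hk => by rw [h k (Finset.mem_Icc.1 hk).1]

end RowEvents

section Array

variable {Ω : Type*} [MeasurableSpace Ω] {P : Measure Ω} {X : ℕ → ℕ → Fin 2 → Ω → ℝ}
  {ρ₀ : ℕ → ℝ} {ρ : Fin 2 → Fin 2 → ℕ → ℕ → ℝ} {γ : Fin 2 → Fin 2 → ℕ → ℕ → ℕ → ℝ}

/-- The index, in the Gaussian process of all entries of an array, of the entry of row `n` that
`rowEvent` indexes by `s`. -/
def entry (n : ℕ) (s : Fin n × Fin 2) : Position × Fin 2 :=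
  (⟨(n, s.1 + 1), Nat.le_add_left 1 s.1, s.1.isLt⟩, s.2)

lemma gap_succ (k l : ℕ) : gap (k + 1) (l + 1) = gap k l := by
  unfold gap
  omega

lemma corr_eq_covariance {Y Z : Ω → ℝ} (hY : Var[Y; P] = 1) (hZ : Var[Z; P] = 1) :
    corr P Y Z = cov[Y, Z; P] := by
  simp [corr, hY, hZ]

namespace IsStationaryGaussianArray

lemma integral_entry (hX : IsStationaryGaussianArray P X ρ₀ ρ) {n : ℕ} (k : Fin n) (i : Fin 2) :
    ∫ ω, X n (k + 1) i ω ∂P = 0 :=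
  hX.mean_zero _ _ (Nat.le_add_left 1 k) k.isLt _

lemma variance_entry (hX : IsStationaryGaussianArray P X ρ₀ ρ) {n : ℕ} (k : Fin n) (i : Fin 2) :
    Var[X n (k + 1) i; P] = 1 :=
  hX.unit_variance _ _ (Nat.le_add_left 1 k) k.isLt _

lemma nullMeasurableSet_rowEvent (hX : IsStationaryGaussianArray P X ρ₀ ρ) (n : ℕ)
    {B : Fin 2 → Set ℝ} (hB : ∀ i, MeasurableSet (B i)) :
    NullMeasurableSet (rowEvent X n B) P := by
  have hinter : rowEvent X n B = ⋂ s : Fin n × Fin 2, X n (s.1 + 1) s.2 ⁻¹' B s.2 := by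
    ext ω
    simp [rowEvent]
  rw [hinter]
  exact .iInter fun s =>
    (hX.gaussian.aemeasurable (entry n s)).nullMeasurableSet_preimage (hB s.2)

lemma covariance_row (hX : IsStationaryGaussianArray P X ρ₀ ρ) {n : ℕ} {s t : Fin n × Fin 2}
    (hst : s.1 ≠ t.1) :
    cov[X n (s.1 + 1) s.2, X n (t.1 + 1) t.2; P] = ρ s.2 t.2 (gap s.1 t.1) n := by
  rw [← corr_eq_covariance (hX.variance_entry _ _) (hX.variance_entry _ _), ← gap_succ]
  exact hX.corr_row n _ _ (by omega) (by omega) (by omega) (by omega)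
    (fun h => hst (Fin.ext (by omega))) _ _

lemma covariance_cross (hX : IsStationaryGaussianArray P X ρ₀ ρ) (hγ : HasCrossRowCorr P X γ)
    {m n : ℕ} (hmn : m < n) (s : Fin m × Fin 2) (t : Fin n × Fin 2) :
    cov[X m (s.1 + 1) s.2, X n (t.1 + 1) t.2; P] = γ s.2 t.2 (gap s.1 t.1 + 1) m n := by
  rw [← corr_eq_covariance (hX.variance_entry _ _) (hX.variance_entry _ _), ← gap_succ]
  exact hγ m n _ _ hmn (by omega) (by omega) (by omega) (by omega) _ _

lemma isStdPair (hX : IsStationaryGaussianArray P X ρ₀ ρ) {n : ℕ} (k : Fin n) :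
    IsStdPair P (X n (k + 1) 0) (X n (k + 1) 1) (ρ₀ n) where
  gaussian := hX.gaussian.hasGaussianLaw_prodMk (s := entry n (k, 0)) (t := entry n (k, 1))
  mean_fst := hX.integral_entry k 0
  mean_snd := hX.integral_entry k 1
  var_fst := hX.variance_entry k 0
  var_snd := hX.variance_entry k 1
  cov_eq := by
    rw [← corr_eq_covariance (hX.variance_entry k 0) (hX.variance_entry k 1)]
    exact hX.corr_same n _ (Nat.le_add_left 1 k) k.isLt

lemma eventually_abs_le_one (hX : IsStationaryGaussianArray P X ρ₀ ρ) :
    ∀ᶠ n in atTop, |ρ₀ n| ≤ 1 := by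
  filter_upwards [eventually_ge_atTop 1] with n hn
  exact (hX.isStdPair (⟨0, hn⟩ : Fin n)).abs_le_one

lemma prod_measureReal_position (hX : IsStationaryGaussianArray P X ρ₀ ρ) (n : ℕ)
    {B : Fin 2 → Set ℝ} (hB : ∀ i, MeasurableSet (B i)) :
    ∏ k : Fin n, P.real {ω | ∀ t : Fin n × Fin 2, t.1 = k → X n (t.1 + 1) t.2 ω ∈ B t.2}
      = (bivGaussian (ρ₀ n)).real (B 0 ×ˢ B 1) ^ n := by
  have hpos (k : Fin n) :
      P.real {ω | ∀ t : Fin n × Fin 2, t.1 = k → X n (t.1 + 1) t.2 ω ∈ B t.2}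
        = (bivGaussian (ρ₀ n)).real (B 0 ×ˢ B 1) := by
    have hpair := hX.isStdPair k
    rw [← hpair.map_eq_bivGaussian, map_measureReal_apply_of_aemeasurable
      hpair.gaussian.aemeasurable ((hB 0).prod (hB 1))]
    congr 1
    ext ω
    simp [Prod.forall, Fin.forall_fin_two, forall_and]
  simp_rw [hpos, Finset.prod_const, Finset.card_univ, Fintype.card_fin]

end IsStationaryGaussianArray

end Array

section RowIndependence

variable {Ω : Type*} [MeasurableSpace Ω] {P : Measure Ω} {X : ℕ → ℕ → Fin 2 → Ω → ℝ}
  {ρ₀ : ℕ → ℝ} {ρ : Fin 2 → Fin 2 → ℕ → ℕ → ℝ}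

/-- The correlation of two entries of row `n`, set to `0` inside each vector: the correlations that
the comparison with independent vectors removes. -/
def interVectorCorr (ρ : Fin 2 → Fin 2 → ℕ → ℕ → ℝ) (n : ℕ) (s t : Fin n × Fin 2) : ℝ :=
  if s.1 = t.1 then 0 else ρ s.2 t.2 (gap s.1 t.1) n

lemma gap_lt {n : ℕ} (k l : Fin n) : gap k l < n := by
  unfold gap
  omega

lemma one_le_gap {n : ℕ} {k l : Fin n} (hkl : k ≠ l) : 1 ≤ gap k l := by
  have hval : (k : ℕ) ≠ l := Fin.val_ne_of_ne hkl
  unfold gap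
  omega

lemma gap_add_one_le {m n : ℕ} (hmn : m < n) (k : Fin m) (l : Fin n) : gap k l + 1 ≤ n := by
  unfold gap
  omega

lemma IsRowSup.nonneg {σ : ℝ} (hσ : IsRowSup ρ σ) : 0 ≤ σ :=
  (abs_nonneg (ρ 0 0 1 2)).trans (hσ.1 ⟨0, 0, 1, 2, le_rfl, by norm_num, rfl⟩)

lemma IsRowSup.abs_le {σ : ℝ} (hσ : IsRowSup ρ σ) {n : ℕ} {s t : Fin n × Fin 2}
    (hst : s.1 ≠ t.1) : |ρ s.2 t.2 (gap s.1 t.1) n| ≤ σ :=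
  hσ.1 ⟨_, _, _, _, one_le_gap hst, gap_lt _ _, rfl⟩

lemma IsRowSup.abs_interVectorCorr_le {σ : ℝ} (hσ : IsRowSup ρ σ) {n : ℕ} (s t : Fin n × Fin 2) :
    |interVectorCorr ρ n s t| ≤ σ := by
  unfold interVectorCorr
  split_ifs with hst
  · simpa using hσ.nonneg
  · exact hσ.abs_le hst

lemma IsStationaryGaussianArray.abs_measureReal_rowEvent_sub_pow_le
    (hX : IsStationaryGaussianArray P X ρ₀ ρ) {σ : ℝ} (hσ : IsRowSup ρ σ) (hσ1 : σ < 1) {n : ℕ}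
    {B : Fin 2 → Set ℝ} {u : ℝ} (hB : ∀ i, IsWindow (B i) u) :
    |P.real (rowEvent X n B) - (bivGaussian (ρ₀ n)).real (B 0 ×ˢ B 1) ^ n|
      ≤ 2 * Real.pi * (√(1 - σ ^ 2))⁻¹
        * ∑ s, ∑ t, comparisonTerm (interVectorCorr ρ n s t) u u := by
  have key := abs_measureReal_windows_sub_prod_le
    (hasGaussianLaw_of_isGaussianProcess hX.gaussian (entry n)) Prod.fst
    (fun t => hX.integral_entry t.1 t.2) (fun t => hX.variance_entry t.1 t.2) hσ1
    (fun s t hst => (hX.covariance_row hst).symm ▸ hσ.abs_le hst) (fun t => hB t.2)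
  rw [← hX.prod_measureReal_position n fun i => (hB i).1]
  refine key.trans_eq ?_
  congr 1
  refine Finset.sum_congr rfl fun s _ => Finset.sum_congr rfl fun t _ => ?_
  by_cases hst : s.1 = t.1
  · rw [if_pos hst, interVectorCorr, if_pos hst, comparisonTerm_zero]
  · rw [if_neg hst, interVectorCorr, if_neg hst, ← hX.covariance_row hst]
    rfl

lemma tendsto_natCast_rpow_neg {η : ℝ} (hη : 0 < η) :
    Tendsto (fun n : ℕ => (n : ℝ) ^ (-η)) atTop (𝓝 0) :=
  (tendsto_rpow_neg_atTop hη).comp tendsto_natCast_atTop_atTop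

lemma tendsto_zero_of_abs_le_mul_add {ι : Type*} {l : Filter ι} {f g : ι → ℝ} {c : ℝ} (hc : 0 < c)
    (hg : Tendsto g l (𝓝 0)) (hfg : ∀ δ ∈ Set.Ioc (0 : ℝ) 1, ∀ᶠ n in l, |f n| ≤ c * (g n + δ)) :
    Tendsto f l (𝓝 0) := by
  rw [Metric.tendsto_nhds]
  intro e he
  set δ := min 1 (e / (4 * c))
  have hδ : 0 < δ := lt_min one_pos (by positivity)
  have hδe : δ * (4 * c) ≤ e := (le_div_iff₀ (by positivity)).1 (min_le_right _ _)
  filter_upwards [hfg δ ⟨hδ, min_le_left _ _⟩, hg.eventually_le_const hδ] with n hfn hgn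
  rw [Real.dist_eq, sub_zero]
  calc |f n| ≤ c * (g n + δ) := hfn
    _ ≤ c * (δ + δ) := by gcongr
    _ < e := by nlinarith

theorem tendsto_measure_rowEvent_sub_pow (hX : IsStationaryGaussianArray P X ρ₀ ρ)
    {σ α : ℝ} (hσ : IsRowSup ρ σ) (hσ1 : σ < 1) (hα : α < (1 - σ) / (1 + σ))
    (hBerman : BermanCondition ρ α) {z : ℝ} {B : ℕ → Fin 2 → Set ℝ}
    (hB : ∀ᶠ n in atTop, ∀ i, IsWindow (B n i) (level n z)) :
    Tendsto (fun n => P.real (rowEvent X n (B n))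
      - (bivGaussian (ρ₀ n)).real (B n 0 ×ˢ B n 1) ^ n) atTop (𝓝 0) := by
  obtain ⟨η, hη, K, hK, N, hsum⟩ := exists_sum_comparisonTerm_le z hσ.nonneg hσ1 hα
  have hsqrt : 0 < √(1 - σ ^ 2) := Real.sqrt_pos.2 (by nlinarith [hσ.nonneg])
  refine tendsto_zero_of_abs_le_mul_add (c := 2 * Real.pi * (√(1 - σ ^ 2))⁻¹ * K) (by positivity)
    (tendsto_natCast_rpow_neg hη) fun δ hδ => ?_
  filter_upwards [hB, eventually_ge_atTop N, eventually_log_pos, hBerman δ hδ.1]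
    with n hBn hnN hlog hfar
  have hq : δ / Real.log n * Real.log n = δ := div_mul_cancel₀ _ hlog.ne'
  have hq0 : 0 ≤ δ / Real.log n := div_nonneg hδ.1.le hlog.le
  have hbound := hsum n n hnN le_rfl (interVectorCorr ρ n) (δ / Real.log n) hq0
    (hq.trans_le hδ.2) hσ.abs_interVectorCorr_le fun s t hst => by
      unfold interVectorCorr
      split_ifs
      · simpa using hq0
      · exact (le_div_iff₀ hlog).2 (hfar _ _ _ hst (gap_lt _ _))
  rw [hq] at hbound
  calc _ ≤ _ := hX.abs_measureReal_rowEvent_sub_pow_le hσ hσ1 hBn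
    _ ≤ 2 * Real.pi * (√(1 - σ ^ 2))⁻¹ * (K * ((n : ℝ) ^ (-η) + δ)) := by gcongr
    _ = _ := by ring

end RowIndependence

section CrossRows

variable {Ω : Type*} [MeasurableSpace Ω] {P : Measure Ω} {X : ℕ → ℕ → Fin 2 → Ω → ℝ}
  {ρ₀ : ℕ → ℝ} {ρ : Fin 2 → Fin 2 → ℕ → ℕ → ℝ} {γ : Fin 2 → Fin 2 → ℕ → ℕ → ℕ → ℝ}

lemma IsCrossSup.nonneg {θ : ℝ} (hθ : IsCrossSup γ θ) : 0 ≤ θ :=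
  (abs_nonneg (γ 0 0 1 1 2)).trans
    (hθ.1 ⟨0, 0, 1, 1, 2, le_rfl, by norm_num, le_rfl, by norm_num, rfl⟩)

lemma IsCrossSup.abs_le {θ : ℝ} (hθ : IsCrossSup γ θ) {m n : ℕ} (hmn : m < n)
    (s : Fin m × Fin 2) (t : Fin n × Fin 2) : |γ s.2 t.2 (gap s.1 t.1 + 1) m n| ≤ θ :=
  hθ.1 ⟨_, _, _, _, _, Nat.le_add_left _ _, gap_add_one_le hmn _ _, s.1.pos, hmn, rfl⟩

lemma IsStationaryGaussianArray.abs_measureReal_inter_rowEvent_sub_mul_le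
    (hX : IsStationaryGaussianArray P X ρ₀ ρ) (hγ : HasCrossRowCorr P X γ) {θ : ℝ}
    (hθ : IsCrossSup γ θ) (hθ1 : θ < 1) {m n : ℕ} (hmn : m < n) {B C : Fin 2 → Set ℝ} {u v : ℝ}
    (hB : ∀ i, IsWindow (B i) u) (hC : ∀ i, IsWindow (C i) v) :
    |P.real (rowEvent X m B ∩ rowEvent X n C) - P.real (rowEvent X m B) * P.real (rowEvent X n C)|
      ≤ 4 * Real.pi * (√(1 - θ ^ 2))⁻¹ * ∑ s : Fin m × Fin 2, ∑ t : Fin n × Fin 2,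
        comparisonTerm (γ s.2 t.2 (gap s.1 t.1 + 1) m n) u v := by
  have hlaw : HasGaussianLaw (fun ω a => Sum.elim (fun s : Fin m × Fin 2 => X m (s.1 + 1) s.2)
      (fun t : Fin n × Fin 2 => X n (t.1 + 1) t.2) a ω) P := by
    convert hasGaussianLaw_of_isGaussianProcess hX.gaussian (Sum.elim (entry m) (entry n))
      using 3 with ω a
    cases a <;> rfl
  simp_rw [← hX.covariance_cross hγ hmn]
  exact abs_measureReal_inter_windows_sub_mul_le hlaw (fun s => hX.integral_entry s.1 s.2)
    (fun s => hX.variance_entry s.1 s.2) (fun t => hX.integral_entry t.1 t.2)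
    (fun t => hX.variance_entry t.1 t.2) hθ1
    (fun s t => (hX.covariance_cross hγ hmn s t).symm ▸ hθ.abs_le hmn s t)
    (fun s => hB s.2) fun t => hC t.2

lemma eventually_rpow_half_le_of_powFloor_le {β : ℝ} (hβ : 0 < β) :
    ∀ᶠ n : ℕ in atTop, ∀ t : ℕ, powFloor β n ≤ t → (n : ℝ) ^ (β / 2) ≤ t := by
  filter_upwards [eventually_gt_atTop 0,
    ((tendsto_rpow_atTop (half_pos hβ)).comp tendsto_natCast_atTop_atTop).eventually_ge_atTop 2]
    with n hn0 hpow t ht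
  rw [Function.comp_apply] at hpow
  have hfloor : (n : ℝ) ^ β < powFloor β n + 1 := Nat.lt_floor_add_one _
  have hcast : (powFloor β n : ℝ) ≤ t := mod_cast ht
  have hsq : (n : ℝ) ^ β = (n : ℝ) ^ (β / 2) * (n : ℝ) ^ (β / 2) := by
    rw [← Real.rpow_add (mod_cast hn0), add_halves]
  nlinarith

lemma eventually_log_mul_log_log_rpow_ge {β s : ℝ} (hβ : 0 < β) (hs : 0 ≤ s) :
    ∀ᶠ n : ℕ in atTop, ∀ t : ℕ, powFloor β n ≤ t →
      β / 2 * (1 / 2) ^ s * (Real.log n * Real.log (Real.log n) ^ s)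
        ≤ Real.log t * Real.log (Real.log t) ^ s := by
  filter_upwards [eventually_rpow_half_le_of_powFloor_le hβ, eventually_gt_atTop 0,
    eventually_log_pos, tendsto_log_log_natCast.eventually_ge_atTop 0,
    tendsto_log_log_natCast.eventually_ge_atTop (-2 * Real.log (β / 2))]
    with n hpow hn0 hlog hll hllβ t ht
  have hn : (0 : ℝ) < n := mod_cast hn0
  have hlogt : β / 2 * Real.log n ≤ Real.log t := by
    rw [← Real.log_rpow hn]
    exact Real.log_le_log (by positivity) (hpow t ht)
  have hllt : 1 / 2 * Real.log (Real.log n) ≤ Real.log (Real.log t) := by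
    have hmono := Real.log_le_log (by positivity) hlogt
    rw [Real.log_mul (by positivity) hlog.ne'] at hmono
    linarith
  calc _ = β / 2 * Real.log n * (1 / 2 * Real.log (Real.log n)) ^ s := by
        rw [Real.mul_rpow (by norm_num) hll]
        ring
    _ ≤ _ := by gcongr

lemma CrossRate.exists_eventually_abs_le {β ε : ℝ} (h : CrossRate γ β ε) (hβ : 0 < β)
    (hε : 0 < ε) : ∃ C, 0 ≤ C ∧ ∀ᶠ n : ℕ in atTop, ∀ m, 1 ≤ m → m < n → ∀ i j t,
      powFloor β n ≤ t → t ≤ n →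
        |γ i j t m n| ≤ C * Real.log (Real.log n) ^ (-(1 + ε)) / Real.log n := by
  obtain ⟨C, hC⟩ := h
  set a := β / 2 * (1 / 2) ^ (1 + ε)
  have ha : 0 < a := by positivity
  refine ⟨|C| / a, by positivity, ?_⟩
  filter_upwards [hC, eventually_log_mul_log_log_rpow_ge hβ (by positivity : 0 ≤ 1 + ε),
    eventually_log_pos, tendsto_log_log_natCast.eventually_gt_atTop 0]
    with n hn hlow hlog hll m hm hmn i j t ht htn
  have hmul : |γ i j t m n| * (a * (Real.log n * Real.log (Real.log n) ^ (1 + ε))) ≤ |C| :=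
    calc _ ≤ |γ i j t m n| * (Real.log t * Real.log (Real.log t) ^ (1 + ε)) :=
          mul_le_mul_of_nonneg_left (hlow t ht) (abs_nonneg _)
      _ ≤ |C| := by
          rw [← mul_assoc]
          exact (hn m hm hmn i j t ht htn).trans (le_abs_self C)
  calc |γ i j t m n| ≤ |C| / (a * (Real.log n * Real.log (Real.log n) ^ (1 + ε))) :=
        (le_div_iff₀ (by positivity)).2 hmul
    _ = _ := by
        rw [Real.rpow_neg hll.le]
        field_simp

lemma eventually_rpow_neg_le_log_log_rpow_neg {η s : ℝ} (hη : 0 < η) (hs : 0 ≤ s) :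
    ∀ᶠ n : ℕ in atTop, (n : ℝ) ^ (-η) ≤ Real.log (Real.log n) ^ (-s) := by
  have hbound := (isLittleO_log_rpow_rpow_atTop s hη).bound one_pos
  filter_upwards [tendsto_natCast_atTop_atTop.eventually hbound, eventually_log_pos,
    tendsto_log_log_natCast.eventually_gt_atTop 0, eventually_gt_atTop 0] with n hn hlog hll hn0
  have hnpos : (0 : ℝ) < n := mod_cast hn0
  rw [one_mul, Real.norm_of_nonneg (by positivity), Real.norm_of_nonneg (by positivity)] at hn
  rw [Real.rpow_neg hnpos.le, Real.rpow_neg hll.le]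
  have hle : Real.log (Real.log n) ≤ Real.log n := Real.log_le_self hlog.le
  exact inv_anti₀ (by positivity) ((Real.rpow_le_rpow hll.le hle hs).trans hn)

theorem exists_abs_measure_inter_rowEvent_sub_le (hX : IsStationaryGaussianArray P X ρ₀ ρ)
    (hγ : HasCrossRowCorr P X γ) {θ β : ℝ} (hθ : IsCrossSup γ θ) (hθ1 : θ < 1)
    (hβ0 : 0 < β) (hβ : β < (1 - θ) / (1 + θ)) {ε : ℝ} (hε : 0 < ε)
    (hrate : CrossRate γ β ε) {z : ℝ} {B : ℕ → Fin 2 → Set ℝ}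
    (hB : ∀ᶠ n in atTop, ∀ i, IsWindow (B n i) (level n z)) :
    ∃ C, 0 ≤ C ∧ ∀ᶠ m in atTop, ∀ n, m < n →
      |P.real (rowEvent X m (B m) ∩ rowEvent X n (B n))
          - P.real (rowEvent X m (B m)) * P.real (rowEvent X n (B n))|
        ≤ C * Real.log (Real.log n) ^ (-(1 + ε)) := by
  obtain ⟨η, hη, K, hK, N, hsum⟩ := exists_sum_comparisonTerm_le z hθ.nonneg hθ1 hβ
  obtain ⟨C₁, hC₁, hfar⟩ := hrate.exists_eventually_abs_le hβ0 hε
  have hs : 0 < 1 + ε := by positivity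
  have hsmall : ∀ᶠ n : ℕ in atTop, C₁ * Real.log (Real.log n) ^ (-(1 + ε)) ≤ 1 :=
    (((tendsto_rpow_neg_atTop hs).comp tendsto_log_log_natCast).const_mul C₁).eventually_le_const
      (by simp)
  have hev := eventually_forall_ge_atTop.2 <| ((hB.and hfar).and (hsmall.and
    eventually_log_pos)).and ((eventually_rpow_neg_le_log_log_rpow_neg hη hs.le).and
      (tendsto_log_log_natCast.eventually_ge_atTop 0))
  refine ⟨4 * Real.pi * (√(1 - θ ^ 2))⁻¹ * (K * (1 + C₁)), by positivity, ?_⟩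
  filter_upwards [eventually_ge_atTop N, eventually_ge_atTop 1, hB, hev]
    with m hmN hm1 hBm hm n hmn
  obtain ⟨⟨⟨hBn, hfarn⟩, hsmalln, hlog⟩, hpow, hll⟩ := hm n hmn.le
  set x := Real.log (Real.log n) ^ (-(1 + ε))
  have hq : C₁ * x / Real.log n * Real.log n = C₁ * x := div_mul_cancel₀ _ hlog.ne'
  have hbound := hsum m n hmN hmn.le (fun s t => γ s.2 t.2 (gap s.1 t.1 + 1) m n)
    (C₁ * x / Real.log n) (by positivity) (hq.trans_le hsmalln) (hθ.abs_le hmn)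
    fun s t hst => hfarn m hm1 hmn _ _ _ (hst.trans (Nat.le_succ _)) (gap_add_one_le hmn _ _)
  rw [hq] at hbound
  calc _ ≤ _ := hX.abs_measureReal_inter_rowEvent_sub_mul_le hγ hθ hθ1 hmn hBm hBn
    _ ≤ 4 * Real.pi * (√(1 - θ ^ 2))⁻¹ * (K * ((n : ℝ) ^ (-η) + C₁ * x)) := by gcongr
    _ ≤ 4 * Real.pi * (√(1 - θ ^ 2))⁻¹ * (K * (x + C₁ * x)) := by gcongr
    _ = _ := by ring

end CrossRows

section LogAverages

variable {Ω : Type*} [MeasurableSpace Ω] {P : Measure Ω} {X : ℕ → ℕ → Fin 2 → Ω → ℝ}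
  {ρ₀ : ℕ → ℝ} {ρ : Fin 2 → Fin 2 → ℕ → ℕ → ℝ} {γ : Fin 2 → Fin 2 → ℕ → ℕ → ℕ → ℝ}

theorem ae_tendsto_logAverage_of_eq_rowEvent [IsProbabilityMeasure P]
    (hX : IsStationaryGaussianArray P X ρ₀ ρ)
    {σ α : ℝ} (hσ : IsRowSup ρ σ) (hσ1 : σ < 1) (hα : α < (1 - σ) / (1 + σ))
    (hBerman : BermanCondition ρ α)
    (hγ : HasCrossRowCorr P X γ) {θ β : ℝ} (hθ : IsCrossSup γ θ) (hθ1 : θ < 1)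
    (hβ0 : 0 < β) (hβ : β < (1 - θ) / (1 + θ)) {ε : ℝ} (hε : 0 < ε)
    (hrate : CrossRate γ β ε) {A : ℕ → Set Ω} {B : ℕ → Fin 2 → Set ℝ}
    (hA : ∀ n, 1 ≤ n → A n = rowEvent X n (B n)) (hBm : ∀ n i, MeasurableSet (B n i))
    {z : ℝ} (hB : ∀ᶠ n in atTop, ∀ i, IsWindow (B n i) (level n z)) {p : ℝ}
    (hp : Tendsto (fun n => (bivGaussian (ρ₀ n)).real (B n 0 ×ˢ B n 1) ^ n) atTop (𝓝 p)) :
    ∀ᵐ ω ∂P, Tendsto (fun n => logAverage A n ω) atTop (𝓝 p) := by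
  obtain ⟨C, hC, hcross⟩ :=
    exists_abs_measure_inter_rowEvent_sub_le hX hγ hθ hθ1 hβ0 hβ hε hrate hB
  have hprob : Tendsto (fun n => P.real (rowEvent X n (B n))) atTop (𝓝 p) := by
    simpa using (tendsto_measure_rowEvent_sub_pow hX hσ hσ1 hα hBerman hB).add hp
  filter_upwards [ae_tendsto_logAverage (fun k => hX.nullMeasurableSet_rowEvent k (hBm k)) hprob
    hC hε hcross] with ω hω
  exact hω.congr fun n => (logAverage_congr hA n ω).symm

lemma level_mono {n : ℕ} (h : 0 < Real.log n) : Monotone (level n) := fun _ _ hz =>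
  add_le_add_left (mul_le_mul_of_nonneg_left hz (scaleConst_pos h).le) _

lemma eventually_isWindow_Iic (x y : ℝ) : ∀ᶠ n in atTop, ∀ i : Fin 2,
    IsWindow ((![Set.Iic (level n x), Set.Iic (level n y)] : Fin 2 → Set ℝ) i)
      (level n (min x y)) := by
  filter_upwards [eventually_log_pos, (tendsto_level_atTop (min x y)).eventually_ge_atTop 0]
    with n hlog h0
  have hle {a : ℝ} (ha : min x y ≤ a) : level n (min x y) ≤ |level n a| :=
    (level_mono hlog ha).trans (le_abs_self _)
  exact Fin.forall_fin_two.2 ⟨isWindow_Iic h0 (hle (min_le_left x y)),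
    isWindow_Iic h0 (hle (min_le_right x y))⟩

lemma eventually_isWindow_Ioc (x₁ x₂ y₁ y₂ : ℝ) : ∀ᶠ n in atTop, ∀ i : Fin 2,
    IsWindow ((![Set.Ioc (-level n y₁) (level n x₁), Set.Ioc (-level n y₂) (level n x₂)] :
      Fin 2 → Set ℝ) i) (level n (min (min x₁ x₂) (min y₁ y₂))) := by
  set z := min (min x₁ x₂) (min y₁ y₂) with hz
  filter_upwards [eventually_log_pos, (tendsto_level_atTop z).eventually_ge_atTop 0]
    with n hlog h0
  have hwindow {x y : ℝ} (hx : z ≤ x) (hy : z ≤ y) :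
      IsWindow (Set.Ioc (-level n y) (level n x)) (level n z) := by
    have hzx := level_mono hlog hx
    have hzy := level_mono hlog hy
    exact isWindow_Ioc h0 (hzx.trans (le_abs_self _))
      ((abs_neg (level n y)).symm ▸ hzy.trans (le_abs_self _)) (by linarith)
  exact Fin.forall_fin_two.2 ⟨hwindow (by simp [hz]) (by simp [hz]),
    hwindow (by simp [hz]) (by simp [hz])⟩

lemma tendsto_one_add_mul_log_atTop {lam : ℝ≥0∞} (hlam : Tendsto
    (fun n : ℕ => ENNReal.ofReal ((1 - ρ₀ n) * Real.log n)) atTop (𝓝 (lam ^ 2)))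
    (hfin : lam ≠ ⊤) : Tendsto (fun n : ℕ => (1 + ρ₀ n) * Real.log n) atTop atTop := by
  have hlt : lam ^ 2 < lam ^ 2 + 1 :=
    ENNReal.lt_add_right (ENNReal.pow_ne_top hfin) one_ne_zero
  have hmain : Tendsto (fun n : ℕ => 2 * Real.log n - (lam ^ 2 + 1).toReal) atTop atTop :=
    tendsto_atTop_add_const_right _ _ (tendsto_log_natCast.const_mul_atTop (by norm_num))
  refine tendsto_atTop_mono' _ ?_ hmain
  filter_upwards [hlam.eventually_lt_const hlt] with n hn
  have hle : (1 - ρ₀ n) * Real.log n ≤ (lam ^ 2 + 1).toReal :=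
    (ENNReal.ofReal_le_iff_le_toReal (by finiteness)).1 hn.le
  linarith

end LogAverages

end HuslerReiss

end

open HuslerReiss in
theorem theorem2p2_general {Ω : Type*} [MeasurableSpace Ω] (P : Measure Ω) [IsProbabilityMeasure P]
    (X : ℕ → ℕ → Fin 2 → Ω → ℝ) (ρ₀ : ℕ → ℝ) (ρ : Fin 2 → Fin 2 → ℕ → ℕ → ℝ)
    (γ : Fin 2 → Fin 2 → ℕ → ℕ → ℕ → ℝ) (hX : IsStationaryGaussianArray P X ρ₀ ρ)
    (σ α : ℝ) (hσ : IsRowSup ρ σ) (hσ1 : σ < 1) (hα : α < (1 - σ) / (1 + σ))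
    (hBerman : BermanCondition ρ α) (lam : ℝ≥0∞)
    (hlam : Tendsto (fun n : ℕ => ENNReal.ofReal ((1 - ρ₀ n) * Real.log n)) atTop (𝓝 (lam ^ 2)))
    (hγ : HasCrossRowCorr P X γ) (θ β : ℝ) (hθ : IsCrossSup γ θ) (hθ1 : θ < 1)
    (hβ0 : 0 < β) (hβ : β < (1 - θ) / (1 + θ)) (ε : ℝ) (hε : 0 < ε) (hγrate : CrossRate γ β ε) :
    (∀ x y : ℝ, ∀ᵐ ω ∂P, Tendsto (fun n : ℕ => logAverage (fun k => maxEvent X k x y) n ω)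
      atTop (𝓝 (hrCDF lam x y))) ∧
    ((lam = ⊤ → Tendsto (fun n : ℕ => (1 + ρ₀ n) * Real.log n) atTop atTop) →
      ∀ x₁ x₂ y₁ y₂ : ℝ, ∀ᵐ ω ∂P,
        Tendsto (fun n : ℕ => logAverage (fun k => maxMinEvent X k x₁ x₂ y₁ y₂) n ω)
          atTop (𝓝 (hrCDF lam x₁ x₂ * hrCDF lam y₁ y₂))) := by
  have hρ := hX.eventually_abs_le_one
  refine ⟨fun x y => ?_, fun htop x₁ x₂ y₁ y₂ => ?_⟩
  · exact ae_tendsto_logAverage_of_eq_rowEvent hX hσ hσ1 hα hBerman hγ hθ hθ1 hβ0 hβ hε hγrate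
      (fun _ hn => maxEvent_eq_rowEvent hn x y)
      (fun _ => Fin.forall_fin_two.2 ⟨measurableSet_Iic, measurableSet_Iic⟩)
      (eventually_isWindow_Iic x y) (tendsto_bivGaussian_quadrant_pow hρ hlam x y)
  · have hadd : Tendsto (fun n : ℕ => (1 + ρ₀ n) * Real.log n) atTop atTop := by
      by_cases hlam_top : lam = ⊤
      · exact htop hlam_top
      · exact tendsto_one_add_mul_log_atTop hlam hlam_top
    exact ae_tendsto_logAverage_of_eq_rowEvent hX hσ hσ1 hα hBerman hγ hθ hθ1 hβ0 hβ hε hγrate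
      (fun _ hn => maxMinEvent_eq_rowEvent hn x₁ x₂ y₁ y₂)
      (fun _ => Fin.forall_fin_two.2 ⟨measurableSet_Ioc, measurableSet_Ioc⟩)
      (eventually_isWindow_Ioc x₁ x₂ y₁ y₂) (tendsto_bivGaussian_box_pow hρ hlam hadd x₁ x₂ y₁ y₂)

theorem theorem2p2 {Ω : Type*} [MeasurableSpace Ω] (P : Measure Ω) [IsProbabilityMeasure P]
    (X : ℕ → ℕ → Fin 2 → Ω → ℝ) (ρ₀ : ℕ → ℝ) (ρ : Fin 2 → Fin 2 → ℕ → ℕ → ℝ)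
    (γ : Fin 2 → Fin 2 → ℕ → ℕ → ℕ → ℝ)
    (hX : HuslerReiss.IsStationaryGaussianArray P X ρ₀ ρ)
    (σ α : ℝ) (hσ : HuslerReiss.IsRowSup ρ σ) (hσ1 : σ < 1)
    (hα0 : 0 < α) (hα : α < (1 - σ) / (1 + σ))
    (hBerman : HuslerReiss.BermanCondition ρ α)
    (lam : ℝ≥0∞)
    (hlam : Tendsto (fun n : ℕ => ENNReal.ofReal ((1 - ρ₀ n) * Real.log n)) atTop (𝓝 (lam ^ 2)))
    (hγ : HuslerReiss.HasCrossRowCorr P X γ)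
    (θ β : ℝ) (hθ : HuslerReiss.IsCrossSup γ θ) (hθ1 : θ < 1)
    (hβ0 : 0 < β) (hβ : β < (1 - θ) / (1 + θ))
    (ε : ℝ) (hε : 0 < ε)
    (hρrate : HuslerReiss.RowRate ρ α ε) (hγrate : HuslerReiss.CrossRate γ β ε) :
    (∀ x y : ℝ, ∀ᵐ ω ∂P,
      Tendsto (fun n : ℕ => HuslerReiss.logAverage (fun k => HuslerReiss.maxEvent X k x y) n ω)
        atTop (𝓝 (HuslerReiss.hrCDF lam x y))) ∧
    ((lam = ⊤ → Tendsto (fun n : ℕ => (1 + ρ₀ n) * Real.log n) atTop atTop) →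
      ∀ x₁ x₂ y₁ y₂ : ℝ, ∀ᵐ ω ∂P,
        Tendsto
          (fun n : ℕ =>
            HuslerReiss.logAverage (fun k => HuslerReiss.maxMinEvent X k x₁ x₂ y₁ y₂) n ω)
          atTop (𝓝 (HuslerReiss.hrCDF lam x₁ x₂ * HuslerReiss.hrCDF lam y₁ y₂))) :=
  theorem2p2_general P X ρ₀ ρ γ hX σ α hσ hσ1 hα hBerman lam hlam hγ θ β hθ hθ1 hβ0 hβ ε hε
    hγrate
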